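/- **Setting.** Fix $d\ge 1$. For finite $\Lambda\subset\mathbb Z$ let $\mathfrak A_\Lambda=\mathcal B(\bigotimes_{x\in\Lambda}\mathbb C^d)$ with the operator norm $\|\cdot\|$; for $\Lambda'\subset\Lambda$ identify $Q\in\mathfrak A_{\Lambda'}$ with $Q\otimes\mathbb 1_{\Lambda\setminus\Lambda'}\in\mathfrak A_\Lambda$. A local interaction $\Phi=(\Phi_X)_X$ assigns to every finite $X\subset\mathbb Z$ a self-adjoint $\Phi_X\in\mathfrak A_X$. It has range $r>0$ and strength $J>0$ if $\Phi_X=0$ whenever $\operatorname{diam}(X)>r$ and $\|\Phi_X\|\le J$ for all $X$. Put $H_\Lambda=\sum_{X\subset\Lambda}\Phi_X$ and $\rho^\Lambda=e^{-H_\Lambda}/\operatorname{Tr}(e^{-H_\Lambda})$. For a state $\rho$ on $I$ and $X\subset I$, let $\rho_X=\operatorname{tr}_{I\setminus X}(\rho)$ be the (unnormalized) partial trace, and for disjoint $A,C\subset I$ let $$\operatorname{Corr}_\rho(A:C)=\sup_{\|O_A\|=\|O_C\|=1}\big|\operatorname{Tr}\big[O_A\otimes O_C\,(\rho_{AC}-\rho_A\otimes\rho_C)\big]\big|,\qquad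 O_A\in\mathfrak A_A,\ O_C\in\mathfrak A_C.$$ For $\widetilde{\mathcal K},\widetilde\alpha>0$, $\Phi$ satisfies exponential uniform clustering with constants $\widetilde{\mathcal K},\widetilde\alpha$ if for every finite interval $I\subset\mathbb Z$ split into three consecutive (possibly empty) subintervals $I=ABC$ and every $\ell\ge 0$ with $|B|\ge\ell$ one has $\operatorname{Corr}_{\rho^I}(A:C)\le\widetilde{\mathcal K}e^{-\widetilde\alpha\ell}$. **Proposition 8.1.** For all $d\ge 1$ and $r,J,\widetilde{\mathcal K},\widetilde\alpha>0$ there are constants $\widehat{\mathcal K},\widehat\alpha>0$, depending only on $d,r,J,\widetilde{\mathcal K},\widetilde\alpha$, such that the following holds for every local interaction $\Phi$ of range $r$ and strength $J$ with local dimension $d$ that satisfies exponential uniform clustering with constants $\widetilde{\mathcal K},\widetilde\alpha$. For each finite interval $I\subset\mathbb Z$ split into three consecutive (possibly empty) subintervals $I=ABC$ with $|B|\ge 3\ell\ge 0$, and for $\rho=\rho^I$ the Gibbs state on $I$, $$\big\|\rho_A^{-1}\rho_C^{-1}\rho_{AC}-\mathbb 1\big\|\le\widehat{\mathcal K}\,e^{-\widehat\alpha\ell}.$$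 -/

import Mathlib

open scoped Matrix.Norms.L2Operator

noncomputable section

namespace SpinChain

/-- The algebra `𝔄_X = B(⨂_{x ∈ X} ℂ^d)` of observables on a finite set `X ⊂ ℤ` of sites, written as
matrices in the product basis (the basis vectors are the configurations `X → Fin d`).
The norm is the operator norm for the Euclidean norm. -/
abbrev Observable (d : ℕ) (X : Finset ℤ) : Type :=
  Matrix (X → Fin d) (X → Fin d) ℂ

/-- The canonical embedding `𝔄_X → 𝔄_Λ`, `Q ↦ Q ⊗ 𝟙_{Λ \ X}`, for `X ⊆ Λ`. -/
def embed {d : ℕ} {X Λ : Finset ℤ} (h : X ⊆ Λ) (Q : Observable d X) : Observable d Λ :=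
  Matrix.of fun σ τ =>
    if ∀ x : Λ, x.1 ∉ X → σ x = τ x then
      Q (Finset.restrict₂ (π := fun _ => Fin d) h σ) (Finset.restrict₂ (π := fun _ => Fin d) h τ)
    else 0

/-- The configuration on `Λ` that is `σ` on `X` and `η` on `Λ \ X`. -/
def glue {d : ℕ} {X Λ : Finset ℤ} (σ : X → Fin d) (η : (Λ \ X : Finset ℤ) → Fin d) : Λ → Fin d :=
  fun x => if hx : x.1 ∈ X then σ ⟨x.1, hx⟩ else η ⟨x.1, Finset.mem_sdiff.2 ⟨x.2, hx⟩⟩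

/-- The reduction of `Q ∈ 𝔄_Λ` to `X ⊆ Λ`: the unnormalized partial trace over `Λ \ X`,
`R ⊗ S ↦ Tr(S) R` for `R ∈ 𝔄_X`, `S ∈ 𝔄_{Λ \ X}`. -/
def reduce {d : ℕ} {Λ : Finset ℤ} (X : Finset ℤ) (Q : Observable d Λ) : Observable d X :=
  Matrix.of fun σ τ => ∑ η : (Λ \ X : Finset ℤ) → Fin d, Q (glue σ η) (glue τ η)

/-- A local interaction on `ℤ`: a self-adjoint `Φ_X ∈ 𝔄_X` for every finite `X ⊂ ℤ`. -/
structure LocalInteraction (d : ℕ) where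
  /-- The interaction terms. -/
  term : (X : Finset ℤ) → Observable d X
  isHermitian : ∀ X, (term X).IsHermitian

/-- `Φ_X = 0` whenever the diameter of `X` is larger than `r`. -/
def LocalInteraction.HasRange {d : ℕ} (Φ : LocalInteraction d) (r : ℝ) : Prop :=
  ∀ X : Finset ℤ, r < Metric.diam (X : Set ℤ) → Φ.term X = 0

/-- `‖Φ_X‖ ≤ J` for all `X`. -/
def LocalInteraction.HasStrength {d : ℕ} (Φ : LocalInteraction d) (J : ℝ) : Prop :=
  ∀ X : Finset ℤ, ‖Φ.term X‖ ≤ J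

/-- The Hamiltonian `H_Λ = ∑_{X ⊆ Λ} Φ_X`. -/
def LocalInteraction.hamiltonian {d : ℕ} (Φ : LocalInteraction d) (Λ : Finset ℤ) :
    Observable d Λ :=
  ∑ X ∈ Λ.powerset.attach, embed (Finset.mem_powerset.1 X.2) (Φ.term X.1)

/-- The Gibbs state `ρ^Λ = e^{-H_Λ} / Tr(e^{-H_Λ})`. -/
def LocalInteraction.gibbs {d : ℕ} (Φ : LocalInteraction d) (Λ : Finset ℤ) : Observable d Λ :=
  (NormedSpace.exp (-Φ.hamiltonian Λ)).trace⁻¹ • NormedSpace.exp (-Φ.hamiltonian Λ)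

/-- The covariance correlation
`Corr_ρ(A : C) = sup |Tr[(O_A ⊗ O_C) (ρ_{AC} - ρ_A ⊗ ρ_C)]|`, the supremum over all `O_A ∈ 𝔄_A` and
`O_C ∈ 𝔄_C` of operator norm one, for disjoint `A, C ⊆ Λ`. -/
def corr {d : ℕ} {Λ : Finset ℤ} (ρ : Observable d Λ) (A C : Finset ℤ) : ℝ :=
  sSup {t : ℝ | ∃ (QA : Observable d A) (QC : Observable d C), ‖QA‖ = 1 ∧ ‖QC‖ = 1 ∧
    t = ‖Matrix.trace
      (embed (Finset.subset_union_left (s₁ := A) (s₂ := C)) QA *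
        embed (Finset.subset_union_right (s₁ := A) (s₂ := C)) QC *
        (reduce (A ∪ C) ρ -
          embed (Finset.subset_union_left (s₁ := A) (s₂ := C)) (reduce A ρ) *
            embed (Finset.subset_union_right (s₁ := A) (s₂ := C)) (reduce C ρ)))‖}

/-- The embedding is linear. -/
def embedLin {d : ℕ} {X Λ : Finset ℤ} (h : X ⊆ Λ) : Observable d X →ₗ[ℂ] Observable d Λ where
  toFun := embed h
  map_add' P Q := by
    ext σ τ
    simp only [embed, Matrix.of_apply, Matrix.add_apply]
    split_ifs <;> simp
  map_smul' c Q := by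
    ext σ τ
    simp [embed]

/-- The set in the definition of `corr` is bounded, so that its `sSup` is a genuine supremum. -/
theorem le_corr {d : ℕ} {Λ : Finset ℤ} (ρ : Observable d Λ) (A C : Finset ℤ)
    (QA : Observable d A) (QC : Observable d C) (hA : ‖QA‖ = 1) (hC : ‖QC‖ = 1) :
    ‖Matrix.trace
      (embed (Finset.subset_union_left (s₁ := A) (s₂ := C)) QA *
        embed (Finset.subset_union_right (s₁ := A) (s₂ := C)) QC *
        (reduce (A ∪ C) ρ -
          embed (Finset.subset_union_left (s₁ := A) (s₂ := C)) (reduce A ρ) *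
            embed (Finset.subset_union_right (s₁ := A) (s₂ := C)) (reduce C ρ)))‖
      ≤ corr ρ A C := by
  refine le_csSup ?_ ⟨QA, QC, hA, hC, rfl⟩
  set D := (reduce (A ∪ C) ρ -
          embed (Finset.subset_union_left (s₁ := A) (s₂ := C)) (reduce A ρ) *
            embed (Finset.subset_union_right (s₁ := A) (s₂ := C)) (reduce C ρ)) with hD
  let tr : Observable d (A ∪ C) →L[ℂ] ℂ :=
    LinearMap.toContinuousLinearMap (Matrix.traceLinearMap (↥(A ∪ C) → Fin d) ℂ ℂ)
  let eA : Observable d A →L[ℂ] Observable d (A ∪ C) :=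
    LinearMap.toContinuousLinearMap (embedLin Finset.subset_union_left)
  let eC : Observable d C →L[ℂ] Observable d (A ∪ C) :=
    LinearMap.toContinuousLinearMap (embedLin Finset.subset_union_right)
  refine ⟨‖tr‖ * (‖eA‖ * ‖eC‖ * ‖D‖), ?_⟩
  rintro t ⟨PA, PC, hPA, hPC, rfl⟩
  have h1 : ‖eA PA‖ ≤ ‖eA‖ := by simpa [hPA] using eA.le_opNorm PA
  have h2 : ‖eC PC‖ ≤ ‖eC‖ := by simpa [hPC] using eC.le_opNorm PC
  calc ‖tr (eA PA * eC PC * D)‖ ≤ ‖tr‖ * ‖eA PA * eC PC * D‖ := tr.le_opNorm _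
    _ ≤ ‖tr‖ * (‖eA PA‖ * ‖eC PC‖ * ‖D‖) := by
        gcongr
        exact (norm_mul_le _ _).trans (by gcongr; exact norm_mul_le _ _)
    _ ≤ _ := by gcongr

/-- `Φ` is uniform clustering with the positive and decreasing function `ε`: for every finite
interval `I = ABC` split into subintervals `A = [a, b)`, `B = [b, c)`, `C = [c, e)` with `|B| ≥ ℓ`,
the Gibbs state on `I` has `Corr(A : C) ≤ ε(ℓ)`. -/
structure LocalInteraction.UniformClustering {d : ℕ} (Φ : LocalInteraction d) (ε : ℝ → ℝ) :
    Prop where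
  pos : ∀ ℓ, 0 ≤ ℓ → 0 < ε ℓ
  anti : AntitoneOn ε (Set.Ici 0)
  corr_le : ∀ a b c e : ℤ, a ≤ b → b ≤ c → c ≤ e →
    ∀ ℓ : ℝ, 0 ≤ ℓ → ℓ ≤ (Finset.Ico b c).card →
      corr (Φ.gibbs (Finset.Ico a e)) (Finset.Ico a b) (Finset.Ico c e) ≤ ε ℓ

/-- The reduced operator `ρ_X = tr_{Λ \ X}(ρ)`, regarded as an element of `𝔄_Λ`. -/
def reduced {d : ℕ} {Λ X : Finset ℤ} (h : X ⊆ Λ) (ρ : Observable d Λ) : Observable d Λ :=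
  embed h (reduce X ρ)

end SpinChain

end

set_option linter.unusedSectionVars false

/-! Write H_0 = H_A + H_B + H_C and e^{-H_I} = e^{-H_0} E with the expansional E = e^{H_0} e^{-H_I}.
Let w be the average of E over the Gibbs state of B, p the average of w over that of C, q the
average of w over that of A, and κ = Z_A Z_B Z_C / Z_I. Then ρ_{AC}, ρ_A and ρ_C are, up to scalars,
e^{-H_A} e^{-H_C} w, e^{-H_A} p and e^{-H_C} q. The factors e^{-H_A} and e^{-H_C} cancel, and
ρ_A^{-1} ρ_C^{-1} ρ_{AC} - 1 = κ^{-1} p^{-1} q^{-1} (w - κ q p) (`IsPartition.norm_mixing_le`). It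
remains to bound κ^{-1}, p^{-1}, q^{-1} uniformly and to show that w - κ q p is exponentially small.

All of this rests on Araki's one-dimensional estimate (`norm_evolve_succ_sub_le`): the imaginary
time evolution of the terms crossing the two cuts is bounded uniformly in the interval, and the
interaction at distance nR from the cuts changes it by at most C_t / t^n, for every t ≥ 1. Hence E
is bounded, which bounds κ and κ^{-1}, and E is close to the expansional of an interval in which A
and C are shortened to about nR sites. Averaging over a Gibbs state is a contraction
(`norm_thermal_le`), so w, p and q inherit this.

Invertibility of p (`exists_uniform_inv`): if A has m sites, positivity of the partial trace bounds
p^{-1} by a constant times e^{O(m)}. The truncation error decays faster than any exponential, so for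
some fixed n a Neumann series carries the bound over to every A. The same works for q.

Factorization of w (`IsLocal.norm_averaged_sub_ratio_smul_le`): when A and C have m sites, w - κ p q
is ρ_{AC} - ρ_A ρ_C multiplied by operators and scalars of total size e^{O(m)}, so clustering bounds
it by e^{O(m)} e^{-αℓ}. Taking m to be a small multiple of ℓ makes this and the truncation error
exponentially small. Thus w is close to some product P Q. Averaging P Q shows that P and Q are p and
q up to scalars, and that these scalars combine to κ. -/

namespace SpinChain

/-! ### Imaginary time evolution and expansionals in a Banach algebra. -/

section Evolution

variable {𝔐 : Type*} [NormedRing 𝔐] [NormedAlgebra ℝ 𝔐] [CompleteSpace 𝔐] [NormOneClass 𝔐]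

open NormedSpace in
theorem norm_exp_le (x : 𝔐) : ‖exp x‖ ≤ Real.exp ‖x‖ := by
  rw [exp_eq_tsum ℝ, Real.exp_eq_exp_ℝ, exp_eq_tsum ℝ]
  refine tsum_of_norm_bounded (expSeries_summable' (𝕂 := ℝ) ‖x‖).hasSum fun n => ?_
  rw [norm_smul, smul_eq_mul, norm_inv, Real.norm_natCast]
  gcongr
  exact norm_pow_le x n

theorem norm_exp_smul_le {s c : ℝ} (hs : 0 ≤ s) {x : 𝔐} (hx : ‖x‖ ≤ c) :
    ‖NormedSpace.exp (s • x)‖ ≤ Real.exp (s * c) := by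
  refine (norm_exp_le _).trans (Real.exp_le_exp.2 ?_)
  rw [norm_smul, Real.norm_of_nonneg hs]
  gcongr

theorem exp_smul_mul_exp_neg_smul (s : ℝ) (H : 𝔐) :
    NormedSpace.exp (s • H) * NormedSpace.exp ((-s) • H) = 1 := by
  let := NormedAlgebra.restrictScalars ℚ ℝ 𝔐
  rw [← NormedSpace.exp_add_of_commute (((Commute.refl H).smul_left s).smul_right (-s)),
    ← add_smul, add_neg_cancel, zero_smul, NormedSpace.exp_zero]

theorem exp_neg_smul_mul_exp_smul (s : ℝ) (H : 𝔐) :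
    NormedSpace.exp ((-s) • H) * NormedSpace.exp (s • H) = 1 := by
  simpa using exp_smul_mul_exp_neg_smul (-s) H

/-- The imaginary time evolution `e^{sH} V e^{-sH}`. -/
noncomputable def evolve (s : ℝ) (H V : 𝔐) : 𝔐 :=
  NormedSpace.exp (s • H) * V * NormedSpace.exp ((-s) • H)

theorem evolve_zero (H V : 𝔐) : evolve 0 H V = V := by
  simp [evolve]

theorem norm_evolve_le {s c : ℝ} (hs : 0 ≤ s) {H : 𝔐} (hH : ‖H‖ ≤ c) (V : 𝔐) :
    ‖evolve s H V‖ ≤ Real.exp (2 * s * c) * ‖V‖ := by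
  have h1 := norm_exp_smul_le hs hH
  have h2 : ‖NormedSpace.exp ((-s) • H)‖ ≤ Real.exp (s * c) := by
    have := norm_exp_smul_le hs (x := -H) (c := c) (by simpa using hH)
    simpa using this
  calc ‖evolve s H V‖ ≤ ‖NormedSpace.exp (s • H)‖ * ‖V‖ * ‖NormedSpace.exp ((-s) • H)‖ :=
        (norm_mul_le _ _).trans (by gcongr; exact norm_mul_le _ _)
    _ ≤ Real.exp (s * c) * ‖V‖ * Real.exp (s * c) := by gcongr
    _ = Real.exp (2 * s * c) * ‖V‖ := by
        rw [show 2 * s * c = s * c + s * c by ring, Real.exp_add]; ring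

theorem commute_evolve {D H V : 𝔐} (s : ℝ) (hH : Commute D H) (hV : Commute D V) :
    Commute D (evolve s H V) :=
  (((hH.smul_right s).exp_right).mul_right hV).mul_right ((hH.smul_right (-s)).exp_right)

theorem hasDerivAt_exp_neg_smul (H : 𝔐) (u : ℝ) :
    HasDerivAt (fun u : ℝ => NormedSpace.exp ((-u) • H)) (-(H * NormedSpace.exp ((-u) • H))) u := by
  simpa [neg_smul, Function.comp_def] using
    (hasDerivAt_exp_smul_const' (𝕂 := ℝ) H (-u)).scomp u (hasDerivAt_neg u)

theorem hasDerivAt_exp_neg_smul' (H : 𝔐) (u : ℝ) :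
    HasDerivAt (fun u : ℝ => NormedSpace.exp ((-u) • H)) (-(NormedSpace.exp ((-u) • H) * H)) u := by
  simpa [neg_smul, Function.comp_def] using
    (hasDerivAt_exp_smul_const (𝕂 := ℝ) H (-u)).scomp u (hasDerivAt_neg u)

theorem hasDerivAt_evolve (H V : 𝔐) (u : ℝ) :
    HasDerivAt (fun u => evolve u H V) (H * evolve u H V - evolve u H V * H) u := by
  have h := ((hasDerivAt_exp_smul_const' (𝕂 := ℝ) H u).mul_const V).mul
    (hasDerivAt_exp_neg_smul' H u)
  refine h.congr_deriv ?_
  simp only [evolve]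
  noncomm_ring

/-- Duhamel: comparison of the evolutions generated by `H` and `H'`. -/
theorem hasDerivAt_evolve_evolve (H H' V : 𝔐) (s u : ℝ) :
    HasDerivAt (fun u => evolve (s - u) H' (evolve u H V))
      (-evolve (s - u) H'
        ((H' - H) * evolve u H V - evolve u H V * (H' - H))) u := by
  have hsub : HasDerivAt (fun u : ℝ => s - u) (-1) u := by
    simpa using (hasDerivAt_id u).const_sub s
  have h1 := (hasDerivAt_exp_smul_const (𝕂 := ℝ) H' (s - u)).scomp u hsub
  have h2 := (hasDerivAt_exp_neg_smul H' (s - u)).scomp u hsub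
  have h := (h1.mul (hasDerivAt_evolve H V u)).mul h2
  refine h.congr_deriv ?_
  simp only [evolve, Function.comp_apply, Pi.mul_apply]
  generalize NormedSpace.exp ((s - u) • H') = a
  generalize NormedSpace.exp ((-(s - u)) • H') = b
  generalize NormedSpace.exp (u • H) * V * NormedSpace.exp ((-u) • H) = w
  simp only [neg_smul, one_smul, neg_neg]
  noncomm_ring

/-- The path u ↦ `evolve (s - u) H' (evolve u H V)` joins the two evolutions, and its derivative
involves only the commutator with H' - H. The function B is a majorant of the integral of this
derivative, to be chosen by the user. -/
theorem norm_evolve_sub_evolve_le {H H' V : 𝔐} {s : ℝ} (hs : 0 ≤ s) {B B' : ℝ → ℝ} (hB0 : 0 ≤ B 0)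
    (hB : ∀ u, HasDerivAt B (B' u) u)
    (hbd : ∀ u ∈ Set.Ico 0 s, ‖evolve (s - u) H'
      ((H' - H) * evolve u H V - evolve u H V * (H' - H))‖ ≤ B' u) :
    ‖evolve s H' V - evolve s H V‖ ≤ B s := by
  let f : ℝ → 𝔐 := fun u => evolve s H' V - evolve (s - u) H' (evolve u H V)
  have hf : ∀ u, HasDerivAt f (evolve (s - u) H'
      ((H' - H) * evolve u H V - evolve u H V * (H' - H))) u := fun u => by
    simpa [f] using (hasDerivAt_evolve_evolve H H' V s u).const_sub (evolve s H' V)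
  have := image_norm_le_of_norm_deriv_right_le_deriv_boundary (f := f) (a := 0) (b := s)
    (fun u _ => (hf u).continuousAt.continuousWithinAt) (fun u _ => (hf u).hasDerivWithinAt)
    (by simpa [f, evolve_zero] using hB0) hB hbd (Set.right_mem_Icc.2 hs)
  simpa [f, evolve_zero] using this

theorem norm_commutator_le (D W : 𝔐) {c w : ℝ} (hD : ‖D‖ ≤ c) (hW : ‖W‖ ≤ w) :
    ‖D * W - W * D‖ ≤ 2 * c * w := by
  have hc := (norm_nonneg D).trans hD
  calc ‖D * W - W * D‖ ≤ ‖D‖ * ‖W‖ + ‖W‖ * ‖D‖ :=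
        (norm_sub_le _ _).trans (add_le_add (norm_mul_le _ _) (norm_mul_le _ _))
    _ ≤ c * w + w * c := by
        have hw := (norm_nonneg W).trans hW
        gcongr
    _ = 2 * c * w := by ring

/-- Araki's estimate: along an exhaustion `H 0, H 1, …` whose increments are bounded and commute
with everything two steps before, the imaginary time evolution converges like a series `q ^ k / k!`. -/
theorem norm_evolve_succ_sub_le {H : ℕ → 𝔐} {V : 𝔐} {c : ℝ} (hc : 0 ≤ c)
    (hH : ∀ k, ‖H k‖ ≤ c * (k + 1)) (hD : ∀ k, ‖H (k + 1) - H k‖ ≤ c)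
    (hHH : ∀ k, Commute (H (k + 2) - H (k + 1)) (H k)) (hHV : ∀ k, Commute (H (k + 2) - H (k + 1)) V)
    (k : ℕ) : ∀ s : ℝ, 0 ≤ s → ‖evolve s (H (k + 1)) V - evolve s (H k) V‖ ≤
      ‖V‖ * Real.exp (2 * c * (k + 2) * s) * ((2 * c * s) ^ (k + 1) / (k + 1).factorial) := by
  -- Each majorant is a primitive of 2c times the preceding one. The exponential weight M is frozen
  -- at the final time s, so that only a power of u has to be differentiated.
  have hder : ∀ (m : ℕ) (M u : ℝ), HasDerivAt
      (fun u : ℝ => M * ((2 * c * u) ^ (m + 1) / (m + 1).factorial))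
      (M * (2 * c * ((2 * c * u) ^ m / m.factorial))) u := fun m M u => by
    have h := (((hasDerivAt_id u).const_mul (2 * c)).pow (m + 1)).div_const
      ((m + 1).factorial : ℝ) |>.const_mul M
    refine h.congr_deriv ?_
    have : (m.factorial : ℝ) ≠ 0 := by positivity
    rw [Nat.factorial_succ]
    push_cast
    simp only [id, mul_one]
    field_simp
  induction k with
  | zero =>
    intro s hs
    refine norm_evolve_sub_evolve_le hs (by simp) (hder 0 _) fun u hu => ?_
    have h1 : ‖evolve u (H 0) V‖ ≤ Real.exp (2 * u * c) * ‖V‖ :=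
      norm_evolve_le hu.1 (by simpa using hH 0) V
    refine (norm_evolve_le (sub_nonneg.2 hu.2.le) (hH 1) _).trans ?_
    calc _ ≤ Real.exp (2 * (s - u) * (c * ((1 : ℕ) + 1))) * (2 * c * (Real.exp (2 * u * c) * ‖V‖)) := by
          gcongr
          exact norm_commutator_le _ _ (hD 0) h1
      _ = 2 * c * ‖V‖ * Real.exp (2 * (s - u) * (c * ((1 : ℕ) + 1)) + 2 * u * c) := by
          rw [Real.exp_add]; ring
      _ ≤ 2 * c * ‖V‖ * Real.exp (2 * c * ((0 : ℕ) + 2) * s) := by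
          gcongr
          push_cast
          nlinarith [mul_nonneg hc hu.1]
      _ = _ := by simp; ring
  | succ k ih =>
    intro s hs
    refine norm_evolve_sub_evolve_le hs (by simp) (hder (k + 1) _) fun u hu => ?_
    have h1 := ih u hu.1
    -- The increment commutes with H k and V, hence with `evolve u (H k) V`, which may therefore be
    -- subtracted inside the commutator. This brings in the induction hypothesis and one more factor
    -- 2c and integration.
    have h2 : (H (k + 1 + 1) - H (k + 1)) * evolve u (H (k + 1)) V
          - evolve u (H (k + 1)) V * (H (k + 1 + 1) - H (k + 1)) =
        (H (k + 1 + 1) - H (k + 1)) * (evolve u (H (k + 1)) V - evolve u (H k) V)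
          - (evolve u (H (k + 1)) V - evolve u (H k) V) * (H (k + 1 + 1) - H (k + 1)) := by
      have := (commute_evolve u (hHH k) (hHV k)).eq
      simp only [add_assoc, one_add_one_eq_two] at *
      linear_combination (norm := noncomm_ring) this
    rw [h2]
    refine (norm_evolve_le (sub_nonneg.2 hu.2.le) (hH (k + 2)) _).trans ?_
    have hu0 := hu.1
    calc _ ≤ Real.exp (2 * (s - u) * (c * ((k + 2 : ℕ) + 1))) * (2 * c * (‖V‖ *
            Real.exp (2 * c * (k + 2) * u) * ((2 * c * u) ^ (k + 1) / (k + 1).factorial))) := by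
          gcongr
          exact norm_commutator_le _ _ (hD (k + 1)) h1
      _ = ‖V‖ * Real.exp (2 * (s - u) * (c * ((k + 2 : ℕ) + 1)) + 2 * c * (k + 2) * u) *
            (2 * c * ((2 * c * u) ^ (k + 1) / (k + 1).factorial)) := by
          rw [Real.exp_add]; ring
      _ ≤ _ := by
          gcongr
          push_cast
          nlinarith [mul_nonneg hc hu.1]

/-- Only indices k + 1 > n occur, so t^n ≤ t^(k+1) can be absorbed into the exponential series of q
t. As t is free, the tail decays faster than any exponential in n. -/
theorem sum_Ico_pow_succ_div_factorial_le {q t : ℝ} (hq : 0 ≤ q) (ht : 1 ≤ t) (n m : ℕ) :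
    ∑ k ∈ Finset.Ico n m, q ^ (k + 1) / (k + 1).factorial ≤ Real.exp (q * t) / t ^ n := by
  have ht0 : 0 < t := one_pos.trans_le ht
  rw [le_div_iff₀ (by positivity), Finset.sum_mul]
  have h1 : ∀ k ∈ Finset.Ico n m, q ^ (k + 1) / (k + 1).factorial * t ^ n ≤
      (q * t) ^ (k + 1) / (k + 1).factorial := fun k hk => by
    rw [mul_pow, div_mul_eq_mul_div]
    have hk := (Finset.mem_Ico.1 hk).1
    gcongr
    omega
  refine (Finset.sum_le_sum h1).trans ?_
  refine le_trans ?_ (Real.sum_le_exp_of_nonneg (by positivity : 0 ≤ q * t) (m + 1))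
  rw [Finset.sum_range_succ' _ m, Finset.range_eq_Ico]
  refine le_add_of_le_of_nonneg (Finset.sum_le_sum_of_subset_of_nonneg
    (Finset.Ico_subset_Ico_left (Nat.zero_le n)) fun _ _ _ => by positivity) (by positivity)

theorem norm_evolve_sub_evolve_le_div_pow {H : ℕ → 𝔐} {V : 𝔐} {c : ℝ} (hc : 0 ≤ c)
    (hH : ∀ k, ‖H k‖ ≤ c * (k + 1)) (hD : ∀ k, ‖H (k + 1) - H k‖ ≤ c)
    (hHH : ∀ k, Commute (H (k + 2) - H (k + 1)) (H k)) (hHV : ∀ k, Commute (H (k + 2) - H (k + 1)) V)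
    {t : ℝ} (ht : 1 ≤ t) {s : ℝ} (hs : 0 ≤ s) (hs1 : s ≤ 1) {n m : ℕ} (hnm : n ≤ m) :
    ‖evolve s (H m) V - evolve s (H n) V‖ ≤
      ‖V‖ * Real.exp (2 * c) * (Real.exp (2 * c * Real.exp (2 * c) * t) / t ^ n) := by
  -- The weight e^{2c(k+2)} is geometric in k: it equals e^{2c} (e^{2c})^{k+1} and only enlarges the
  -- base of the power over the factorial.
  set q := 2 * c * Real.exp (2 * c)
  have h1 : ∀ k ∈ Finset.Ico n m, ‖evolve s (H (k + 1)) V - evolve s (H k) V‖ ≤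
      ‖V‖ * Real.exp (2 * c) * (q ^ (k + 1) / (k + 1).factorial) := fun k _ => by
    refine (norm_evolve_succ_sub_le hc hH hD hHH hHV k s hs).trans ?_
    calc _ ≤ ‖V‖ * Real.exp (2 * c * (k + 2) * 1) * ((2 * c * 1) ^ (k + 1) / (k + 1).factorial) := by
          gcongr
      _ = _ := by
          have : Real.exp (2 * c * (k + 2) * 1) = Real.exp (2 * c) * Real.exp (2 * c) ^ (k + 1) := by
            rw [← Real.exp_nat_mul, ← Real.exp_add]
            congr 1
            push_cast
            ring
          rw [this, mul_pow]
          ring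
  rw [← Finset.sum_Ico_sub (fun k => evolve s (H k) V) hnm]
  refine (norm_sum_le _ _).trans ((Finset.sum_le_sum h1).trans ?_)
  rw [← Finset.mul_sum]
  gcongr
  exact sum_Ico_pow_succ_div_factorial_le (by positivity) ht n m

theorem norm_evolve_le_of_exhaustion {H : ℕ → 𝔐} {V : 𝔐} {c : ℝ} (hc : 0 ≤ c)
    (hH : ∀ k, ‖H k‖ ≤ c * (k + 1)) (hD : ∀ k, ‖H (k + 1) - H k‖ ≤ c)
    (hHH : ∀ k, Commute (H (k + 2) - H (k + 1)) (H k)) (hHV : ∀ k, Commute (H (k + 2) - H (k + 1)) V)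
    {s : ℝ} (hs : 0 ≤ s) (hs1 : s ≤ 1) (m : ℕ) :
    ‖evolve s (H m) V‖ ≤ ‖V‖ * Real.exp (2 * c) * (1 + Real.exp (2 * c * Real.exp (2 * c))) := by
  have h1 := norm_evolve_sub_evolve_le_div_pow hc hH hD hHH hHV le_rfl hs hs1 (Nat.zero_le m)
  have h2 : ‖evolve s (H 0) V‖ ≤ Real.exp (2 * c) * ‖V‖ :=
    (norm_evolve_le hs (by simpa using hH 0) V).trans (by gcongr; nlinarith)
  have h3 := norm_le_norm_add_norm_sub' (evolve s (H m) V) (evolve s (H 0) V)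
  simp only [mul_one, pow_zero, div_one] at h1
  linarith

/-! ### Expansionals -/

/-- The generator is the evolved V alone. Grönwall's inequality then controls the expansional
without reference to the norm of H, which grows with the interval. -/
theorem hasDerivAt_expansional (H V : 𝔐) (s : ℝ) :
    HasDerivAt (fun s : ℝ => NormedSpace.exp (s • H) * NormedSpace.exp ((-s) • (H + V)))
      (-(evolve s H V * (NormedSpace.exp (s • H) * NormedSpace.exp ((-s) • (H + V))))) s := by
  have h := (hasDerivAt_exp_smul_const (𝕂 := ℝ) H s).mul (hasDerivAt_exp_neg_smul (H + V) s)
  refine h.congr_deriv ?_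
  have h1 := exp_neg_smul_mul_exp_smul s H
  rw [evolve, mul_assoc (NormedSpace.exp (s • H) * V), ← mul_assoc (NormedSpace.exp ((-s) • H)), h1,
    one_mul]
  noncomm_ring

theorem hasDerivAt_expansional_inv (H V : 𝔐) (s : ℝ) :
    HasDerivAt (fun s : ℝ => NormedSpace.exp (s • (H + V)) * NormedSpace.exp ((-s) • H))
      (NormedSpace.exp (s • (H + V)) * NormedSpace.exp ((-s) • H) * evolve s H V) s := by
  have h := (hasDerivAt_exp_smul_const (𝕂 := ℝ) (H + V) s).mul (hasDerivAt_exp_neg_smul H s)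
  refine h.congr_deriv ?_
  have h1 := exp_neg_smul_mul_exp_smul s H
  rw [evolve, mul_assoc _ (NormedSpace.exp ((-s) • H)), ← mul_assoc (NormedSpace.exp ((-s) • H)),
    ← mul_assoc (NormedSpace.exp ((-s) • H)), h1, one_mul]
  noncomm_ring

theorem norm_le_exp_of_deriv {f f' : ℝ → 𝔐} {g : ℝ} (hf : ∀ s, HasDerivAt f (f' s) s) (h0 : f 0 = 1)
    (hf' : ∀ s, 0 ≤ s → s ≤ 1 → ‖f' s‖ ≤ g * ‖f s‖) {s : ℝ} (hs : 0 ≤ s) (hs1 : s ≤ 1) (hg : 0 ≤ g) :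
    ‖f s‖ ≤ Real.exp g := by
  have := norm_le_gronwallBound_of_norm_deriv_right_le (f := f) (f' := f') (δ := 1) (K := g) (ε := 0)
    (a := 0) (b := 1) (fun u _ => (hf u).continuousAt.continuousWithinAt)
    (fun u _ => (hf u).hasDerivWithinAt) (by simp [h0])
    (fun u hu => by simpa using hf' u hu.1 hu.2.le) s ⟨hs, hs1⟩
  rw [gronwallBound_ε0, one_mul, sub_zero] at this
  exact this.trans (Real.exp_le_exp.2 (by nlinarith))

theorem norm_expansional_le {H V : 𝔐} {g : ℝ} (hg : 0 ≤ g)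
    (h : ∀ s, 0 ≤ s → s ≤ 1 → ‖evolve s H V‖ ≤ g) {s : ℝ} (hs : 0 ≤ s) (hs1 : s ≤ 1) :
    ‖NormedSpace.exp (s • H) * NormedSpace.exp ((-s) • (H + V))‖ ≤ Real.exp g := by
  refine norm_le_exp_of_deriv (hasDerivAt_expansional H V) (by simp) (fun u hu hu1 => ?_) hs hs1 hg
  rw [norm_neg]
  exact (norm_mul_le _ _).trans (by gcongr; exact h u hu hu1)

theorem norm_expansional_inv_le {H V : 𝔐} {g : ℝ} (hg : 0 ≤ g)
    (h : ∀ s, 0 ≤ s → s ≤ 1 → ‖evolve s H V‖ ≤ g) {s : ℝ} (hs : 0 ≤ s) (hs1 : s ≤ 1) :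
    ‖NormedSpace.exp (s • (H + V)) * NormedSpace.exp ((-s) • H)‖ ≤ Real.exp g := by
  refine norm_le_exp_of_deriv (hasDerivAt_expansional_inv H V) (by simp) (fun u hu hu1 => ?_) hs hs1 hg
  rw [mul_comm g]
  exact (norm_mul_le _ _).trans (by gcongr; exact h u hu hu1)

/-- Variation of constants: with G' the inverse of F', the derivative of G' F is G' (`evolve s H'
V'` - `evolve s H V`) F, and F - F' = F' (G' F - 1). The three expansionals cost e^{3g}. -/
theorem norm_expansional_sub_le {H V H' V' : 𝔐} {g δ : ℝ} (hg : 0 ≤ g) (hδ : 0 ≤ δ)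
    (h : ∀ s, 0 ≤ s → s ≤ 1 → ‖evolve s H V‖ ≤ g) (h' : ∀ s, 0 ≤ s → s ≤ 1 → ‖evolve s H' V'‖ ≤ g)
    (hd : ∀ s, 0 ≤ s → s ≤ 1 → ‖evolve s H V - evolve s H' V'‖ ≤ δ) :
    ‖NormedSpace.exp H * NormedSpace.exp (-(H + V)) - NormedSpace.exp H' * NormedSpace.exp (-(H' + V'))‖
      ≤ Real.exp (3 * g) * δ := by
  let F : ℝ → 𝔐 := fun s => NormedSpace.exp (s • H) * NormedSpace.exp ((-s) • (H + V))
  let F' : ℝ → 𝔐 := fun s => NormedSpace.exp (s • H') * NormedSpace.exp ((-s) • (H' + V'))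
  let G' : ℝ → 𝔐 := fun s => NormedSpace.exp (s • (H' + V')) * NormedSpace.exp ((-s) • H')
  have hG : ∀ s, F' s * G' s = 1 := fun s => by
    have h1 := exp_neg_smul_mul_exp_smul s (H' + V')
    have h2 := exp_smul_mul_exp_neg_smul s H'
    simp only [F', G']
    rw [mul_assoc, ← mul_assoc (NormedSpace.exp ((-s) • (H' + V'))), h1, one_mul, h2]
  let K : ℝ → 𝔐 := fun s => G' s * F s - 1
  have hK : ∀ s, HasDerivAt K (G' s * (evolve s H' V' - evolve s H V) * F s) s := fun s => by
    have := ((hasDerivAt_expansional_inv H' V' s).mul (hasDerivAt_expansional H V s)).sub_const 1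
    refine this.congr_deriv ?_
    simp only [F, G']
    noncomm_ring
  have hK1 : ‖K 1‖ ≤ Real.exp (2 * g) * δ * 1 := by
    refine image_norm_le_of_norm_deriv_right_le_deriv_boundary (f := K) (a := 0) (b := 1)
      (B := fun u => Real.exp (2 * g) * δ * u) (B' := fun _ => Real.exp (2 * g) * δ)
      (fun u _ => (hK u).continuousAt.continuousWithinAt) (fun u _ => (hK u).hasDerivWithinAt)
      (by simp [K, G', F]) (fun u => by simpa using (hasDerivAt_id u).const_mul (Real.exp (2 * g) * δ))
      (fun u hu => ?_) (Set.right_mem_Icc.2 zero_le_one)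
    have h1 : ‖G' u‖ ≤ Real.exp g := norm_expansional_inv_le hg h' hu.1 hu.2.le
    have h2 : ‖F u‖ ≤ Real.exp g := norm_expansional_le hg h hu.1 hu.2.le
    have h3 := hd u hu.1 hu.2.le
    rw [norm_sub_rev] at h3
    calc _ ≤ ‖G' u‖ * ‖evolve u H' V' - evolve u H V‖ * ‖F u‖ :=
          (norm_mul_le _ _).trans (by gcongr; exact norm_mul_le _ _)
      _ ≤ Real.exp g * δ * Real.exp g := by gcongr
      _ = _ := by rw [two_mul, Real.exp_add]; ring
  have h4 : F 1 - F' 1 = F' 1 * K 1 := by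
    simp only [K]
    rw [mul_sub, ← mul_assoc, hG, one_mul, mul_one]
  have h5 : ‖F' 1‖ ≤ Real.exp g := norm_expansional_le hg h' zero_le_one le_rfl
  have h6 : ‖F 1 - F' 1‖ ≤ Real.exp (3 * g) * δ := by
    rw [h4]
    calc _ ≤ ‖F' 1‖ * ‖K 1‖ := norm_mul_le _ _
      _ ≤ Real.exp g * (Real.exp (2 * g) * δ * 1) := by gcongr
      _ = _ := by rw [show 3 * g = g + 2 * g by ring, Real.exp_add]; ring
  simpa only [F, F', one_smul, neg_smul] using h6

end Evolution

/-! ### Combinatorics of short sets and of windows around the two cuts. -/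

/-- The nonempty subsets of `Λ` of diameter at most `R`. -/
def shortSets (R : ℕ) (Λ : Finset ℤ) : Finset (Finset ℤ) :=
  Λ.powerset.filter fun X => X.Nonempty ∧ ∀ x ∈ X, ∀ y ∈ X, |x - y| ≤ (R : ℤ)

theorem mem_shortSets {R : ℕ} {Λ X : Finset ℤ} :
    X ∈ shortSets R Λ ↔ X ⊆ Λ ∧ X.Nonempty ∧ ∀ x ∈ X, ∀ y ∈ X, |x - y| ≤ (R : ℤ) := by
  simp [shortSets]

/-- The sites at distance at most `(k + 1) * R` from `b` or `c`. -/
noncomputable def window (R : ℕ) (b c : ℤ) (k : ℕ) : Finset ℤ :=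
  Finset.Icc (b - (k + 1) * R) (b + (k + 1) * R) ∪ Finset.Icc (c - (k + 1) * R) (c + (k + 1) * R)

theorem mem_window {R : ℕ} {b c : ℤ} {k : ℕ} {x : ℤ} :
    x ∈ window R b c k ↔ |x - b| ≤ (k + 1) * R ∨ |x - c| ≤ (k + 1) * R := by
  simp only [window, Finset.mem_union, Finset.mem_Icc, abs_le]
  constructor <;> rintro (h | h) <;> [left; right; left; right] <;> constructor <;> linarith [h.1, h.2]

theorem window_mono (R : ℕ) (b c : ℤ) : Monotone (window R b c) := fun k l hkl x hx => by
  rw [mem_window] at hx ⊢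
  have : ((k : ℤ) + 1) * R ≤ (l + 1) * R := by gcongr
  exact hx.imp (fun h => h.trans this) fun h => h.trans this

theorem card_window_le (R : ℕ) (b c : ℤ) (k : ℕ) :
    (window R b c k).card ≤ (4 * R + 2) * (k + 1) := by
  refine (Finset.card_union_le _ _).trans ?_
  simp only [Int.card_Icc]
  have h : ∀ x : ℤ, (x + (k + 1) * R + 1 - (x - (k + 1) * R)).toNat = 2 * ((k + 1) * R) + 1 := by
    intro x
    rw [show x + ((k : ℤ) + 1) * R + 1 - (x - (k + 1) * R) = ((2 * ((k + 1) * R) + 1 : ℕ) : ℤ) by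
      push_cast; ring, Int.toNat_natCast]
  rw [h, h]
  nlinarith

theorem card_window_succ_sdiff_le (R : ℕ) (b c : ℤ) (k : ℕ) :
    (window R b c (k + 1) \ window R b c k).card ≤ 4 * R + 2 := by
  have h : window R b c (k + 1) \ window R b c k ⊆
      (Finset.Ico (b - (k + 2) * R) (b - (k + 1) * R) ∪ Finset.Ioc (b + (k + 1) * R) (b + (k + 2) * R)) ∪
      (Finset.Ico (c - (k + 2) * R) (c - (k + 1) * R) ∪ Finset.Ioc (c + (k + 1) * R) (c + (k + 2) * R)) := by
    intro x
    simp only [window, Finset.mem_sdiff, Finset.mem_union, Finset.mem_Icc, Finset.mem_Ico,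
      Finset.mem_Ioc]
    push_cast
    rw [show (k : ℤ) + 1 + 1 = k + 2 by ring]
    generalize ((k : ℤ) + 1) * R = p
    generalize ((k : ℤ) + 2) * R = q
    omega
  have h1 : ∀ x : ℤ, (Finset.Ico (x - (k + 2) * R) (x - (k + 1) * R)).card = R := fun x => by
    rw [Int.card_Ico, show x - ((k : ℤ) + 1) * R - (x - (k + 2) * R) = R by ring, Int.toNat_natCast]
  have h2 : ∀ x : ℤ, (Finset.Ioc (x + (k + 1) * R) (x + (k + 2) * R)).card = R := fun x => by
    rw [Int.card_Ioc, show x + ((k : ℤ) + 2) * R - (x + (k + 1) * R) = R by ring, Int.toNat_natCast]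
  refine (Finset.card_le_card h).trans ((Finset.card_union_le _ _).trans ?_)
  have h3 := Finset.card_union_le (Finset.Ico (b - (k + 2) * R) (b - (k + 1) * R))
    (Finset.Ioc (b + (k + 1) * R) (b + (k + 2) * R))
  have h4 := Finset.card_union_le (Finset.Ico (c - (k + 2) * R) (c - (k + 1) * R))
    (Finset.Ioc (c + (k + 1) * R) (c + (k + 2) * R))
  rw [h1, h2] at h3 h4
  omega

/-- Consecutive windows differ by a margin R, the maximal diameter of X. A term added two windows
later therefore commutes with everything in the earlier window. -/
theorem disjoint_window {R : ℕ} {b c : ℤ} {k : ℕ} {X : Finset ℤ}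
    (hX : ∀ x ∈ X, ∀ y ∈ X, |x - y| ≤ (R : ℤ)) (h : ¬ X ⊆ window R b c (k + 1)) :
    Disjoint X (window R b c k) := by
  obtain ⟨x, hx, hxw⟩ := Finset.not_subset.1 h
  refine Finset.disjoint_left.2 fun y hy hyw => hxw ?_
  have hxy := hX x hx y hy
  rw [mem_window] at hyw ⊢
  push_cast
  rw [show ((k : ℤ) + 1 + 1) * R = (k + 1) * R + R by ring]
  refine hyw.imp (fun h => ?_) fun h => ?_
  · have := abs_sub_le x y b; linarith
  · have := abs_sub_le x y c; linarith

theorem exists_subset_window {R : ℕ} (hR : 0 < R) (b c : ℤ) (S : Finset ℤ) (n : ℕ) :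
    ∃ m, n ≤ m ∧ S ⊆ window R b c m := by
  refine ⟨n + ∑ x ∈ S, (x - b).natAbs, Nat.le_add_right _ _, fun x hx => ?_⟩
  rw [mem_window]
  left
  have h1 : (x - b).natAbs ≤ ∑ x ∈ S, (x - b).natAbs :=
    Finset.single_le_sum (f := fun x : ℤ => (x - b).natAbs) (fun _ _ => Nat.zero_le _) hx
  have h2 : |x - b| = ((x - b).natAbs : ℤ) := Int.abs_eq_natAbs _
  have h3 : ((x - b).natAbs : ℤ) ≤ ((∑ x ∈ S, (x - b).natAbs : ℕ) : ℤ) := by exact_mod_cast h1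
  rw [h2]
  have h4 : (1 : ℤ) ≤ R := by exact_mod_cast hR
  push_cast at h3 ⊢
  have h5 : (0 : ℤ) ≤ n := by positivity
  have h6 : (0 : ℤ) ≤ ∑ x ∈ S, |x - b| := Finset.sum_nonneg fun _ _ => abs_nonneg _
  nlinarith

/-- A short set through x is a subset of [x - R, x + R], which has 2R + 1 sites. Terms are therefore
counted by sites, not by pairs of sites. -/
theorem card_le_of_inter_nonempty {R : ℕ} {𝒯 : Finset (Finset ℤ)} {S : Finset ℤ}
    (h𝒯 : ∀ X ∈ 𝒯, ∀ x ∈ X, ∀ y ∈ X, |x - y| ≤ (R : ℤ)) (hS : ∀ X ∈ 𝒯, ∃ x ∈ X, x ∈ S) :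
    𝒯.card ≤ S.card * 2 ^ (2 * R + 1) := by
  have h : 𝒯 ⊆ S.biUnion fun x => (Finset.Icc (x - R) (x + R)).powerset := fun X hX => by
    obtain ⟨x, hx, hxS⟩ := hS X hX
    refine Finset.mem_biUnion.2 ⟨x, hxS, Finset.mem_powerset.2 fun y hy => ?_⟩
    have := abs_le.1 (h𝒯 X hX x hx y hy)
    rw [Finset.mem_Icc]
    constructor <;> linarith [this.1, this.2]
  refine (Finset.card_le_card h).trans ?_
  refine Finset.card_biUnion_le_card_mul _ _ _ fun x _ => ?_
  rw [Finset.card_powerset, Int.card_Icc,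
    show x + (R : ℤ) + 1 - (x - R) = ((2 * R + 1 : ℕ) : ℤ) by push_cast; ring, Int.toNat_natCast]

/-! ### Araki's estimate for finite range interactions on the line. -/

section Locality

variable {𝔐 : Type*} [NormedRing 𝔐] [NormedAlgebra ℝ 𝔐] [CompleteSpace 𝔐] [NormOneClass 𝔐]

theorem norm_sum_le_of_inter_nonempty {φ : Finset ℤ → 𝔐} {J : ℝ} (hJ : ∀ X, ‖φ X‖ ≤ J) {R : ℕ}
    {𝒯 : Finset (Finset ℤ)} {S : Finset ℤ}
    (h𝒯 : ∀ X ∈ 𝒯, ∀ x ∈ X, ∀ y ∈ X, |x - y| ≤ (R : ℤ)) (hS : ∀ X ∈ 𝒯, ∃ x ∈ X, x ∈ S) :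
    ‖∑ X ∈ 𝒯, φ X‖ ≤ J * 2 ^ (2 * R + 1) * S.card := by
  have hJ0 : 0 ≤ J := (norm_nonneg _).trans (hJ ∅)
  refine (norm_sum_le_of_le _ fun X _ => hJ X).trans ?_
  rw [Finset.sum_const, nsmul_eq_mul]
  have : (𝒯.card : ℝ) ≤ S.card * 2 ^ (2 * R + 1) := by
    exact_mod_cast card_le_of_inter_nonempty h𝒯 hS
  nlinarith

/-- An upper bound for the interaction energy of a window per unit of length. -/
noncomputable def energyRate (J : ℝ) (R : ℕ) : ℝ := J * 2 ^ (2 * R + 1) * (4 * R + 2)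

theorem energyRate_nonneg {J : ℝ} (hJ : 0 ≤ J) (R : ℕ) : 0 ≤ energyRate J R := by
  unfold energyRate; positivity

/-- The part of the Hamiltonian of the family `𝒯` in a window. -/
noncomputable def windowSum (φ : Finset ℤ → 𝔐) (𝒯 : Finset (Finset ℤ)) (R : ℕ) (b c : ℤ) (k : ℕ) : 𝔐 :=
  ∑ X ∈ 𝒯 with X ⊆ window R b c k, φ X

/-- A family of nonempty sets of diameter at most `R`. -/
def IsShortFamily (R : ℕ) (𝒯 : Finset (Finset ℤ)) : Prop :=
  ∀ X ∈ 𝒯, X.Nonempty ∧ ∀ x ∈ X, ∀ y ∈ X, |x - y| ≤ (R : ℤ)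

variable {φ : Finset ℤ → 𝔐} {J : ℝ} {R : ℕ} {b c : ℤ} {𝒯 𝒯' 𝒱 : Finset (Finset ℤ)}

theorem windowSum_succ_sub (k : ℕ) :
    windowSum φ 𝒯 R b c (k + 1) - windowSum φ 𝒯 R b c k =
      ∑ X ∈ 𝒯 with X ⊆ window R b c (k + 1) ∧ ¬ X ⊆ window R b c k, φ X := by
  have h : (𝒯.filter fun X => X ⊆ window R b c (k + 1)).filter (fun X => X ⊆ window R b c k) =
      𝒯.filter fun X => X ⊆ window R b c k := by
    ext X
    simp only [Finset.mem_filter]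
    exact ⟨fun h => ⟨h.1.1, h.2⟩, fun h => ⟨⟨h.1, h.2.trans (window_mono R b c (Nat.le_succ k))⟩, h.2⟩⟩
  rw [windowSum, windowSum, ← Finset.sum_filter_add_sum_filter_not
    (𝒯.filter fun X => X ⊆ window R b c (k + 1)) (fun X => X ⊆ window R b c k), h,
    Finset.filter_filter]
  abel

theorem norm_windowSum_le (hJ : ∀ X, ‖φ X‖ ≤ J) (h𝒯 : IsShortFamily R 𝒯) (k : ℕ) :
    ‖windowSum φ 𝒯 R b c k‖ ≤ energyRate J R * (k + 1) := by
  have hJ0 : 0 ≤ J := (norm_nonneg _).trans (hJ ∅)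
  refine (norm_sum_le_of_inter_nonempty hJ (R := R) (S := window R b c k)
    (fun X hX => (h𝒯 X (Finset.mem_filter.1 hX).1).2) fun X hX => ?_).trans ?_
  · obtain ⟨x, hx⟩ := (h𝒯 X (Finset.mem_filter.1 hX).1).1
    exact ⟨x, hx, (Finset.mem_filter.1 hX).2 hx⟩
  · rw [energyRate, mul_assoc _ (4 * (R : ℝ) + 2)]
    gcongr
    exact_mod_cast card_window_le R b c k

theorem norm_windowSum_succ_sub_le (hJ : ∀ X, ‖φ X‖ ≤ J) (h𝒯 : IsShortFamily R 𝒯) (k : ℕ) :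
    ‖windowSum φ 𝒯 R b c (k + 1) - windowSum φ 𝒯 R b c k‖ ≤ energyRate J R := by
  have hJ0 : 0 ≤ J := (norm_nonneg _).trans (hJ ∅)
  rw [windowSum_succ_sub]
  refine (norm_sum_le_of_inter_nonempty hJ (R := R) (S := window R b c (k + 1) \ window R b c k)
    (fun X hX => (h𝒯 X (Finset.mem_filter.1 hX).1).2) fun X hX => ?_).trans ?_
  · obtain ⟨x, hx, hxw⟩ := Finset.not_subset.1 (Finset.mem_filter.1 hX).2.2
    exact ⟨x, hx, Finset.mem_sdiff.2 ⟨(Finset.mem_filter.1 hX).2.1 hx, hxw⟩⟩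
  · rw [energyRate]
    gcongr
    exact_mod_cast card_window_succ_sdiff_le R b c k

theorem commute_windowSum_sub_sum (hφ : ∀ X Y, Disjoint X Y → Commute (φ X) (φ Y))
    (h𝒯 : IsShortFamily R 𝒯) {k : ℕ} (h𝒱 : ∀ X ∈ 𝒱, X ⊆ window R b c k) :
    Commute (windowSum φ 𝒯 R b c (k + 2) - windowSum φ 𝒯 R b c (k + 1)) (∑ X ∈ 𝒱, φ X) := by
  rw [windowSum_succ_sub]
  refine Commute.sum_left _ _ _ fun X hX => Commute.sum_right _ _ _ fun Y hY => hφ _ _ ?_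
  obtain ⟨hX, _, hXw⟩ := Finset.mem_filter.1 hX
  exact (disjoint_window (h𝒯 X hX).2 hXw).mono_right (h𝒱 Y hY)

theorem exists_windowSum_eq (hR : 0 < R) (n : ℕ) :
    ∃ m, n ≤ m ∧ windowSum φ 𝒯 R b c m = ∑ X ∈ 𝒯, φ X := by
  obtain ⟨m, hnm, hm⟩ := exists_subset_window hR b c (𝒯.sup id) n
  refine ⟨m, hnm, ?_⟩
  rw [windowSum, Finset.filter_true_of_mem]
  exact fun X hX => (Finset.le_sup (f := id) hX).trans hm

/-- A bound for the imaginary time evolution of a boundary term. -/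
noncomputable def evolveBound (J : ℝ) (R : ℕ) : ℝ :=
  energyRate J R * Real.exp (2 * energyRate J R) *
    (1 + Real.exp (2 * energyRate J R * Real.exp (2 * energyRate J R)))

/-- A bound for the dependence of the imaginary time evolution of a boundary term on the interaction
at distance at least `n * R`. -/
noncomputable def evolveTail (J : ℝ) (R : ℕ) (t : ℝ) : ℝ :=
  2 * (energyRate J R * Real.exp (2 * energyRate J R) *
    Real.exp (2 * energyRate J R * Real.exp (2 * energyRate J R) * t))

theorem norm_boundary_le (hJ : ∀ X, ‖φ X‖ ≤ J) (h𝒱 : IsShortFamily R 𝒱)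
    (hw : ∀ X ∈ 𝒱, X ⊆ window R b c 0) : ‖∑ X ∈ 𝒱, φ X‖ ≤ energyRate J R := by
  have := norm_windowSum_le (b := b) (c := c) hJ h𝒱 0
  rwa [windowSum, Finset.filter_true_of_mem hw, Nat.cast_zero, zero_add, mul_one] at this

theorem norm_evolve_boundary_le (hφ : ∀ X Y, Disjoint X Y → Commute (φ X) (φ Y))
    (hJ : ∀ X, ‖φ X‖ ≤ J) (hR : 0 < R) (h𝒯 : IsShortFamily R 𝒯) (h𝒱 : IsShortFamily R 𝒱)
    (hw : ∀ X ∈ 𝒱, X ⊆ window R b c 0) {s : ℝ} (hs : 0 ≤ s) (hs1 : s ≤ 1) :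
    ‖evolve s (∑ X ∈ 𝒯, φ X) (∑ X ∈ 𝒱, φ X)‖ ≤ evolveBound J R := by
  have hJ0 : 0 ≤ J := (norm_nonneg _).trans (hJ ∅)
  obtain ⟨m, -, hm⟩ := exists_windowSum_eq (φ := φ) (𝒯 := 𝒯) (b := b) (c := c) hR 0
  rw [← hm]
  refine (norm_evolve_le_of_exhaustion (energyRate_nonneg hJ0 R) (norm_windowSum_le hJ h𝒯)
    (norm_windowSum_succ_sub_le hJ h𝒯)
    (fun k => commute_windowSum_sub_sum hφ h𝒯 fun X hX => (Finset.mem_filter.1 hX).2)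
    (fun k => commute_windowSum_sub_sum hφ h𝒯 fun X hX =>
      (hw X hX).trans (window_mono R b c (Nat.zero_le k))) hs hs1 m).trans ?_
  rw [evolveBound]
  gcongr
  exact norm_boundary_le hJ h𝒱 hw

/-- Both families have the same part in the n-th window, and each full evolution is compared with
the evolution under that common part. This explains the factor 2 in `evolveTail`. -/
theorem norm_evolve_boundary_sub_le (hφ : ∀ X Y, Disjoint X Y → Commute (φ X) (φ Y))
    (hJ : ∀ X, ‖φ X‖ ≤ J) (hR : 0 < R) (h𝒯 : IsShortFamily R 𝒯) (h𝒯' : IsShortFamily R 𝒯')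
    (h𝒱 : IsShortFamily R 𝒱) (hw : ∀ X ∈ 𝒱, X ⊆ window R b c 0) {n : ℕ}
    (hn : ∀ X, X ⊆ window R b c n → (X ∈ 𝒯 ↔ X ∈ 𝒯'))
    {t : ℝ} (ht : 1 ≤ t) {s : ℝ} (hs : 0 ≤ s) (hs1 : s ≤ 1) :
    ‖evolve s (∑ X ∈ 𝒯, φ X) (∑ X ∈ 𝒱, φ X) - evolve s (∑ X ∈ 𝒯', φ X) (∑ X ∈ 𝒱, φ X)‖ ≤
      evolveTail J R t / t ^ n := by
  have hJ0 : 0 ≤ J := (norm_nonneg _).trans (hJ ∅)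
  have key : ∀ 𝒮 : Finset (Finset ℤ), IsShortFamily R 𝒮 →
      ‖evolve s (∑ X ∈ 𝒮, φ X) (∑ X ∈ 𝒱, φ X) - evolve s (windowSum φ 𝒮 R b c n) (∑ X ∈ 𝒱, φ X)‖ ≤
        evolveTail J R t / t ^ n / 2 := fun 𝒮 h𝒮 => by
    obtain ⟨m, hnm, hm⟩ := exists_windowSum_eq (φ := φ) (𝒯 := 𝒮) (b := b) (c := c) hR n
    rw [← hm]
    refine (norm_evolve_sub_evolve_le_div_pow (energyRate_nonneg hJ0 R) (norm_windowSum_le hJ h𝒮)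
      (norm_windowSum_succ_sub_le hJ h𝒮)
      (fun k => commute_windowSum_sub_sum hφ h𝒮 fun X hX => (Finset.mem_filter.1 hX).2)
      (fun k => commute_windowSum_sub_sum hφ h𝒮 fun X hX =>
        (hw X hX).trans (window_mono R b c (Nat.zero_le k))) ht hs hs1 hnm).trans ?_
    rw [evolveTail, show ∀ x y z : ℝ, 2 * (x * y) / z / 2 = x * (y / z) by intros; ring]
    gcongr
    exact norm_boundary_le hJ h𝒱 hw
  have h0 : windowSum φ 𝒯 R b c n = windowSum φ 𝒯' R b c n := by
    rw [windowSum, windowSum]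
    congr 1
    ext X
    simp only [Finset.mem_filter]
    exact ⟨fun h => ⟨(hn X h.2).1 h.1, h.2⟩, fun h => ⟨(hn X h.2).2 h.1, h.2⟩⟩
  have h1 := key 𝒯 h𝒯
  have h2 := key 𝒯' h𝒯'
  rw [← h0, norm_sub_rev] at h2
  refine (norm_sub_le_norm_sub_add_norm_sub _ (evolve s (windowSum φ 𝒯 R b c n) (∑ X ∈ 𝒱, φ X)) _).trans ?_
  linarith

/-! ### Splitting an interval into three -/

/-- The Hamiltonian of the terms of `φ` in `Λ` of diameter at most `R`. -/
noncomputable def localSum (φ : Finset ℤ → 𝔐) (R : ℕ) (Λ : Finset ℤ) : 𝔐 := ∑ X ∈ shortSets R Λ, φ X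

theorem isShortFamily_shortSets (R : ℕ) (Λ : Finset ℤ) : IsShortFamily R (shortSets R Λ) :=
  fun _ hX => (mem_shortSets.1 hX).2

/-- The terms inside of one of the intervals `[a, b)`, `[b, c)`, `[c, e)`. -/
noncomputable def splitSets (R : ℕ) (a b c e : ℤ) : Finset (Finset ℤ) :=
  shortSets R (Finset.Ico a b) ∪ shortSets R (Finset.Ico b c) ∪ shortSets R (Finset.Ico c e)

theorem isShortFamily_splitSets (R : ℕ) (a b c e : ℤ) : IsShortFamily R (splitSets R a b c e) := by
  intro X hX
  simp only [splitSets, Finset.mem_union] at hX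
  rcases hX with (hX | hX) | hX <;> exact (mem_shortSets.1 hX).2

theorem disjoint_shortSets {R : ℕ} {Λ Λ' : Finset ℤ} (h : Disjoint Λ Λ') :
    Disjoint (shortSets R Λ) (shortSets R Λ') :=
  Finset.disjoint_left.2 fun X hX hX' => by
    obtain ⟨hX, ⟨x, hx⟩, _⟩ := mem_shortSets.1 hX
    exact Finset.disjoint_left.1 h (hX hx) ((mem_shortSets.1 hX').1 hx)

theorem sum_splitSets (a b c e : ℤ) (hab : a ≤ b) (hbc : b ≤ c) (hce : c ≤ e) :
    ∑ X ∈ splitSets R a b c e, φ X =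
      localSum φ R (Finset.Ico a b) + localSum φ R (Finset.Ico b c) + localSum φ R (Finset.Ico c e) := by
  rw [splitSets, Finset.sum_union, Finset.sum_union]
  · rfl
  · exact disjoint_shortSets (Finset.Ico_disjoint_Ico_consecutive a b c)
  · rw [Finset.disjoint_union_left]
    refine ⟨disjoint_shortSets ?_, disjoint_shortSets (Finset.Ico_disjoint_Ico_consecutive b c e)⟩
    refine Finset.disjoint_left.2 fun x hx hx' => ?_
    rw [Finset.mem_Ico] at hx hx'
    omega

/-- The terms that cross one of the cuts. -/
noncomputable def crossingSets (R : ℕ) (a b c e : ℤ) : Finset (Finset ℤ) :=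
  shortSets R (Finset.Ico a e) \ splitSets R a b c e

theorem isShortFamily_crossingSets (R : ℕ) (a b c e : ℤ) : IsShortFamily R (crossingSets R a b c e) :=
  fun _ hX => isShortFamily_shortSets _ _ _ (Finset.mem_sdiff.1 hX).1

theorem splitSets_subset {a b c e : ℤ} (hab : a ≤ b) (hbc : b ≤ c) (hce : c ≤ e) :
    splitSets R a b c e ⊆ shortSets R (Finset.Ico a e) := by
  intro X hX
  have h := isShortFamily_splitSets R a b c e X hX
  refine mem_shortSets.2 ⟨?_, h⟩
  simp only [splitSets, Finset.mem_union, mem_shortSets] at hX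
  rcases hX with (hX | hX) | hX
  · exact hX.1.trans (Finset.Ico_subset_Ico_right (hbc.trans hce))
  · exact hX.1.trans (Finset.Ico_subset_Ico hab hce)
  · exact hX.1.trans (Finset.Ico_subset_Ico_left (hab.trans hbc))

theorem localSum_Ico_eq {a b c e : ℤ} (hab : a ≤ b) (hbc : b ≤ c) (hce : c ≤ e) :
    localSum φ R (Finset.Ico a e) =
      ∑ X ∈ splitSets R a b c e, φ X + ∑ X ∈ crossingSets R a b c e, φ X := by
  rw [localSum, crossingSets, add_comm, Finset.sum_sdiff (splitSets_subset hab hbc hce)]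

/-- A site farther than R from both cuts sees, within distance R, only sites of its own subinterval,
so a short set containing it crosses nothing. -/
theorem subset_window_of_mem_crossingSets {a b c e : ℤ} {X : Finset ℤ}
    (hX : X ∈ crossingSets R a b c e) : X ⊆ window R b c 0 := by
  obtain ⟨hX, hX'⟩ := Finset.mem_sdiff.1 hX
  obtain ⟨hXI, hne, hd⟩ := mem_shortSets.1 hX
  intro x hx
  rw [mem_window]
  by_contra! hcon
  have hx' := Finset.mem_Ico.1 (hXI hx)
  simp only [Nat.cast_zero, zero_add, one_mul, lt_abs] at hcon
  apply hX'
  simp only [splitSets, Finset.mem_union, mem_shortSets]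
  have hall : ∀ y ∈ X, y - x ≤ R ∧ x - y ≤ R ∧ a ≤ y ∧ y < e := fun y hy => by
    have h1 := abs_le.1 (hd x hx y hy)
    have h2 := Finset.mem_Ico.1 (hXI hy)
    refine ⟨by linarith [h1.1], by linarith [h1.2], h2.1, h2.2⟩
  by_cases hxb : x < b
  · refine Or.inl (Or.inl ⟨fun y hy => ?_, hne, hd⟩)
    have := hall y hy
    rw [Finset.mem_Ico]
    omega
  · by_cases hxc : x < c
    · refine Or.inl (Or.inr ⟨fun y hy => ?_, hne, hd⟩)
      have := hall y hy
      rw [Finset.mem_Ico]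
      omega
    · refine Or.inr ⟨fun y hy => ?_, hne, hd⟩
      have := hall y hy
      rw [Finset.mem_Ico]
      omega

/-- `[a', e')` contains all sites of `[a, e)` at distance at most `(n + 1) * R` from `b` or `c`. -/
structure IsTruncation (R n : ℕ) (a b c e a' e' : ℤ) : Prop where
  le_left : a ≤ a'
  left_le : a' ≤ b
  le_right : c ≤ e'
  right_le : e' ≤ e
  left : a' = a ∨ a' ≤ b - (n + 1) * R
  -- Strict, unlike on the left, because the right end is excluded from `[a', e')`.
  right : e' = e ∨ c + (n + 1) * R < e'

theorem IsTruncation.mem_iff {n : ℕ} {a b c e a' e' : ℤ} (h : IsTruncation R n a b c e a' e')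
    (hbc : b ≤ c) {x : ℤ} (hx : x ∈ window R b c n) : (a' ≤ x ↔ a ≤ x) ∧ (x < e' ↔ x < e) := by
  obtain ⟨h1, h2, h3, h4, h5, h6⟩ := h
  rw [mem_window, abs_le, abs_le] at hx
  generalize ((n : ℤ) + 1) * R = p at *
  omega

theorem IsTruncation.mem_splitSets_iff {n : ℕ} {a b c e a' e' : ℤ}
    (h : IsTruncation R n a b c e a' e') (hbc : b ≤ c) {X : Finset ℤ} (hX : X ⊆ window R b c n) :
    X ∈ splitSets R a b c e ↔ X ∈ splitSets R a' b c e' := by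
  have h1 : X ⊆ Finset.Ico a b ↔ X ⊆ Finset.Ico a' b := by
    simp only [Finset.subset_iff, Finset.mem_Ico]
    exact forall₂_congr fun x hx => by rw [(h.mem_iff hbc (hX hx)).1]
  have h2 : X ⊆ Finset.Ico c e ↔ X ⊆ Finset.Ico c e' := by
    simp only [Finset.subset_iff, Finset.mem_Ico]
    exact forall₂_congr fun x hx => by rw [(h.mem_iff hbc (hX hx)).2]
  simp only [splitSets, Finset.mem_union, mem_shortSets, h1, h2]

theorem IsTruncation.crossingSets_eq {n : ℕ} {a b c e a' e' : ℤ}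
    (h : IsTruncation R n a b c e a' e') (hbc : b ≤ c) :
    crossingSets R a' b c e' = crossingSets R a b c e := by
  ext X
  by_cases hX : X ⊆ window R b c n
  · have h1 : X ⊆ Finset.Ico a e ↔ X ⊆ Finset.Ico a' e' := by
      simp only [Finset.subset_iff, Finset.mem_Ico]
      exact forall₂_congr fun x hx => by
        rw [(h.mem_iff hbc (hX hx)).1, (h.mem_iff hbc (hX hx)).2]
    simp only [crossingSets, Finset.mem_sdiff, h.mem_splitSets_iff hbc hX, mem_shortSets, h1]
  · have hn := window_mono R b c (Nat.zero_le n)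
    exact ⟨fun h => absurd ((subset_window_of_mem_crossingSets h).trans hn) hX,
      fun h => absurd ((subset_window_of_mem_crossingSets h).trans hn) hX⟩

/-- `e^{H_A + H_B + H_C} e^{-H_{ABC}}` -/
noncomputable def expansional (φ : Finset ℤ → 𝔐) (R : ℕ) (A B C I : Finset ℤ) : 𝔐 :=
  NormedSpace.exp (localSum φ R A + localSum φ R B + localSum φ R C) *
    NormedSpace.exp (-localSum φ R I)

theorem norm_expansional_Ico_le (hφ : ∀ X Y, Disjoint X Y → Commute (φ X) (φ Y))
    (hJ : ∀ X, ‖φ X‖ ≤ J) (hR : 0 < R) {a b c e : ℤ} (hab : a ≤ b) (hbc : b ≤ c) (hce : c ≤ e) :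
    ‖expansional φ R (Finset.Ico a b) (Finset.Ico b c) (Finset.Ico c e) (Finset.Ico a e)‖ ≤
      Real.exp (evolveBound J R) := by
  have hJ0 : 0 ≤ J := (norm_nonneg _).trans (hJ ∅)
  have := energyRate_nonneg hJ0 R
  have h := norm_expansional_le (H := ∑ X ∈ splitSets R a b c e, φ X)
    (V := ∑ X ∈ crossingSets R a b c e, φ X) (by unfold evolveBound; positivity)
    (fun s hs hs1 => norm_evolve_boundary_le hφ hJ hR (isShortFamily_splitSets R a b c e)
      (isShortFamily_crossingSets R a b c e) (fun X => subset_window_of_mem_crossingSets) hs hs1)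
    zero_le_one le_rfl
  rwa [← localSum_Ico_eq hab hbc hce, sum_splitSets a b c e hab hbc hce, one_smul, neg_smul,
    one_smul] at h

theorem norm_exp_mul_exp_Ico_le (hφ : ∀ X Y, Disjoint X Y → Commute (φ X) (φ Y))
    (hJ : ∀ X, ‖φ X‖ ≤ J) (hR : 0 < R) {a b c e : ℤ} (hab : a ≤ b) (hbc : b ≤ c) (hce : c ≤ e)
    {s : ℝ} (hs : 0 ≤ s) (hs1 : s ≤ 1) :
    ‖NormedSpace.exp (s • localSum φ R (Finset.Ico a e)) * NormedSpace.exp ((-s) •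
      (localSum φ R (Finset.Ico a b) + localSum φ R (Finset.Ico b c) + localSum φ R (Finset.Ico c e)))‖ ≤
      Real.exp (evolveBound J R) := by
  have hJ0 : 0 ≤ J := (norm_nonneg _).trans (hJ ∅)
  have := energyRate_nonneg hJ0 R
  have h := norm_expansional_inv_le (H := ∑ X ∈ splitSets R a b c e, φ X)
    (V := ∑ X ∈ crossingSets R a b c e, φ X) (by unfold evolveBound; positivity)
    (fun s hs hs1 => norm_evolve_boundary_le hφ hJ hR (isShortFamily_splitSets R a b c e)
      (isShortFamily_crossingSets R a b c e) (fun X => subset_window_of_mem_crossingSets) hs hs1)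
    hs hs1
  rwa [← localSum_Ico_eq hab hbc hce, sum_splitSets a b c e hab hbc hce] at h

/-- The crossing terms are the same before and after truncation. Only the decoupled Hamiltonian that
evolves them changes, and only outside the n-th window. -/
theorem norm_expansional_sub_truncation_le (hφ : ∀ X Y, Disjoint X Y → Commute (φ X) (φ Y))
    (hJ : ∀ X, ‖φ X‖ ≤ J) (hR : 0 < R) {a b c e a' e' : ℤ} (hbc : b ≤ c)
    {n : ℕ} (h : IsTruncation R n a b c e a' e') {t : ℝ} (ht : 1 ≤ t) :
    ‖expansional φ R (Finset.Ico a b) (Finset.Ico b c) (Finset.Ico c e) (Finset.Ico a e) -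
      expansional φ R (Finset.Ico a' b) (Finset.Ico b c) (Finset.Ico c e') (Finset.Ico a' e')‖ ≤
      Real.exp (3 * evolveBound J R) * (evolveTail J R t / t ^ n) := by
  have hJ0 : 0 ≤ J := (norm_nonneg _).trans (hJ ∅)
  have := energyRate_nonneg hJ0 R
  have hb := h.left_le
  have he := h.le_right
  have hab := h.le_left.trans h.left_le
  have hce := h.le_right.trans h.right_le
  have h := norm_expansional_sub_le (H := ∑ X ∈ splitSets R a b c e, φ X)
    (V := ∑ X ∈ crossingSets R a b c e, φ X) (H' := ∑ X ∈ splitSets R a' b c e', φ X)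
    (V' := ∑ X ∈ crossingSets R a' b c e', φ X) (g := evolveBound J R)
    (δ := evolveTail J R t / t ^ n)
    (by unfold evolveBound; positivity) (by unfold evolveTail; positivity)
    (fun s hs hs1 => norm_evolve_boundary_le hφ hJ hR (isShortFamily_splitSets R a b c e)
      (isShortFamily_crossingSets R a b c e) (fun X => subset_window_of_mem_crossingSets) hs hs1)
    (fun s hs hs1 => norm_evolve_boundary_le hφ hJ hR (isShortFamily_splitSets R a' b c e')
      (isShortFamily_crossingSets R a' b c e') (fun X => subset_window_of_mem_crossingSets) hs hs1)
    (fun s hs hs1 => by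
      rw [h.crossingSets_eq hbc]
      exact norm_evolve_boundary_sub_le hφ hJ hR (isShortFamily_splitSets R a b c e)
        (isShortFamily_splitSets R a' b c e') (isShortFamily_crossingSets R a b c e)
        (fun X => subset_window_of_mem_crossingSets) (fun X hX => h.mem_splitSets_iff hbc hX)
        ht hs hs1)
  rwa [← localSum_Ico_eq hab hbc hce, ← localSum_Ico_eq hb hbc he, sum_splitSets a b c e hab hbc hce,
    sum_splitSets a' b c e' hb hbc he] at h

theorem norm_localSum_le (hJ : ∀ X, ‖φ X‖ ≤ J) (Λ : Finset ℤ) :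
    ‖localSum φ R Λ‖ ≤ J * 2 ^ (2 * R + 1) * Λ.card :=
  norm_sum_le_of_inter_nonempty hJ (fun _ hX => (mem_shortSets.1 hX).2.2) fun _ hX =>
    have ⟨hX, ⟨x, hx⟩, _⟩ := mem_shortSets.1 hX
    ⟨x, hx, hX hx⟩

end Locality

/-! ### Ampliation by an identity factor. -/

section Kronecker

open scoped Kronecker

variable {n κ : Type*} [Fintype n] [DecidableEq n] [Fintype κ] [DecidableEq κ]

/-- The star homomorphism `Q ↦ Q ⊗ 𝟙`. -/
noncomputable def kroneckerOneHom (n κ : Type*) [Fintype n] [DecidableEq n] [Fintype κ] [DecidableEq κ] :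
    Matrix n n ℂ →⋆ₐ[ℂ] Matrix (n × κ) (n × κ) ℂ where
  toFun Q := Q ⊗ₖ (1 : Matrix κ κ ℂ)
  map_one' := Matrix.one_kronecker_one
  map_mul' P Q := by rw [← Matrix.mul_kronecker_mul, one_mul]
  map_zero' := Matrix.zero_kronecker _
  map_add' P Q := Matrix.add_kronecker _ _ _
  commutes' c := by
    rw [Algebra.algebraMap_eq_smul_one, Algebra.algebraMap_eq_smul_one, Matrix.smul_kronecker,
      Matrix.one_kronecker_one]
  map_star' Q := by
    rw [Matrix.star_eq_conjTranspose, Matrix.star_eq_conjTranspose, Matrix.conjTranspose_kronecker,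
      Matrix.conjTranspose_one]

/-- Star homomorphisms of C*-algebras are contractions. -/
theorem norm_kronecker_one_le (Q : Matrix n n ℂ) : ‖Q ⊗ₖ (1 : Matrix κ κ ℂ)‖ ≤ ‖Q‖ :=
  NonUnitalStarAlgHom.norm_apply_le (kroneckerOneHom n κ) Q

end Kronecker

/-! ### Embeddings and partial traces. -/

section Tensor

open scoped Kronecker

variable {d : ℕ} {X Y Λ I : Finset ℤ}

/-- Configurations on `Λ` are pairs of configurations on `X` and on `Λ \ X`. -/
def splitEquiv (h : X ⊆ Λ) : (Λ → Fin d) ≃ (X → Fin d) × ((Λ \ X : Finset ℤ) → Fin d) where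
  toFun σ := (Finset.restrict₂ (π := fun _ => Fin d) h σ,
    Finset.restrict₂ (π := fun _ => Fin d) Finset.sdiff_subset σ)
  invFun p := glue p.1 p.2
  left_inv σ := by
    funext x
    simp only [glue, Finset.restrict₂]
    split_ifs <;> rfl
  right_inv p := by
    ext x
    · simp [glue, Finset.restrict₂]
    · have := (Finset.mem_sdiff.1 x.2).2
      simp [glue, Finset.restrict₂, this]

theorem forall_notMem_iff (σ τ : Λ → Fin d) :
    (∀ x : Λ, x.1 ∉ X → σ x = τ x) ↔
      Finset.restrict₂ (π := fun _ => Fin d) Finset.sdiff_subset σ =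
        Finset.restrict₂ (π := fun _ => Fin d) (Finset.sdiff_subset : Λ \ X ⊆ Λ) τ := by
  constructor
  · exact fun h => funext fun x => h ⟨x.1, _⟩ (Finset.mem_sdiff.1 x.2).2
  · exact fun h x hx => congrFun h ⟨x.1, Finset.mem_sdiff.2 ⟨x.2, hx⟩⟩

theorem embed_eq_submatrix (h : X ⊆ Λ) (Q : Observable d X) :
    embed h Q = (Q ⊗ₖ (1 : Matrix _ _ ℂ)).submatrix (splitEquiv h) (splitEquiv h) := by
  ext σ τ
  simp only [embed, Matrix.of_apply, Matrix.submatrix_apply, Matrix.kroneckerMap_apply, splitEquiv,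
    Equiv.coe_fn_mk, Matrix.one_apply, mul_ite, mul_one, mul_zero]
  exact if_congr (forall_notMem_iff σ τ) rfl rfl

theorem embed_sdiff_eq_submatrix (h : X ⊆ Λ) (Q : Observable d (Λ \ X)) :
    embed Finset.sdiff_subset Q =
      ((1 : Matrix _ _ ℂ) ⊗ₖ Q).submatrix (splitEquiv h) (splitEquiv h) := by
  ext σ τ
  simp only [embed, Matrix.of_apply, Matrix.submatrix_apply, Matrix.kroneckerMap_apply, splitEquiv,
    Equiv.coe_fn_mk, Matrix.one_apply, ite_mul, one_mul, zero_mul]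
  refine if_congr ?_ rfl rfl
  constructor
  · exact fun hx => funext fun x => hx ⟨x.1, h x.2⟩ fun h' => (Finset.mem_sdiff.1 h').2 x.2
  · intro hx x hx'
    exact congrFun hx ⟨x.1, by_contra fun h' => hx' (Finset.mem_sdiff.2 ⟨x.2, h'⟩)⟩

/-- The canonical embedding `𝔄_X → 𝔄_Λ` as a star homomorphism. -/
noncomputable def embedHom (d : ℕ) (h : X ⊆ Λ) : Observable d X →⋆ₐ[ℂ] Observable d Λ where
  toFun := embed h
  map_one' := by
    rw [embed_eq_submatrix, Matrix.one_kronecker_one, Matrix.submatrix_one_equiv]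
  map_mul' P Q := by
    rw [embed_eq_submatrix, embed_eq_submatrix, embed_eq_submatrix, Matrix.submatrix_mul_equiv,
      ← Matrix.mul_kronecker_mul, one_mul]
  map_zero' := (embedLin h).map_zero
  map_add' := (embedLin h).map_add
  commutes' c := by
    rw [Algebra.algebraMap_eq_smul_one, Algebra.algebraMap_eq_smul_one, embed_eq_submatrix,
      Matrix.smul_kronecker, Matrix.one_kronecker_one, ← Matrix.submatrix_one_equiv (splitEquiv h)]
    rfl
  map_star' Q := by
    simp only [Matrix.star_eq_conjTranspose]
    rw [embed_eq_submatrix, embed_eq_submatrix, Matrix.conjTranspose_submatrix,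
      Matrix.conjTranspose_kronecker, Matrix.conjTranspose_one]

theorem embedHom_apply (h : X ⊆ Λ) (Q : Observable d X) : embedHom d h Q = embed h Q := rfl

theorem embed_one (h : X ⊆ Λ) : embed h (1 : Observable d X) = 1 := map_one (embedHom d h)

theorem embed_mul (h : X ⊆ Λ) (P Q : Observable d X) : embed h (P * Q) = embed h P * embed h Q :=
  map_mul (embedHom d h) P Q

theorem embed_smul (h : X ⊆ Λ) (c : ℂ) (Q : Observable d X) : embed h (c • Q) = c • embed h Q :=
  map_smul (embedHom d h) c Q

theorem norm_embed_le (h : X ⊆ Λ) (Q : Observable d X) : ‖embed h Q‖ ≤ ‖Q‖ :=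
  NonUnitalStarAlgHom.norm_apply_le (embedHom d h) Q

theorem continuous_embed (h : X ⊆ Λ) : Continuous (embed h : Observable d X → Observable d Λ) :=
  LinearMap.continuous_of_finiteDimensional (embedLin h)

theorem embed_exp (h : X ⊆ Λ) (Q : Observable d X) :
    embed h (NormedSpace.exp Q) = NormedSpace.exp (embed h Q) := by
  let := NormedAlgebra.restrictScalars ℚ ℂ (Observable d X)
  exact NormedSpace.map_exp (embedHom d h) (continuous_embed h) Q

theorem embed_embed (h : X ⊆ Y) (h' : Y ⊆ Λ) (Q : Observable d X) :
    embed h' (embed h Q) = embed (h.trans h') Q := by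
  ext σ τ
  simp only [embed, Matrix.of_apply]
  rw [← ite_and]
  refine if_congr ⟨fun H x hx => ?_, fun H => ⟨fun x hx => H x fun h'' => hx (h h''), fun x hx => ?_⟩⟩
    rfl rfl
  · by_cases hxY : x.1 ∈ Y
    · exact H.2 ⟨x.1, hxY⟩ hx
    · exact H.1 x hxY
  · exact H ⟨x.1, h' x.2⟩ hx

theorem commute_embed (hX : X ⊆ Λ) (hY : Y ⊆ Λ) (hXY : Disjoint X Y) (P : Observable d X)
    (Q : Observable d Y) : Commute (embed hX P) (embed hY Q) := by
  have hY' : Y ⊆ Λ \ X := Finset.subset_sdiff.2 ⟨hY, hXY.symm⟩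
  rw [← embed_embed hY' Finset.sdiff_subset, embed_sdiff_eq_submatrix hX, embed_eq_submatrix hX,
    Commute, SemiconjBy, Matrix.submatrix_mul_equiv, Matrix.submatrix_mul_equiv,
    ← Matrix.mul_kronecker_mul, ← Matrix.mul_kronecker_mul, one_mul, mul_one, one_mul, mul_one]

/-- The partial trace is the adjoint of the embedding for the trace pairing. As this pairing is
nondegenerate, most rules for partial traces follow by testing against all observables. -/
theorem trace_reduce_mul (h : X ⊆ Λ) (Q : Observable d Λ) (P : Observable d X) :
    (reduce X Q * P).trace = (Q * embed h P).trace := by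
  have h1 : (Q * embed h P).trace = (Q.submatrix (splitEquiv h).symm (splitEquiv h).symm *
      (P ⊗ₖ (1 : Matrix _ _ ℂ))).trace := by
    rw [embed_eq_submatrix]
    simp only [Matrix.trace, Matrix.diag, Matrix.mul_apply, Matrix.submatrix_apply]
    rw [← (splitEquiv h).symm.sum_comp]
    refine Finset.sum_congr rfl fun p _ => ?_
    rw [← (splitEquiv h).symm.sum_comp]
    simp
  rw [h1]
  simp only [Matrix.trace, Matrix.diag, Matrix.mul_apply, Fintype.sum_prod_type, reduce,
    Matrix.of_apply, Matrix.submatrix_apply, Matrix.kroneckerMap_apply, Matrix.one_apply, mul_ite,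
    mul_one, mul_zero, Finset.sum_mul]
  refine Finset.sum_congr rfl fun σ _ => ?_
  rw [Finset.sum_comm]
  refine Finset.sum_congr rfl fun η _ => ?_
  refine Finset.sum_congr rfl fun τ _ => ?_
  simp [splitEquiv]

theorem eq_of_trace_mul {P Q : Observable d X} (h : ∀ R, (P * R).trace = (Q * R).trace) : P = Q :=
  Matrix.ext_iff_trace_mul_right.2 h

theorem reduce_add (P Q : Observable d Λ) : reduce X (P + Q) = reduce X P + reduce X Q := by
  ext σ τ
  simp [reduce, Finset.sum_add_distrib]

theorem reduce_smul (c : ℂ) (Q : Observable d Λ) : reduce X (c • Q) = c • reduce X Q := by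
  ext σ τ
  simp [reduce, Finset.mul_sum]

theorem reduce_mul_embed (h : X ⊆ Λ) (Q : Observable d Λ) (P : Observable d X) :
    reduce X (Q * embed h P) = reduce X Q * P :=
  eq_of_trace_mul fun R => by
    rw [trace_reduce_mul h, mul_assoc, mul_assoc, ← embed_mul, trace_reduce_mul h]

theorem reduce_embed_mul (h : X ⊆ Λ) (P : Observable d X) (Q : Observable d Λ) :
    reduce X (embed h P * Q) = P * reduce X Q :=
  eq_of_trace_mul fun R => by
    rw [trace_reduce_mul h, mul_assoc, Matrix.trace_mul_comm, mul_assoc, ← embed_mul,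
      ← trace_reduce_mul h, mul_assoc P, Matrix.trace_mul_comm P, mul_assoc]

theorem reduce_embed_mul_comm (hX : X ⊆ Λ) (hY : Y ⊆ Λ) (hXY : Disjoint X Y) (P : Observable d Y)
    (Q : Observable d Λ) : reduce X (embed hY P * Q) = reduce X (Q * embed hY P) :=
  eq_of_trace_mul fun R => by
    rw [trace_reduce_mul hX, trace_reduce_mul hX, mul_assoc, Matrix.trace_mul_comm, mul_assoc,
      mul_assoc, (commute_embed hX hY hXY R P).eq]

/-- The partial trace of an observable that is localized in `Λ`. -/
theorem reduce_embed (hX : X ⊆ I) (hΛ : Λ ⊆ I) (hI : I ⊆ X ∪ Λ) (Q : Observable d Λ) :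
    reduce X (embed hΛ Q) = embed Finset.inter_subset_left (reduce (X ∩ Λ) Q) := by
  -- Since X and Λ cover I, the sites traced out of I are exactly those traced out of Λ. An
  -- uncovered site would contribute a factor d.
  have hset : ∀ x, x ∈ I \ X ↔ x ∈ Λ \ (X ∩ Λ) := fun x => by
    simp only [Finset.mem_sdiff, Finset.mem_inter]
    constructor
    · rintro ⟨h1, h2⟩
      have := Finset.mem_union.1 (hI h1)
      tauto
    · rintro ⟨h1, h2⟩
      exact ⟨hΛ h1, fun h => h2 ⟨h, h1⟩⟩
  let E : ((I \ X : Finset ℤ) → Fin d) ≃ ((Λ \ (X ∩ Λ) : Finset ℤ) → Fin d) :=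
    Equiv.arrowCongr (Equiv.subtypeEquivRight hset) (Equiv.refl _)
  ext σ τ
  simp only [reduce, embed, Matrix.of_apply]
  have hcond : ∀ η : (I \ X : Finset ℤ) → Fin d,
      (∀ x : I, x.1 ∉ Λ → (glue σ η : I → Fin d) x = glue τ η x) ↔
        ∀ x : X, x.1 ∉ X ∩ Λ → σ x = τ x := fun η => by
    constructor
    · intro h x hx
      have := h ⟨x.1, hX x.2⟩ fun hxΛ => hx (Finset.mem_inter.2 ⟨x.2, hxΛ⟩)
      simpa [glue] using this
    · intro h x hx
      have hxX : x.1 ∈ X := (Finset.mem_union.1 (hI x.2)).resolve_right hx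
      simpa [glue, hxX] using h ⟨x.1, hxX⟩ fun h' => hx (Finset.mem_inter.1 h').2
  have hglue : ∀ (σ : X → Fin d) (η : (I \ X : Finset ℤ) → Fin d),
      Finset.restrict₂ (π := fun _ => Fin d) hΛ (glue σ η) =
        glue (Finset.restrict₂ (π := fun _ => Fin d) Finset.inter_subset_left σ : (X ∩ Λ : Finset ℤ) → Fin d)
          (E η) := fun σ η => by
    funext x
    by_cases hx : x.1 ∈ X
    · simp [glue, Finset.restrict₂, hx]
    · simp [glue, Finset.restrict₂, hx, E, Equiv.arrowCongr, Equiv.subtypeEquivRight]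
      rfl
  split_ifs with h
  · rw [← E.sum_comp]
    refine Finset.sum_congr rfl fun η _ => ?_
    rw [if_pos ((hcond η).2 h), hglue, hglue]
  · exact Finset.sum_eq_zero fun η _ => if_neg fun h' => h ((hcond η).1 h')

theorem trace_reduce (h : X ⊆ Λ) (Q : Observable d Λ) : (reduce X Q).trace = Q.trace := by
  simpa [embed_one] using trace_reduce_mul h Q 1

theorem reduce_reduce (h : X ⊆ Y) (h' : Y ⊆ Λ) (Q : Observable d Λ) :
    reduce X (reduce Y Q) = reduce X Q :=
  eq_of_trace_mul fun R => by
    rw [trace_reduce_mul h, trace_reduce_mul h', embed_embed, ← trace_reduce_mul]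

theorem embed_empty_eq (h : (∅ : Finset ℤ) ⊆ Λ) (Q : Observable d ∅) :
    embed h Q = Q.trace • 1 := by
  have : Q = Q.trace • 1 := by
    ext σ τ
    have h1 : σ = default := Subsingleton.elim _ _
    have h2 : τ = default := Subsingleton.elim _ _
    subst h1 h2
    simp [Matrix.trace]
  conv_lhs => rw [this]
  rw [embed_smul, embed_one]

theorem reduced_congr {X' : Finset ℤ} (hXX' : X = X') (h : X ⊆ Λ) (h' : X' ⊆ Λ) (Q : Observable d Λ) :
    reduced h Q = reduced h' Q := by
  subst hXX'
  rfl

/-! ### Positivity of the partial trace -/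

/-- The columns of `S`, restacked so that the partial trace becomes a compression. -/
def restack (X : Finset ℤ) (S : Observable d Λ) :
    Matrix ((Λ → Fin d) × ((Λ \ X : Finset ℤ) → Fin d)) (X → Fin d) ℂ :=
  Matrix.of fun p σ => S p.1 (glue σ p.2)

theorem restack_mul (X : Finset ℤ) (W S : Observable d Λ) :
    restack X (W * S) = (W ⊗ₖ (1 : Matrix ((Λ \ X : Finset ℤ) → Fin d) ((Λ \ X : Finset ℤ) → Fin d) ℂ)) * restack X S := by
  ext ⟨x, η⟩ σ
  simp only [restack, Matrix.of_apply, Matrix.mul_apply, Fintype.sum_prod_type,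
    Matrix.kroneckerMap_apply, Matrix.one_apply, mul_ite, mul_one, mul_zero, ite_mul, zero_mul]
  simp

/-- A partial trace of S* T becomes an ordinary product of rectangular matrices, so C*-norm
identities apply and left multiplication by W turns into W ⊗ 1. -/
theorem reduce_conjTranspose_mul (S T : Observable d Λ) :
    reduce X (S.conjTranspose * T) = (restack X S).conjTranspose * restack X T := by
  ext σ τ
  simp only [reduce, restack, Matrix.of_apply, Matrix.mul_apply, Matrix.conjTranspose_apply,
    Fintype.sum_prod_type]
  rw [Finset.sum_comm]

theorem norm_reduce_conj_le (S Q : Observable d Λ) :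
    ‖reduce X (S.conjTranspose * Q * S)‖ ≤ ‖reduce X (S.conjTranspose * S)‖ * ‖Q‖ := by
  rw [mul_assoc, reduce_conjTranspose_mul, reduce_conjTranspose_mul,
    Matrix.l2_opNorm_conjTranspose_mul_self, restack_mul]
  calc _ ≤ ‖(restack X S).conjTranspose‖ * (‖Q ⊗ₖ (1 : Matrix _ _ ℂ)‖ * ‖restack X S‖) :=
        (Matrix.l2_opNorm_mul _ _).trans (by gcongr; exact Matrix.l2_opNorm_mul _ _)
    _ ≤ ‖restack X S‖ * (‖Q‖ * ‖restack X S‖) := by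
        rw [Matrix.l2_opNorm_conjTranspose]
        gcongr
        exact norm_kronecker_one_le Q
    _ = _ := by ring

/-- A left inverse makes N injective, hence N* N positive definite. -/
theorem isUnit_conjTranspose_mul_self {m n : Type*} [Fintype m] [DecidableEq m] [Fintype n]
    [DecidableEq n] {N : Matrix m n ℂ} {L : Matrix n m ℂ} (h : L * N = 1) :
    IsUnit (N.conjTranspose * N) := by
  open scoped ComplexOrder in
  refine (Matrix.PosDef.conjTranspose_mul_self N fun u v huv => ?_).isUnit
  have := congrArg L.mulVec huv
  simpa [Matrix.mulVec_mulVec, h] using this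

theorem norm_inv_conjTranspose_mul_self_le {m n : Type*} [Fintype m] [DecidableEq m] [Fintype n]
    [DecidableEq n] {N : Matrix m n ℂ} {L : Matrix n m ℂ} (h : L * N = 1) :
    ‖(N.conjTranspose * N)⁻¹‖ ≤ ‖L‖ ^ 2 := by
  set Q := N.conjTranspose * N with hQ
  have hu : IsUnit Q.det := (Matrix.isUnit_iff_isUnit_det _).1 (isUnit_conjTranspose_mul_self h)
  -- The orthogonal projection onto the range of N. It satisfies L p L* = Q⁻¹ because L N = 1, and
  -- its norm is at most 1.
  set p := N * Q⁻¹ * N.conjTranspose with hp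
  have hpH : p.conjTranspose = p := by
    have hQH : Q.conjTranspose = Q := by
      rw [hQ, Matrix.conjTranspose_mul, Matrix.conjTranspose_conjTranspose]
    rw [hp, Matrix.conjTranspose_mul, Matrix.conjTranspose_mul, Matrix.conjTranspose_conjTranspose,
      Matrix.conjTranspose_nonsing_inv, hQH, Matrix.mul_assoc]
  have hpp : p * p = p := by
    calc p * p = N * Q⁻¹ * (N.conjTranspose * N) * Q⁻¹ * N.conjTranspose := by
          simp only [hp, Matrix.mul_assoc]
      _ = p := by
          rw [← hQ, Matrix.mul_assoc N, Matrix.nonsing_inv_mul _ hu, Matrix.mul_one]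
  have hp1 : ‖p‖ ≤ 1 := by
    have := Matrix.l2_opNorm_conjTranspose_mul_self p
    rw [hpH, hpp] at this
    nlinarith [norm_nonneg p]
  have hQp : Q⁻¹ = L * p * L.conjTranspose := by
    have h' : N.conjTranspose * L.conjTranspose = 1 := by
      rw [← Matrix.conjTranspose_mul, h, Matrix.conjTranspose_one]
    calc Q⁻¹ = (L * N) * Q⁻¹ * (N.conjTranspose * L.conjTranspose) := by
          rw [h, h', Matrix.one_mul, Matrix.mul_one]
      _ = _ := by simp only [hp, Matrix.mul_assoc]
  rw [hQp]
  calc _ ≤ ‖L‖ * ‖p‖ * ‖L.conjTranspose‖ :=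
        (Matrix.l2_opNorm_mul _ _).trans (by gcongr; exact Matrix.l2_opNorm_mul _ _)
    _ ≤ ‖L‖ * 1 * ‖L‖ := by rw [Matrix.l2_opNorm_conjTranspose]; gcongr
    _ = _ := by ring

instance [NeZero d] : NormOneClass (Observable d X) := inferInstance

/-- A lower bound for a partial trace survives an invertible perturbation: `restack X S` is a
multiple of an isometry, so `restack X (W * S)` has an explicit left inverse of norm at most ‖V‖ /
|z|^{1/2}. -/
theorem isUnit_reduce_and_norm_inv_le [NeZero d] {S W V : Observable d Λ} (hVW : V * W = 1) {z : ℂ}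
    (hz : z ≠ 0) (hS : reduce X (S.conjTranspose * S) = z • 1) :
    IsUnit (reduce X ((W * S).conjTranspose * (W * S))) ∧
      ‖(reduce X ((W * S).conjTranspose * (W * S)))⁻¹‖ ≤ ‖V‖ ^ 2 / ‖z‖ := by
  set T := restack X S
  have hT : T.conjTranspose * T = z • 1 := by rw [← hS, reduce_conjTranspose_mul]
  have hTn : ‖T‖ * ‖T‖ = ‖z‖ := by
    rw [← Matrix.l2_opNorm_conjTranspose_mul_self, hT, norm_smul, norm_one, mul_one]
  set L := z⁻¹ • (T.conjTranspose * (V ⊗ₖ (1 : Matrix ((Λ \ X : Finset ℤ) → Fin d) ((Λ \ X : Finset ℤ) → Fin d) ℂ))) with hL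
  have hLN : L * restack X (W * S) = 1 := by
    rw [restack_mul, hL, Matrix.smul_mul, Matrix.mul_assoc, ← Matrix.mul_assoc (V ⊗ₖ _),
      ← Matrix.mul_kronecker_mul, hVW, Matrix.one_mul, Matrix.one_kronecker_one, Matrix.one_mul, hT,
      smul_smul, inv_mul_cancel₀ hz, one_smul]
  rw [reduce_conjTranspose_mul]
  refine ⟨isUnit_conjTranspose_mul_self hLN, (norm_inv_conjTranspose_mul_self_le hLN).trans ?_⟩
  have hLn : ‖L‖ ≤ ‖z‖⁻¹ * (‖T‖ * ‖V‖) := by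
    rw [hL, norm_smul, norm_inv]
    gcongr
    refine (Matrix.l2_opNorm_mul _ _).trans ?_
    rw [Matrix.l2_opNorm_conjTranspose]
    gcongr
    exact norm_kronecker_one_le V
  have hz' : ‖z‖ ≠ 0 := norm_ne_zero_iff.2 hz
  calc ‖L‖ ^ 2 ≤ (‖z‖⁻¹ * (‖T‖ * ‖V‖)) ^ 2 := by gcongr
    _ = ‖z‖⁻¹ ^ 2 * (‖T‖ * ‖T‖) * ‖V‖ ^ 2 := by ring
    _ = _ := by rw [hTn]; field_simp

end Tensor

/-! ### Averages over Gibbs states of subsystems. -/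

section Thermal

variable {d : ℕ} {X Y Λ I A B C : Finset ℤ}

theorem embed_eq_of_eq_empty (hX : X ⊆ Λ) (h0 : X = ∅) (Q : Observable d X) :
    embed hX Q = Q.trace • 1 := by
  subst h0
  exact embed_empty_eq hX Q

theorem reduce_embed_of_disjoint (hX : X ⊆ I) (hΛ : Λ ⊆ I) (hI : I ⊆ X ∪ Λ) (hd : Disjoint X Λ)
    (Q : Observable d Λ) : reduce X (embed hΛ Q) = Q.trace • 1 := by
  rw [reduce_embed hX hΛ hI, embed_eq_of_eq_empty _ (Finset.disjoint_iff_inter_eq_empty.1 hd),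
    trace_reduce Finset.inter_subset_right]

theorem trace_embed_mul_embed (hX : X ⊆ I) (hY : Y ⊆ I) (hI : I ⊆ X ∪ Y) (hd : Disjoint X Y)
    (P : Observable d X) (Q : Observable d Y) :
    (embed hX P * embed hY Q).trace = P.trace * Q.trace := by
  rw [← trace_reduce_mul, reduce_embed_of_disjoint hY hX (by rwa [Finset.union_comm]) hd.symm,
    Matrix.smul_mul, Matrix.one_mul, Matrix.trace_smul, smul_eq_mul]

theorem reduced_reduced (hX : X ⊆ I) (hΛ : Λ ⊆ I) (hI : I ⊆ X ∪ Λ) (Q : Observable d I) :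
    reduced hX (reduced hΛ Q) = reduced (Finset.inter_subset_left.trans hX : X ∩ Λ ⊆ I) Q := by
  rw [reduced, reduced, reduce_embed hX hΛ hI, embed_embed, reduce_reduce _ hΛ]
  · rfl
  · exact Finset.inter_subset_right

theorem reduced_smul (hX : X ⊆ I) (c : ℂ) (Q : Observable d I) :
    reduced hX (c • Q) = c • reduced hX Q := by
  rw [reduced, reduce_smul, embed_smul, reduced]

theorem reduced_add (hX : X ⊆ I) (P Q : Observable d I) :
    reduced hX (P + Q) = reduced hX P + reduced hX Q := by
  rw [reduced, reduce_add]
  exact map_add (embedHom d hX) _ _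

theorem trace_embed_mul_embed_mul_embed (hA : A ⊆ I) (hB : B ⊆ I) (hC : C ⊆ I)
    (hI : I ⊆ A ∪ B ∪ C) (hAB : Disjoint A B) (hAC : Disjoint A C) (hBC : Disjoint B C)
    (P : Observable d A) (Q : Observable d B) (R : Observable d C) :
    (embed hA P * embed hB Q * embed hC R).trace = P.trace * Q.trace * R.trace := by
  have h1 : A ∪ B ⊆ I := Finset.union_subset hA hB
  rw [← embed_embed (Finset.subset_union_left : A ⊆ A ∪ B) h1,
    ← embed_embed (Finset.subset_union_right : B ⊆ A ∪ B) h1, ← embed_mul,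
    trace_embed_mul_embed _ _ hI (Finset.disjoint_union_left.2 ⟨hAC, hBC⟩),
    trace_embed_mul_embed _ _ Finset.Subset.rfl hAB]

/-- The conditional expectation `Q ↦ tr_Y(e^K Q) / tr(e^K)` for `K ∈ 𝔄_Y`. -/
noncomputable def thermal (h : Y ⊆ I) (K : Observable d Y) (Q : Observable d I) : Observable d I :=
  (NormedSpace.exp K).trace⁻¹ •
    reduced (Finset.sdiff_subset : I \ Y ⊆ I) (embed h (NormedSpace.exp K) * Q)

theorem thermal_smul (h : Y ⊆ I) (K : Observable d Y) (c : ℂ) (Q : Observable d I) :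
    thermal h K (c • Q) = c • thermal h K Q := by
  rw [thermal, Matrix.mul_smul, reduced_smul, smul_comm, thermal]

theorem thermal_sub (h : Y ⊆ I) (K : Observable d Y) (P Q : Observable d I) :
    thermal h K (P - Q) = thermal h K P - thermal h K Q := by
  have hadd : ∀ P Q : Observable d I, thermal h K (P + Q) = thermal h K P + thermal h K Q :=
    fun P Q => by simp only [thermal, mul_add, reduced_add, smul_add]
  rw [sub_eq_add_neg, ← neg_one_smul ℂ Q, hadd, thermal_smul, neg_one_smul, ← sub_eq_add_neg]

theorem exp_half_mul_exp_half (K : Observable d Y) :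
    NormedSpace.exp ((1 / 2 : ℝ) • K) * NormedSpace.exp ((1 / 2 : ℝ) • K) = NormedSpace.exp K := by
  let := NormedAlgebra.restrictScalars ℚ ℂ (Observable d Y)
  rw [← NormedSpace.exp_add_of_commute (Commute.refl _), ← add_smul]
  norm_num

theorem isHermitian_exp_smul {K : Observable d Y} (hK : K.IsHermitian) (s : ℝ) :
    (NormedSpace.exp (s • K)).IsHermitian := by
  refine Matrix.IsHermitian.exp ?_
  rw [Matrix.IsHermitian, Matrix.conjTranspose_smul, hK.eq, star_trivial]

theorem exp_mul_exp_neg [NeZero d] (K : Observable d Y) : NormedSpace.exp K * NormedSpace.exp (-K) = 1 := by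
  simpa using exp_smul_mul_exp_neg_smul 1 K

theorem exp_neg_mul_exp [NeZero d] (K : Observable d Y) : NormedSpace.exp (-K) * NormedSpace.exp K = 1 := by
  simpa using exp_mul_exp_neg (-K)

theorem trace_exp_ne_zero [NeZero d] {K : Observable d Y} (hK : K.IsHermitian) :
    (NormedSpace.exp K).trace ≠ 0 := by
  intro h
  have hS := isHermitian_exp_smul hK (1 / 2)
  rw [← exp_half_mul_exp_half K] at h
  nth_rw 1 [← hS.eq] at h
  open scoped ComplexOrder in
  rw [Matrix.trace_conjTranspose_mul_self_eq_zero_iff] at h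
  have h1 := exp_smul_mul_exp_neg_smul (1 / 2) K
  rw [h, zero_mul] at h1
  exact zero_ne_one h1

theorem reduced_exp_mul [NeZero d] (h : Y ⊆ I) {K : Observable d Y} (hK : K.IsHermitian)
    (Q : Observable d I) : reduced (Finset.sdiff_subset : I \ Y ⊆ I) (embed h (NormedSpace.exp K) * Q) =
      (NormedSpace.exp K).trace • thermal h K Q := by
  rw [thermal, smul_smul, mul_inv_cancel₀ (trace_exp_ne_zero hK), one_smul]

/-- With S = e^{K/2}, one of the two factors S is moved cyclically to the other side of Q, since the
partial trace is over its support. This gives tr_Y(S* Q S), whose norm is at most ‖tr_Y(S* S)‖ ‖Q‖ =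
|tr e^K| ‖Q‖. -/
theorem norm_thermal_le [NeZero d] (h : Y ⊆ I) {K : Observable d Y} (hK : K.IsHermitian)
    (Q : Observable d I) : ‖thermal h K Q‖ ≤ ‖Q‖ := by
  have hz := trace_exp_ne_zero hK
  set S := embed h (NormedSpace.exp ((1 / 2 : ℝ) • K)) with hS
  have hSH : S.conjTranspose = S := by
    have : S.conjTranspose = embed h (NormedSpace.exp ((1 / 2 : ℝ) • K)).conjTranspose :=
      (map_star (embedHom d h) _).symm
    rw [this, (isHermitian_exp_smul hK _).eq]
  have hSS : S * S = embed h (NormedSpace.exp K) := by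
    rw [hS, ← embed_mul, exp_half_mul_exp_half]
  have h1 : reduce (I \ Y) (embed h (NormedSpace.exp K) * Q) =
      reduce (I \ Y) (S.conjTranspose * Q * S) := by
    rw [← hSS, mul_assoc, hS, reduce_embed_mul_comm Finset.sdiff_subset h Finset.sdiff_disjoint,
      ← hS, hSH]
  have h2 : reduce (I \ Y) (S.conjTranspose * S) = (NormedSpace.exp K).trace • 1 := by
    rw [hSH, hSS, reduce_embed_of_disjoint Finset.sdiff_subset h _ Finset.sdiff_disjoint]
    rw [Finset.sdiff_union_of_subset h]
  rw [thermal, norm_smul, norm_inv, reduced, h1]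
  have h3 := (norm_embed_le (Finset.sdiff_subset : I \ Y ⊆ I) _).trans
    (norm_reduce_conj_le (X := I \ Y) S Q)
  rw [h2, norm_smul, norm_one, mul_one] at h3
  rw [inv_mul_le_iff₀ (norm_pos_iff.2 hz)]
  exact h3

theorem thermal_embed_mul (hX : X ⊆ I) (hY : Y ⊆ I) (hd : Disjoint X Y) (K : Observable d Y)
    (P : Observable d X) (Q : Observable d I) :
    thermal hY K (embed hX P * Q) = embed hX P * thermal hY K Q := by
  have hXY : X ⊆ I \ Y := Finset.subset_sdiff.2 ⟨hX, hd⟩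
  rw [thermal, ← mul_assoc, ← (commute_embed hX hY hd P _).eq, mul_assoc,
    ← embed_embed hXY Finset.sdiff_subset, reduced, reduce_embed_mul, embed_mul, thermal, reduced,
    Matrix.mul_smul]

theorem thermal_mul_embed (hX : X ⊆ I) (hY : Y ⊆ I) (hd : Disjoint X Y) (K : Observable d Y)
    (Q : Observable d I) (P : Observable d X) :
    thermal hY K (Q * embed hX P) = thermal hY K Q * embed hX P := by
  have hXY : X ⊆ I \ Y := Finset.subset_sdiff.2 ⟨hX, hd⟩
  rw [thermal, ← mul_assoc, ← embed_embed hXY Finset.sdiff_subset, reduced, reduce_mul_embed,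
    embed_mul, thermal, reduced, Matrix.smul_mul]

theorem thermal_embed (hY : Y ⊆ I) (K P : Observable d Y) :
    thermal hY K (embed hY P) =
      ((NormedSpace.exp K).trace⁻¹ * (NormedSpace.exp K * P).trace) • 1 := by
  rw [thermal, ← embed_mul, reduced,
    reduce_embed_of_disjoint Finset.sdiff_subset hY (by rw [Finset.sdiff_union_of_subset hY])
      Finset.sdiff_disjoint, embed_smul, embed_one, smul_smul]

/-- Enlarging the ambient set. -/
theorem thermal_embed_ambient (hY : Y ⊆ Λ) (hΛ : Λ ⊆ I) (K : Observable d Y) (Q : Observable d Λ) :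
    thermal (hY.trans hΛ) K (embed hΛ Q) = embed hΛ (thermal hY K Q) := by
  have key : ∀ (X : Finset ℤ) (hX : X ⊆ Λ), X = Λ \ Y → ∀ P : Observable d Λ,
      embed (hX.trans hΛ) (reduce X P) = embed hΛ (embed Finset.sdiff_subset (reduce (Λ \ Y) P)) := by
    rintro X hX rfl P
    rw [embed_embed]
  have hset : I \ Y ∩ Λ = Λ \ Y := by
    ext x
    simp only [Finset.mem_inter, Finset.mem_sdiff]
    exact ⟨fun h => ⟨h.2, h.1.2⟩, fun h => ⟨⟨hΛ h.1, h.2⟩, h.1⟩⟩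
  rw [thermal, ← embed_embed hY hΛ, ← embed_mul, reduced, reduce_embed Finset.sdiff_subset hΛ _,
    embed_embed, thermal, embed_smul, reduced, key _ Finset.inter_subset_right hset]
  intro x hx
  by_cases hxY : x ∈ Y
  · exact Finset.mem_union_right _ (hY hxY)
  · exact Finset.mem_union_left _ (Finset.mem_sdiff.2 ⟨hx, hxY⟩)

/-- The contraction property of the thermal average in the case Y = I. -/
theorem norm_trace_exp_mul_le [NeZero d] {K : Observable d I} (hK : K.IsHermitian)
    (Q : Observable d I) :
    ‖(NormedSpace.exp K * Q).trace‖ ≤ ‖(NormedSpace.exp K).trace‖ * ‖Q‖ := by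
  have hz := trace_exp_ne_zero hK
  have h1 := norm_thermal_le Finset.Subset.rfl hK Q
  have h2 := thermal_embed Finset.Subset.rfl K Q
  have h3 : embed Finset.Subset.rfl Q = Q := by
    ext σ τ
    simp only [embed, Matrix.of_apply]
    rw [if_pos fun x hx => absurd x.2 hx]
    rfl
  rw [h3] at h2
  rw [h2, norm_smul, norm_one, mul_one, norm_mul, norm_inv] at h1
  rwa [inv_mul_le_iff₀ (norm_pos_iff.2 hz)] at h1

/-! ### Three subsystems -/

/-- `I` is the disjoint union of `A`, `B` and `C`. -/
structure IsPartition (A B C I : Finset ℤ) : Prop where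
  left : A ⊆ I
  mid : B ⊆ I
  right : C ⊆ I
  subset : I ⊆ A ∪ B ∪ C
  left_mid : Disjoint A B
  left_right : Disjoint A C
  mid_right : Disjoint B C

theorem IsPartition.symm (h : IsPartition A B C I) : IsPartition C B A I where
  left := h.right
  mid := h.mid
  right := h.left
  subset := h.subset.trans fun x => by simp only [Finset.mem_union]; tauto
  left_mid := h.mid_right.symm
  left_right := h.left_right.symm
  mid_right := h.left_mid.symm

theorem IsPartition.sdiff_mid (h : IsPartition A B C I) : I \ B = A ∪ C := by
  ext x
  have h1 : x ∈ I → x ∈ A ∪ B ∪ C := fun hx => h.subset hx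
  have h2 := fun hx : x ∈ A => h.left hx
  have h3 := fun hx : x ∈ C => h.right hx
  have h4 := fun (hx : x ∈ A) (hx' : x ∈ B) => Finset.disjoint_left.1 h.left_mid hx hx'
  have h5 := fun (hx : x ∈ B) (hx' : x ∈ C) => Finset.disjoint_left.1 h.mid_right hx hx'
  simp only [Finset.mem_union, Finset.mem_sdiff] at *
  tauto

theorem IsPartition.sdiff_right_inter (h : IsPartition A B C I) : I \ C ∩ (I \ B) = A := by
  ext x
  have h1 : x ∈ I → x ∈ A ∪ B ∪ C := fun hx => h.subset hx
  have h2 := fun hx : x ∈ A => h.left hx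
  have h4 := fun (hx : x ∈ A) (hx' : x ∈ B) => Finset.disjoint_left.1 h.left_mid hx hx'
  have h5 := fun (hx : x ∈ A) (hx' : x ∈ C) => Finset.disjoint_left.1 h.left_right hx hx'
  simp only [Finset.mem_union, Finset.mem_sdiff, Finset.mem_inter] at *
  tauto

variable (KA : Observable d A) (KB : Observable d B) (KC : Observable d C)

/-- `e^{K_A} e^{K_C} e^{K_B}` -/
noncomputable def IsPartition.prod (h : IsPartition A B C I) : Observable d I :=
  embed h.left (NormedSpace.exp KA) * embed h.right (NormedSpace.exp KC) *
    embed h.mid (NormedSpace.exp KB)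

variable {KA KB KC}

theorem IsPartition.trace_prod (h : IsPartition A B C I) :
    (h.prod KA KB KC).trace = (NormedSpace.exp KA).trace * (NormedSpace.exp KB).trace *
      (NormedSpace.exp KC).trace := by
  rw [prod, trace_embed_mul_embed_mul_embed h.left h.right h.mid _ h.left_right h.left_mid
    h.mid_right.symm]
  · ring
  · exact h.subset.trans fun x => by simp only [Finset.mem_union]; tauto

theorem IsPartition.reduced_left_right [NeZero d] (h : IsPartition A B C I) (hB : KB.IsHermitian)
    (hAC : A ∪ C ⊆ I) (Q : Observable d I) :
    reduced hAC (h.prod KA KB KC * Q) = (NormedSpace.exp KB).trace •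
      (embed h.left (NormedSpace.exp KA) * embed h.right (NormedSpace.exp KC) *
        thermal h.mid KB Q) := by
  have hz := trace_exp_ne_zero hB
  rw [reduced_congr h.sdiff_mid.symm hAC Finset.sdiff_subset, mul_assoc,
    ← thermal_embed_mul h.right h.mid h.mid_right.symm, ← thermal_embed_mul h.left h.mid h.left_mid,
    thermal, smul_smul, mul_inv_cancel₀ hz, one_smul, prod]
  congr 1
  have h1 := (commute_embed h.left h.mid h.left_mid (NormedSpace.exp KA) (NormedSpace.exp KB)).eq
  have h2 := (commute_embed h.right h.mid h.mid_right.symm (NormedSpace.exp KC) (NormedSpace.exp KB)).eq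
  simp only [← mul_assoc]
  rw [← h1, mul_assoc (embed h.left (NormedSpace.exp KA)), h2, ← mul_assoc]

/-- The trace is taken over B and then over C. The sets I \ C and I \ B cover I and meet in A, as
needed for composing partial traces. -/
theorem IsPartition.reduced_left [NeZero d] (h : IsPartition A B C I) (hB : KB.IsHermitian)
    (hC : KC.IsHermitian) (Q : Observable d I) :
    reduced h.left (h.prod KA KB KC * Q) = ((NormedSpace.exp KB).trace * (NormedSpace.exp KC).trace) •
      (embed h.left (NormedSpace.exp KA) * thermal h.right KC (thermal h.mid KB Q)) := by
  have hI : I ⊆ I \ C ∪ I \ B := fun x hx => by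
    have := fun hx' : x ∈ B => Finset.disjoint_left.1 h.mid_right hx'
    simp only [Finset.mem_union, Finset.mem_sdiff]
    tauto
  rw [reduced_congr h.sdiff_right_inter.symm h.left (Finset.inter_subset_left.trans Finset.sdiff_subset),
    ← reduced_reduced Finset.sdiff_subset Finset.sdiff_subset hI,
    reduced_congr h.sdiff_mid Finset.sdiff_subset (Finset.union_subset h.left h.right),
    h.reduced_left_right hB, (commute_embed h.left h.right h.left_right _ _).eq, mul_assoc,
    reduced_smul, reduced_exp_mul _ hC, thermal_embed_mul h.left h.right h.left_right, mul_smul]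

theorem IsPartition.trace_prod_mul [NeZero d] (h : IsPartition A B C I) (hA : KA.IsHermitian)
    (hB : KB.IsHermitian) (hC : KC.IsHermitian) (Q : Observable d I) :
    (h.prod KA KB KC * Q).trace • (1 : Observable d I) =
      ((NormedSpace.exp KA).trace * (NormedSpace.exp KB).trace * (NormedSpace.exp KC).trace) •
        thermal h.left KA (thermal h.right KC (thermal h.mid KB Q)) := by
  have hI : I ⊆ I \ A ∪ A := by rw [Finset.sdiff_union_of_subset h.left]
  have h1 : reduced (Finset.sdiff_subset : I \ A ⊆ I) (reduced h.left (h.prod KA KB KC * Q)) =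
      (h.prod KA KB KC * Q).trace • 1 := by
    rw [reduced, reduced, reduce_embed_of_disjoint Finset.sdiff_subset h.left hI
      Finset.sdiff_disjoint, trace_reduce h.left, embed_smul, embed_one]
  rw [← h1, h.reduced_left hB hC, reduced_smul, reduced_exp_mul _ hA, smul_smul]
  congr 1
  ring

/-- Upper and lower bounds for the ratio of partition functions. -/
theorem IsPartition.norm_trace_prod_le [NeZero d] (h : IsPartition A B C I) {K : Observable d I}
    (hK : K.IsHermitian) {V : Observable d I} (hV : NormedSpace.exp K * V = h.prod KA KB KC) :
    ‖(NormedSpace.exp KA).trace * (NormedSpace.exp KB).trace * (NormedSpace.exp KC).trace‖ ≤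
      ‖(NormedSpace.exp K).trace‖ * ‖V‖ := by
  rw [← h.trace_prod, ← hV]
  exact norm_trace_exp_mul_le hK V

theorem IsPartition.norm_trace_le [NeZero d] (h : IsPartition A B C I) (hA : KA.IsHermitian)
    (hB : KB.IsHermitian) (hC : KC.IsHermitian) (Q : Observable d I) :
    ‖(h.prod KA KB KC * Q).trace‖ ≤
      ‖(NormedSpace.exp KA).trace * (NormedSpace.exp KB).trace * (NormedSpace.exp KC).trace‖ * ‖Q‖ := by
  have h1 := congrArg norm (h.trace_prod_mul hA hB hC Q)
  rw [norm_smul, norm_one, mul_one, norm_smul] at h1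
  rw [h1]
  gcongr
  exact (norm_thermal_le _ hA _).trans ((norm_thermal_le _ hC _).trans (norm_thermal_le _ hB _))

/-- The reduction of `e^K` to `A` is bounded from below. -/
theorem IsPartition.exists_inv_thermal [NeZero d] (h : IsPartition A B C I) {K : Observable d I}
    (hK : K.IsHermitian) (hB : KB.IsHermitian) (hC : KC.IsHermitian) {Q : Observable d I}
    (hQ : h.prod KA KB KC * Q = NormedSpace.exp K) {G : ℝ}
    (hG : ‖NormedSpace.exp ((1 / 2 : ℝ) • (embed h.mid KB + embed h.right KC)) *
      NormedSpace.exp ((-(1 / 2) : ℝ) • K)‖ ≤ G) :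
    ∃ N : Observable d I, N * thermal h.right KC (thermal h.mid KB Q) = 1 ∧
      ‖N‖ ≤ G ^ 2 * ‖NormedSpace.exp KA‖ := by
  let := NormedAlgebra.restrictScalars ℚ ℂ (Observable d I)
  set L := embed h.mid KB + embed h.right KC with hL
  have hemb : ∀ {X : Finset ℤ} (hX : X ⊆ I) {P : Observable d X}, P.IsHermitian →
      (embed hX P).IsHermitian := fun {X} hX {P} hP => by
    have := (map_star (embedHom d hX) P).symm
    rwa [Matrix.star_eq_conjTranspose, Matrix.star_eq_conjTranspose, hP.eq] at this
  have hLH : L.IsHermitian := (hemb _ hB).add (hemb _ hC)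
  set z := (NormedSpace.exp KB).trace * (NormedSpace.exp KC).trace with hzdef
  have hz : z ≠ 0 := mul_ne_zero (trace_exp_ne_zero hB) (trace_exp_ne_zero hC)
  set S := NormedSpace.exp ((1 / 2 : ℝ) • L) with hS
  -- W turns the square root e^{L/2} of the decoupled operator into e^{K/2}, and V is its inverse.
  -- Tracing S* S = e^L over B and C gives the scalar z, so the lower bound for perturbed partial
  -- traces applies to e^K.
  set W := NormedSpace.exp ((1 / 2 : ℝ) • K) * NormedSpace.exp ((-(1 / 2) : ℝ) • L) with hW
  set V := S * NormedSpace.exp ((-(1 / 2) : ℝ) • K) with hV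
  have hVW : V * W = 1 := by
    rw [hV, hW, mul_assoc, ← mul_assoc (NormedSpace.exp ((-(1 / 2) : ℝ) • K)),
      exp_neg_smul_mul_exp_smul, one_mul, hS, exp_smul_mul_exp_neg_smul]
  have hWS : W * S = NormedSpace.exp ((1 / 2 : ℝ) • K) := by
    rw [hW, hS, mul_assoc, exp_neg_smul_mul_exp_smul, mul_one]
  have hexp : (W * S).conjTranspose * (W * S) = NormedSpace.exp K := by
    rw [hWS, (isHermitian_exp_smul hK _).eq, exp_half_mul_exp_half]
  have hSS : reduce A (S.conjTranspose * S) = z • 1 := by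
    rw [hS, (isHermitian_exp_smul hLH _).eq, exp_half_mul_exp_half, hL,
      NormedSpace.exp_add_of_commute (commute_embed h.mid h.right h.mid_right KB KC), ← embed_exp,
      ← embed_exp]
    refine eq_of_trace_mul fun R => ?_
    rw [trace_reduce_mul h.left, trace_embed_mul_embed_mul_embed h.mid h.right h.left _ h.mid_right
      h.left_mid.symm h.left_right.symm, Matrix.smul_mul, Matrix.one_mul, Matrix.trace_smul,
      smul_eq_mul]
    exact h.subset.trans fun x => by simp only [Finset.mem_union]; tauto
  obtain ⟨hu, hle⟩ := isUnit_reduce_and_norm_inv_le hVW hz hSS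
  rw [hexp] at hu hle
  set M := reduce A (NormedSpace.exp K) with hM
  have hMM : M⁻¹ * M = 1 := Matrix.nonsing_inv_mul _ ((Matrix.isUnit_iff_isUnit_det _).1 hu)
  have hp : embed h.left M = z • (embed h.left (NormedSpace.exp KA) *
      thermal h.right KC (thermal h.mid KB Q)) := by
    rw [hzdef, ← h.reduced_left hB hC, hQ]
    rfl
  refine ⟨z • (embed h.left (M⁻¹ * NormedSpace.exp KA)), ?_, ?_⟩
  · rw [Matrix.smul_mul, embed_mul, mul_assoc, ← Matrix.mul_smul, ← hp, ← embed_mul, hMM, embed_one]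
  · rw [norm_smul]
    calc ‖z‖ * ‖embed h.left (M⁻¹ * NormedSpace.exp KA)‖
        ≤ ‖z‖ * (‖V‖ ^ 2 / ‖z‖ * ‖NormedSpace.exp KA‖) := by
          gcongr
          exact (norm_embed_le _ _).trans ((norm_mul_le _ _).trans (by gcongr))
      _ = ‖V‖ ^ 2 * ‖NormedSpace.exp KA‖ := by
          have : ‖z‖ ≠ 0 := norm_ne_zero_iff.2 hz
          field_simp
      _ ≤ G ^ 2 * ‖NormedSpace.exp KA‖ := by gcongr

end Thermal

/-! ### From the correlation function to operator norms. -/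

section Correlations

variable {d : ℕ} {X Y Λ I A B C : Finset ℤ}

theorem norm_single_one {n : Type*} [Fintype n] [DecidableEq n] (i j : n) :
    ‖(Matrix.single i j 1 : Matrix n n ℂ)‖ = 1 := by
  have h := Matrix.l2_opNorm_conjTranspose_mul_self (Matrix.single i j 1 : Matrix n n ℂ)
  rw [Matrix.conjTranspose_single, Matrix.single_mul_single_same, star_one, one_mul,
    ← Matrix.diagonal_single, Matrix.l2_opNorm_diagonal, Pi.norm_single, norm_one] at h
  nlinarith [norm_nonneg (Matrix.single i j 1 : Matrix n n ℂ)]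

/-- Crude, but a loss exponential in the number of sites is affordable: it is only incurred on
truncated regions. -/
theorem norm_le_of_forall_entry {n : Type*} [Fintype n] [DecidableEq n] (D : Matrix n n ℂ) {c : ℝ}
    (h : ∀ i j, ‖D i j‖ ≤ c) : ‖D‖ ≤ (Fintype.card n : ℝ) ^ 2 * c := by
  have h1 : ∀ i j, ‖Matrix.single i j (D i j)‖ ≤ c := fun i j => by
    have : Matrix.single i j (D i j) = D i j • Matrix.single i j 1 := by
      rw [Matrix.smul_single, smul_eq_mul, mul_one]
    rw [this, norm_smul, norm_single_one, mul_one]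
    exact h i j
  conv_lhs => rw [Matrix.matrix_eq_sum_single D]
  refine (norm_sum_le_of_le _ fun i _ => norm_sum_le_of_le _ fun j _ => h1 i j).trans ?_
  simp only [Finset.sum_const, Finset.card_univ, nsmul_eq_mul]
  exact le_of_eq (by ring)

/-- Matrix units of A ∪ C are products of matrix units of A and C, which have norm one. Every matrix
entry of ρ_{AC} - ρ_A ⊗ ρ_C is thus one of the values in the supremum defining `corr`. -/
theorem single_eq_embed_mul_embed (hAC : Disjoint A C) (σ τ : (A ∪ C : Finset ℤ) → Fin d) :
    (Matrix.single σ τ 1 : Observable d (A ∪ C)) =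
      embed Finset.subset_union_left (Matrix.single
        (Finset.restrict₂ (π := fun _ => Fin d) Finset.subset_union_left σ)
        (Finset.restrict₂ (π := fun _ => Fin d) Finset.subset_union_left τ) 1 : Observable d A) *
      embed Finset.subset_union_right (Matrix.single
        (Finset.restrict₂ (π := fun _ => Fin d) Finset.subset_union_right σ)
        (Finset.restrict₂ (π := fun _ => Fin d) Finset.subset_union_right τ) 1 : Observable d C) := by
  have hC : ∀ x ∈ C, x ∉ A := fun x hx hx' => Finset.disjoint_left.1 hAC hx' hx
  have hall : ∀ {α β : (A ∪ C : Finset ℤ) → Fin d},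
      (∀ x : (A ∪ C : Finset ℤ), x.1 ∈ A → α x = β x) →
      (∀ x : (A ∪ C : Finset ℤ), x.1 ∈ C → α x = β x) → α = β := fun {α β} h1 h2 =>
    funext fun x => (Finset.mem_union.1 x.2).elim (h1 x) (h2 x)
  have hr : ∀ {X : Finset ℤ} (hX : X ⊆ A ∪ C) {α β : (A ∪ C : Finset ℤ) → Fin d},
      Finset.restrict₂ (π := fun _ => Fin d) hX α = Finset.restrict₂ (π := fun _ => Fin d) hX β →
      ∀ x : (A ∪ C : Finset ℤ), x.1 ∈ X → α x = β x := fun {X} hX {α β} h x hx =>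
    congrFun h ⟨x.1, hx⟩
  ext α β
  rw [Matrix.mul_apply]
  by_cases h : σ = α ∧ τ = β
  · obtain ⟨rfl, rfl⟩ := h
    rw [Matrix.single_apply_same]
    -- The only intermediate configuration that contributes: the factor on A has already changed σ
    -- into τ on A, and the factor on C has not acted yet.
    set γ : (A ∪ C : Finset ℤ) → Fin d := fun x => if x.1 ∈ A then τ x else σ x with hγ
    rw [Finset.sum_eq_single γ]
    · have h1 : ∀ x : (A ∪ C : Finset ℤ), x.1 ∉ A → σ x = γ x := fun x hx => by simp [hγ, hx]
      have h2 : ∀ x : (A ∪ C : Finset ℤ), x.1 ∉ C → γ x = τ x := fun x hx => by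
        simp [hγ, (Finset.mem_union.1 x.2).resolve_right hx]
      have h3 : Finset.restrict₂ (π := fun _ => Fin d) Finset.subset_union_left γ =
          Finset.restrict₂ (π := fun _ => Fin d) (Finset.subset_union_left : A ⊆ A ∪ C) τ :=
        funext fun x => by simp [hγ, Finset.restrict₂]
      have h4 : Finset.restrict₂ (π := fun _ => Fin d) Finset.subset_union_right γ =
          Finset.restrict₂ (π := fun _ => Fin d) (Finset.subset_union_right : C ⊆ A ∪ C) σ :=
        funext fun x => by simp [hγ, Finset.restrict₂, hC x.1 x.2]
      simp only [embed, Matrix.of_apply]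
      rw [if_pos h1, if_pos h2, h3, h4, Matrix.single_apply_same, Matrix.single_apply_same, one_mul]
    · intro γ' _ hne
      simp only [embed, Matrix.of_apply]
      by_contra hcon
      rw [mul_eq_zero, not_or, ite_eq_right_iff, ite_eq_right_iff] at hcon
      push Not at hcon
      obtain ⟨⟨h1, h2⟩, h3, h4⟩ := hcon
      refine hne (hall (fun x hx => ?_) fun x hx => ?_)
      · rw [h3 x fun hx' => hC x.1 hx' hx]
        simp [hγ, hx]
      · rw [← h1 x (hC x.1 hx)]
        simp [hγ, hC x.1 hx]
    · simp
  · rw [Matrix.single_apply, if_neg h]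
    symm
    refine Finset.sum_eq_zero fun γ _ => ?_
    simp only [embed, Matrix.of_apply]
    by_contra hcon
    rw [mul_eq_zero, not_or, ite_eq_right_iff, ite_eq_right_iff] at hcon
    push Not at hcon
    obtain ⟨⟨h1, h2⟩, h3, h4⟩ := hcon
    rw [Matrix.single_apply, ne_eq, ite_eq_right_iff] at h2 h4
    push Not at h2 h4
    obtain ⟨⟨h5, h6⟩, -⟩ := h2
    obtain ⟨⟨h7, h8⟩, -⟩ := h4
    refine h ⟨hall (hr _ h5) fun x hx => ?_, hall (fun x hx => ?_) (hr _ h8)⟩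
    · rw [h1 x (hC x.1 hx)]
      exact hr _ h7 x hx
    · rw [← h3 x fun hx' => hC x.1 hx' hx]
      exact hr _ h6 x hx

theorem norm_reduced_sub_le (hA : A ⊆ Λ) (hC : C ⊆ Λ) (hAC : Disjoint A C) (ρ : Observable d Λ) :
    ‖reduced (Finset.union_subset hA hC) ρ - reduced hA ρ * reduced hC ρ‖ ≤
      ((d : ℝ) ^ (A ∪ C).card) ^ 2 * corr ρ A C := by
  set D := reduce (A ∪ C) ρ - embed (Finset.subset_union_left (s₁ := A) (s₂ := C)) (reduce A ρ) *
    embed (Finset.subset_union_right (s₁ := A) (s₂ := C)) (reduce C ρ) with hD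
  have h1 : reduced (Finset.union_subset hA hC) ρ - reduced hA ρ * reduced hC ρ =
      embed (Finset.union_subset hA hC) D := by
    have : embed (Finset.union_subset hA hC) D = embedHom d (Finset.union_subset hA hC) D := rfl
    rw [this, hD, map_sub, map_mul]
    simp only [embedHom_apply, embed_embed]
    rfl
  rw [h1]
  refine (norm_embed_le _ _).trans ((norm_le_of_forall_entry D (c := corr ρ A C) fun σ τ => ?_).trans ?_)
  -- The indices are swapped because tr(E_{τσ} D) = D_{στ}.
  · have h2 := le_corr ρ A C (Matrix.single
      (Finset.restrict₂ (π := fun _ => Fin d) Finset.subset_union_left τ)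
      (Finset.restrict₂ (π := fun _ => Fin d) Finset.subset_union_left σ) 1) (Matrix.single
      (Finset.restrict₂ (π := fun _ => Fin d) Finset.subset_union_right τ)
      (Finset.restrict₂ (π := fun _ => Fin d) Finset.subset_union_right σ) 1)
      (norm_single_one _ _) (norm_single_one _ _)
    rw [← single_eq_embed_mul_embed hAC, ← hD, Matrix.trace_single_mul, one_smul] at h2
    exact h2
  · simp

/-- The bound for tr(e^K Q) at K = 0. -/
theorem norm_trace_le [NeZero d] (Q : Observable d X) : ‖Q.trace‖ ≤ (d : ℝ) ^ X.card * ‖Q‖ := by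
  have h := norm_trace_exp_mul_le (K := (0 : Observable d X)) Matrix.isHermitian_zero Q
  rw [NormedSpace.exp_zero, one_mul, Matrix.trace_one] at h
  simpa using h

end Correlations

/-! ### Hamiltonians as sums of short terms, and removal of the constant term. -/

section Hamiltonian

variable {d : ℕ} {X Y Λ I A B C : Finset ℤ} {Φ : LocalInteraction d}

/-- The interaction terms, as observables of `I`. -/
noncomputable def LocalInteraction.termIn (Φ : LocalInteraction d) (I X : Finset ℤ) : Observable d I :=
  if h : X ⊆ I then embed h (Φ.term X) else 0

theorem norm_termIn_le {J : ℝ} (hJ : Φ.HasStrength J) (I X : Finset ℤ) : ‖Φ.termIn I X‖ ≤ J := by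
  rw [LocalInteraction.termIn]
  split_ifs with h
  · exact (norm_embed_le _ _).trans (hJ X)
  · rw [norm_zero]
    exact (norm_nonneg _).trans (hJ ∅)

theorem commute_termIn (I X Y : Finset ℤ) (h : Disjoint X Y) :
    Commute (Φ.termIn I X) (Φ.termIn I Y) := by
  rw [LocalInteraction.termIn, LocalInteraction.termIn]
  split_ifs with hX hY
  · exact commute_embed hX hY h _ _
  · exact Commute.zero_right _
  · exact Commute.zero_left _
  · exact Commute.zero_left _

theorem embed_hamiltonian_eq_sum (h : Λ ⊆ I) :
    embed h (Φ.hamiltonian Λ) = ∑ X ∈ Λ.powerset, Φ.termIn I X := by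
  have h1 : embed h (Φ.hamiltonian Λ) = embedHom d h (Φ.hamiltonian Λ) := rfl
  rw [h1, LocalInteraction.hamiltonian, map_sum, ← Finset.sum_attach Λ.powerset (Φ.termIn I)]
  refine Finset.sum_congr rfl fun X _ => ?_
  have hX := (Finset.mem_powerset.1 X.2).trans h
  rw [embedHom_apply, embed_embed, LocalInteraction.termIn, dif_pos hX]

/-- The empty set has diameter zero, so finite range does not exclude it. It lies in every region
and would be counted three times in H_A + H_B + H_C, so its term has to vanish. -/
theorem embed_hamiltonian_eq_localSum {r : ℝ} (hr : Φ.HasRange r) (h0 : Φ.term ∅ = 0) {R : ℕ}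
    (hR : r ≤ R) (h : Λ ⊆ I) : embed h (Φ.hamiltonian Λ) = localSum (Φ.termIn I) R Λ := by
  rw [embed_hamiltonian_eq_sum, localSum, shortSets]
  symm
  refine Finset.sum_subset (Finset.filter_subset _ _) fun X hX hX' => ?_
  have hterm : Φ.term X = 0 := by
    by_cases hne : X.Nonempty
    · have : ¬ ∀ x ∈ X, ∀ y ∈ X, |x - y| ≤ (R : ℤ) := fun hd =>
        hX' (Finset.mem_filter.2 ⟨hX, hne, hd⟩)
      push Not at this
      obtain ⟨x, hx, y, hy, hxy⟩ := this
      refine hr X ?_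
      have h1 := Metric.dist_le_diam_of_mem X.finite_toSet.isBounded (x := x) (y := y)
        (Finset.mem_coe.2 hx) (Finset.mem_coe.2 hy)
      rw [Int.dist_eq] at h1
      have h2 : (R : ℝ) < |(x : ℝ) - y| := by exact_mod_cast hxy
      linarith
    · rw [Finset.not_nonempty_iff_eq_empty.1 hne, h0]
  rw [LocalInteraction.termIn]
  split_ifs with hXI
  · rw [hterm]
    exact (embedLin hXI).map_zero
  · rfl

theorem isHermitian_embed (h : X ⊆ Λ) {P : Observable d X} (hP : P.IsHermitian) :
    (embed h P).IsHermitian := by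
  have := (map_star (embedHom d h) P).symm
  rwa [Matrix.star_eq_conjTranspose, Matrix.star_eq_conjTranspose, hP.eq] at this

theorem isHermitian_hamiltonian (Φ : LocalInteraction d) (Λ : Finset ℤ) :
    (Φ.hamiltonian Λ).IsHermitian := by
  rw [LocalInteraction.hamiltonian, Matrix.IsHermitian, Matrix.conjTranspose_sum]
  exact Finset.sum_congr rfl fun X _ => isHermitian_embed _ (Φ.isHermitian X.1)

theorem embed_rfl (Q : Observable d X) : embed Finset.Subset.rfl Q = Q := by
  ext σ τ
  simp only [embed, Matrix.of_apply]
  rw [if_pos fun x hx => absurd x.2 hx]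
  rfl

theorem norm_hamiltonian_le [NeZero d] {r J : ℝ} (hr : Φ.HasRange r) (hJ : Φ.HasStrength J)
    (h0 : Φ.term ∅ = 0) {R : ℕ} (hR : r ≤ R) (Λ : Finset ℤ) :
    ‖Φ.hamiltonian Λ‖ ≤ J * 2 ^ (2 * R + 1) * Λ.card := by
  rw [← embed_rfl (Φ.hamiltonian Λ), embed_hamiltonian_eq_localSum hr h0 hR]
  exact norm_localSum_le (norm_termIn_le hJ Λ) Λ

/-- The interaction without its constant term. -/
noncomputable def LocalInteraction.dropConst (Φ : LocalInteraction d) : LocalInteraction d where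
  term X := if X = ∅ then 0 else Φ.term X
  isHermitian X := by
    split_ifs
    · exact Matrix.isHermitian_zero
    · exact Φ.isHermitian X

theorem hamiltonian_eq_dropConst_add (Φ : LocalInteraction d) (Λ : Finset ℤ) :
    Φ.hamiltonian Λ = Φ.dropConst.hamiltonian Λ + (Φ.term ∅).trace • 1 := by
  have h1 : ∀ Ψ : LocalInteraction d, Ψ.hamiltonian Λ =
      ∑ X ∈ Λ.powerset.erase ∅, Ψ.termIn Λ X + (Ψ.term ∅).trace • 1 := fun Ψ => by
    rw [← embed_rfl (Ψ.hamiltonian Λ), embed_hamiltonian_eq_sum,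
      ← Finset.sum_erase_add _ _ (Finset.empty_mem_powerset Λ), LocalInteraction.termIn.eq_def Ψ Λ ∅,
      dif_pos (Finset.empty_subset Λ), embed_empty_eq]
  rw [h1, h1 Φ.dropConst]
  have h2 : Φ.dropConst.term ∅ = 0 := by simp [LocalInteraction.dropConst]
  rw [h2, Matrix.trace_zero, zero_smul, add_zero]
  congr 1
  refine Finset.sum_congr rfl fun X hX => ?_
  have : Φ.dropConst.term X = Φ.term X := by
    simp [LocalInteraction.dropConst, (Finset.mem_erase.1 hX).1]
  rw [LocalInteraction.termIn, LocalInteraction.termIn, this]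

/-- The constant term multiplies e^{-H} by a nonzero scalar, which cancels in the normalization. -/
theorem gibbs_dropConst (Φ : LocalInteraction d) (Λ : Finset ℤ) :
    Φ.dropConst.gibbs Λ = Φ.gibbs Λ := by
  let := NormedAlgebra.restrictScalars ℚ ℂ (Observable d Λ)
  have hc : ∀ c : ℂ, NormedSpace.exp (c • (1 : Observable d Λ)) = NormedSpace.exp c • 1 := fun c => by
    rw [← Algebra.algebraMap_eq_smul_one, ← NormedSpace.algebraMap_exp_comm,
      Algebra.algebraMap_eq_smul_one]
  have h1 : NormedSpace.exp (-Φ.hamiltonian Λ) =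
      NormedSpace.exp (-(Φ.term ∅).trace) • NormedSpace.exp (-Φ.dropConst.hamiltonian Λ) := by
    rw [hamiltonian_eq_dropConst_add, neg_add, ← neg_smul,
      NormedSpace.exp_add_of_commute ((Commute.one_right _).smul_right _), hc, Matrix.mul_smul, mul_one]
  have h2 : NormedSpace.exp (-(Φ.term ∅).trace) ≠ 0 := by
    rw [← Complex.exp_eq_exp_ℂ]
    exact Complex.exp_ne_zero _
  rw [LocalInteraction.gibbs, LocalInteraction.gibbs, h1, Matrix.trace_smul, smul_smul, smul_eq_mul,
    mul_inv_rev, inv_mul_cancel_right₀ h2]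

end Hamiltonian

/-! ### Reduced Gibbs states in terms of averaged expansionals. -/

section Partition

variable {d : ℕ} [NeZero d] {I A B C : Finset ℤ} {Φ : LocalInteraction d}

/-- The partition function. -/
noncomputable def LocalInteraction.partitionFn (Φ : LocalInteraction d) (Λ : Finset ℤ) : ℂ :=
  (NormedSpace.exp (-Φ.hamiltonian Λ)).trace

theorem isHermitian_neg_hamiltonian (Φ : LocalInteraction d) (Λ : Finset ℤ) :
    (-Φ.hamiltonian Λ).IsHermitian := (isHermitian_hamiltonian Φ Λ).neg

theorem partitionFn_ne_zero (Φ : LocalInteraction d) (Λ : Finset ℤ) : Φ.partitionFn Λ ≠ 0 :=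
  trace_exp_ne_zero (isHermitian_neg_hamiltonian Φ Λ)

theorem norm_exp_hamiltonian_le {x : ℝ} {Λ : Finset ℤ} (hx : ‖Φ.hamiltonian Λ‖ ≤ x) :
    ‖NormedSpace.exp (Φ.hamiltonian Λ)‖ ≤ Real.exp x :=
  (norm_exp_le _).trans (Real.exp_le_exp.2 hx)

theorem norm_exp_neg_hamiltonian_le {x : ℝ} {Λ : Finset ℤ} (hx : ‖Φ.hamiltonian Λ‖ ≤ x) :
    ‖NormedSpace.exp (-Φ.hamiltonian Λ)‖ ≤ Real.exp x :=
  (norm_exp_le _).trans (Real.exp_le_exp.2 (by rwa [norm_neg]))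

namespace IsPartition

/-- `H_A + H_B + H_C` -/
noncomputable def decoupled (h : IsPartition A B C I) (Φ : LocalInteraction d) : Observable d I :=
  embed h.left (Φ.hamiltonian A) + embed h.mid (Φ.hamiltonian B) + embed h.right (Φ.hamiltonian C)

/-- `e^{H_A + H_B + H_C} e^{-H_{ABC}}` -/
noncomputable def expansional (h : IsPartition A B C I) (Φ : LocalInteraction d) : Observable d I :=
  NormedSpace.exp (h.decoupled Φ) * NormedSpace.exp (-Φ.hamiltonian I)

/-- The expansional, averaged over the Gibbs state of the middle part. -/
noncomputable def averaged (h : IsPartition A B C I) (Φ : LocalInteraction d) : Observable d I :=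
  thermal h.mid (-Φ.hamiltonian B) (h.expansional Φ)

/-- The expansional, averaged over the Gibbs states of the middle and right parts. -/
noncomputable def leftAveraged (h : IsPartition A B C I) (Φ : LocalInteraction d) : Observable d I :=
  thermal h.right (-Φ.hamiltonian C) (h.averaged Φ)

/-- `Z_A Z_B Z_C / Z_{ABC}` -/
noncomputable def ratio (_ : IsPartition A B C I) (Φ : LocalInteraction d) : ℂ :=
  Φ.partitionFn A * Φ.partitionFn B * Φ.partitionFn C / Φ.partitionFn I

/-- Bounds for the expansional and the inverse expansionals. -/
structure IsBounded (h : IsPartition A B C I) (Φ : LocalInteraction d) (g : ℝ) : Prop where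
  norm_expansional_le : ‖h.expansional Φ‖ ≤ g
  norm_inv_le : ∀ s : ℝ, 0 ≤ s → s ≤ 1 →
    ‖NormedSpace.exp (s • Φ.hamiltonian I) * NormedSpace.exp ((-s) • h.decoupled Φ)‖ ≤ g

theorem decoupled_symm (h : IsPartition A B C I) : h.symm.decoupled Φ = h.decoupled Φ := by
  rw [decoupled, decoupled]
  abel

theorem expansional_symm (h : IsPartition A B C I) : h.symm.expansional Φ = h.expansional Φ := by
  rw [expansional, expansional, decoupled_symm]

theorem averaged_symm (h : IsPartition A B C I) : h.symm.averaged Φ = h.averaged Φ := by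
  rw [averaged, averaged, expansional_symm]

theorem IsBounded.symm {h : IsPartition A B C I} {g : ℝ} (hg : h.IsBounded Φ g) :
    h.symm.IsBounded Φ g where
  norm_expansional_le := by
    rw [expansional_symm]
    exact hg.norm_expansional_le
  norm_inv_le := by
    rw [decoupled_symm]
    exact hg.norm_inv_le

theorem IsBounded.nonneg {h : IsPartition A B C I} {g : ℝ} (hg : h.IsBounded Φ g) : 0 ≤ g :=
  (norm_nonneg _).trans hg.norm_expansional_le

theorem IsBounded.norm_averaged_le {h : IsPartition A B C I} {g : ℝ} (hg : h.IsBounded Φ g) :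
    ‖h.averaged Φ‖ ≤ g :=
  (norm_thermal_le _ (isHermitian_neg_hamiltonian Φ B) _).trans hg.norm_expansional_le

theorem IsBounded.norm_leftAveraged_le {h : IsPartition A B C I} {g : ℝ} (hg : h.IsBounded Φ g) :
    ‖h.leftAveraged Φ‖ ≤ g :=
  (norm_thermal_le _ (isHermitian_neg_hamiltonian Φ C) _).trans hg.norm_averaged_le

theorem prod_eq_exp (h : IsPartition A B C I) :
    h.prod (-Φ.hamiltonian A) (-Φ.hamiltonian B) (-Φ.hamiltonian C) =
      NormedSpace.exp (-h.decoupled Φ) := by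
  let := NormedAlgebra.restrictScalars ℚ ℂ (Observable d I)
  have hn : ∀ {X : Finset ℤ} (hX : X ⊆ I) (P : Observable d X), embed hX (-P) = -embed hX P :=
    fun hX P => (embedLin hX).map_neg P
  have hAC := commute_embed h.left h.right h.left_right (-Φ.hamiltonian A) (-Φ.hamiltonian C)
  have hAB := commute_embed h.left h.mid h.left_mid (-Φ.hamiltonian A) (-Φ.hamiltonian B)
  have hCB := commute_embed h.right h.mid h.mid_right.symm (-Φ.hamiltonian C) (-Φ.hamiltonian B)
  rw [prod, embed_exp, embed_exp, embed_exp, ← NormedSpace.exp_add_of_commute hAC,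
    ← NormedSpace.exp_add_of_commute (hAB.add_left hCB), hn, hn, hn, decoupled]
  congr 1
  abel

theorem prod_mul_expansional (h : IsPartition A B C I) :
    h.prod (-Φ.hamiltonian A) (-Φ.hamiltonian B) (-Φ.hamiltonian C) * h.expansional Φ =
      NormedSpace.exp (-Φ.hamiltonian I) := by
  rw [prod_eq_exp, expansional, ← mul_assoc, exp_neg_mul_exp, one_mul]

/-- Z_A Z_B Z_C = tr(e^{-H_I} V) with V = e^{H_I} e^{-H_0} the inverse expansional up to cyclic
order, so the Gibbs state bounds the ratio by ‖V‖. -/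
theorem norm_ratio_le {h : IsPartition A B C I} {g : ℝ} (hg : h.IsBounded Φ g) : ‖h.ratio Φ‖ ≤ g := by
  have hV : NormedSpace.exp (-Φ.hamiltonian I) *
      (NormedSpace.exp (Φ.hamiltonian I) * NormedSpace.exp (-h.decoupled Φ)) =
      h.prod (-Φ.hamiltonian A) (-Φ.hamiltonian B) (-Φ.hamiltonian C) := by
    rw [prod_eq_exp, ← mul_assoc, exp_neg_mul_exp, one_mul]
  have h1 := h.norm_trace_prod_le (isHermitian_neg_hamiltonian Φ I) hV
  have h2 := hg.norm_inv_le 1 zero_le_one le_rfl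
  rw [one_smul, neg_smul, one_smul] at h2
  have hz : 0 < ‖Φ.partitionFn I‖ := norm_pos_iff.2 (partitionFn_ne_zero Φ I)
  rw [ratio, norm_div, div_le_iff₀ hz, mul_comm g]
  exact h1.trans (mul_le_mul_of_nonneg_left h2 hz.le)

theorem norm_partitionFn_le {h : IsPartition A B C I} {g : ℝ} (hg : h.IsBounded Φ g) :
    ‖Φ.partitionFn I‖ ≤ ‖Φ.partitionFn A * Φ.partitionFn B * Φ.partitionFn C‖ * g := by
  have h1 := h.norm_trace_le (isHermitian_neg_hamiltonian Φ A) (isHermitian_neg_hamiltonian Φ B)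
    (isHermitian_neg_hamiltonian Φ C) (h.expansional Φ)
  rw [prod_mul_expansional] at h1
  exact h1.trans (mul_le_mul_of_nonneg_left hg.norm_expansional_le (norm_nonneg _))

theorem norm_inv_ratio_le {h : IsPartition A B C I} {g : ℝ} (hg : h.IsBounded Φ g) :
    ‖(h.ratio Φ)⁻¹‖ ≤ g := by
  have hz : 0 < ‖Φ.partitionFn A * Φ.partitionFn B * Φ.partitionFn C‖ :=
    norm_pos_iff.2 (mul_ne_zero (mul_ne_zero (partitionFn_ne_zero Φ A) (partitionFn_ne_zero Φ B))
      (partitionFn_ne_zero Φ C))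
  rw [ratio, inv_div, norm_div, div_le_iff₀ hz, mul_comm]
  exact norm_partitionFn_le hg

/-- Averaging the expansional over all three parts gives Z_I / (Z_A Z_B Z_C). This normalization
later identifies the scalar in the factorization. -/
theorem ratio_smul_thermal (h : IsPartition A B C I) :
    h.ratio Φ • thermal h.left (-Φ.hamiltonian A) (h.leftAveraged Φ) = 1 := by
  have h1 := h.trace_prod_mul (isHermitian_neg_hamiltonian Φ A) (isHermitian_neg_hamiltonian Φ B)
    (isHermitian_neg_hamiltonian Φ C) (h.expansional Φ)
  rw [prod_mul_expansional] at h1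
  have hz := partitionFn_ne_zero Φ I
  rw [ratio, div_eq_inv_mul, mul_smul]
  refine (congrArg (fun Q => (Φ.partitionFn I)⁻¹ • Q) h1.symm).trans ?_
  rw [smul_smul, ← LocalInteraction.partitionFn.eq_def, inv_mul_cancel₀ hz, one_smul]

theorem reduced_gibbs_left_right (h : IsPartition A B C I) (hAC : A ∪ C ⊆ I) :
    reduced hAC (Φ.gibbs I) = (Φ.partitionFn B / Φ.partitionFn I) •
      (embed h.left (NormedSpace.exp (-Φ.hamiltonian A)) *
        embed h.right (NormedSpace.exp (-Φ.hamiltonian C)) * h.averaged Φ) := by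
  rw [LocalInteraction.gibbs, reduced_smul, ← h.prod_mul_expansional,
    h.reduced_left_right (isHermitian_neg_hamiltonian Φ B), prod_mul_expansional, smul_smul,
    div_eq_inv_mul]
  rfl

theorem reduced_gibbs_left (h : IsPartition A B C I) :
    reduced h.left (Φ.gibbs I) = (Φ.partitionFn B * Φ.partitionFn C / Φ.partitionFn I) •
      (embed h.left (NormedSpace.exp (-Φ.hamiltonian A)) * h.leftAveraged Φ) := by
  rw [LocalInteraction.gibbs, reduced_smul, ← h.prod_mul_expansional,
    h.reduced_left (isHermitian_neg_hamiltonian Φ B) (isHermitian_neg_hamiltonian Φ C),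
    prod_mul_expansional, smul_smul, div_eq_inv_mul]
  rfl

theorem reduced_gibbs_right (h : IsPartition A B C I) :
    reduced h.right (Φ.gibbs I) = (Φ.partitionFn A * Φ.partitionFn B / Φ.partitionFn I) •
      (embed h.right (NormedSpace.exp (-Φ.hamiltonian C)) * h.symm.leftAveraged Φ) := by
  rw [h.symm.reduced_gibbs_left, mul_comm (Φ.partitionFn B)]

theorem isHermitian_decoupled (h : IsPartition A B C I) : (h.decoupled Φ).IsHermitian :=
  ((isHermitian_embed _ (isHermitian_hamiltonian Φ A)).add
    (isHermitian_embed _ (isHermitian_hamiltonian Φ B))).add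
    (isHermitian_embed _ (isHermitian_hamiltonian Φ C))

/-- The reduced Gibbs state of a bounded subsystem is bounded from below. -/
theorem exists_inv_leftAveraged {h : IsPartition A B C I} {g : ℝ} (hg : h.IsBounded Φ g) {x : ℝ}
    (hx : ‖Φ.hamiltonian A‖ ≤ x) :
    ∃ N : Observable d I, N * h.leftAveraged Φ = 1 ∧ ‖N‖ ≤ g ^ 2 * Real.exp (2 * x) := by
  let := NormedAlgebra.restrictScalars ℚ ℂ (Observable d I)
  have hg0 := hg.nonneg
  have hn : ∀ {X : Finset ℤ} (hX : X ⊆ I) (P : Observable d X), embed hX (-P) = -embed hX P :=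
    fun hX P => (embedLin hX).map_neg P
  have hG : ‖NormedSpace.exp ((1 / 2 : ℝ) •
      (embed h.mid (-Φ.hamiltonian B) + embed h.right (-Φ.hamiltonian C))) *
      NormedSpace.exp ((-(1 / 2) : ℝ) • (-Φ.hamiltonian I))‖ ≤ Real.exp (x / 2) * g := by
    have h1 : NormedSpace.exp ((1 / 2 : ℝ) •
        (embed h.mid (-Φ.hamiltonian B) + embed h.right (-Φ.hamiltonian C))) =
        NormedSpace.exp ((1 / 2 : ℝ) • embed h.left (Φ.hamiltonian A)) *
          NormedSpace.exp ((-(1 / 2) : ℝ) • h.decoupled Φ) := by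
      have hc : Commute (embed h.left (Φ.hamiltonian A)) (h.decoupled Φ) :=
        ((Commute.refl _).add_right (commute_embed h.left h.mid h.left_mid _ _)).add_right
          (commute_embed h.left h.right h.left_right _ _)
      rw [← NormedSpace.exp_add_of_commute ((hc.smul_left _).smul_right _), decoupled, hn, hn]
      congr 1
      module
    -- The adjoint of the inverse expansional at s = 1/2; the half comes from the square root of
    -- e^{-H_I}.
    have h2 : NormedSpace.exp ((-(1 / 2) : ℝ) • h.decoupled Φ) *
        NormedSpace.exp ((1 / 2 : ℝ) • Φ.hamiltonian I) =
        (NormedSpace.exp ((1 / 2 : ℝ) • Φ.hamiltonian I) *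
          NormedSpace.exp ((-(1 / 2) : ℝ) • h.decoupled Φ)).conjTranspose := by
      rw [Matrix.conjTranspose_mul, (isHermitian_exp_smul h.isHermitian_decoupled _).eq,
        (isHermitian_exp_smul (isHermitian_hamiltonian Φ I) _).eq]
    rw [h1, neg_smul_neg, mul_assoc, h2]
    refine (norm_mul_le _ _).trans ?_
    rw [Matrix.l2_opNorm_conjTranspose]
    gcongr
    · refine (norm_exp_smul_le (by norm_num) ((norm_embed_le _ _).trans hx)).trans ?_
      rw [one_div_mul_eq_div]
    · exact hg.norm_inv_le (1 / 2) (by norm_num) (by norm_num)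
  obtain ⟨N, hN, hNn⟩ := h.exists_inv_thermal (isHermitian_neg_hamiltonian Φ I)
    (isHermitian_neg_hamiltonian Φ B) (isHermitian_neg_hamiltonian Φ C) h.prod_mul_expansional hG
  refine ⟨N, hN, hNn.trans ?_⟩
  calc _ ≤ (Real.exp (x / 2) * g) ^ 2 * Real.exp x := by
        gcongr
        exact norm_exp_neg_hamiltonian_le hx
    _ = g ^ 2 * Real.exp (2 * x) := by
        rw [mul_pow, ← Real.exp_nat_mul, mul_right_comm, ← Real.exp_add, mul_comm]
        congr 2
        push_cast
        ring

theorem embed_exp_mul_embed_exp_neg {X : Finset ℤ} (hX : X ⊆ I) (K : Observable d X) :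
    embed hX (NormedSpace.exp K) * embed hX (NormedSpace.exp (-K)) = 1 := by
  rw [← embed_mul, exp_mul_exp_neg, embed_one]

/-- The averaged expansional factorizes up to the correlations of the Gibbs state. -/
theorem averaged_sub_eq (h : IsPartition A B C I) :
    h.averaged Φ - h.ratio Φ • (h.leftAveraged Φ * h.symm.leftAveraged Φ) =
      (Φ.partitionFn I / Φ.partitionFn B) • (embed h.right (NormedSpace.exp (Φ.hamiltonian C)) *
        embed h.left (NormedSpace.exp (Φ.hamiltonian A)) *
        (reduced (Finset.union_subset h.left h.right) (Φ.gibbs I) -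
          reduced h.left (Φ.gibbs I) * reduced h.right (Φ.gibbs I))) := by
  have hB := partitionFn_ne_zero Φ B
  have hI := partitionFn_ne_zero Φ I
  have hcomm := (commute_embed h.left h.right h.left_right (reduce A (Φ.gibbs I))
    (NormedSpace.exp (-Φ.hamiltonian C))).eq
  have h1 : reduced h.left (Φ.gibbs I) * reduced h.right (Φ.gibbs I) =
      (Φ.partitionFn A * Φ.partitionFn B / Φ.partitionFn I *
        (Φ.partitionFn B * Φ.partitionFn C / Φ.partitionFn I)) •
      (embed h.left (NormedSpace.exp (-Φ.hamiltonian A)) *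
        embed h.right (NormedSpace.exp (-Φ.hamiltonian C)) *
          (h.leftAveraged Φ * h.symm.leftAveraged Φ)) := by
    rw [h.reduced_gibbs_right, Matrix.mul_smul, ← mul_assoc]
    change _ • (embed h.left (reduce A (Φ.gibbs I)) * _ * _) = _
    rw [hcomm]
    change _ • (_ * reduced h.left (Φ.gibbs I) * _) = _
    rw [h.reduced_gibbs_left, Matrix.mul_smul, Matrix.smul_mul, smul_smul, ← mul_assoc,
      ← (commute_embed h.left h.right h.left_right _ _).eq, mul_assoc]
  have hone : embed h.right (NormedSpace.exp (Φ.hamiltonian C)) *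
      embed h.left (NormedSpace.exp (Φ.hamiltonian A)) *
      (embed h.left (NormedSpace.exp (-Φ.hamiltonian A)) *
        embed h.right (NormedSpace.exp (-Φ.hamiltonian C))) = 1 := by
    rw [mul_assoc, ← mul_assoc (embed h.left (NormedSpace.exp (Φ.hamiltonian A))),
      embed_exp_mul_embed_exp_neg, one_mul, embed_exp_mul_embed_exp_neg]
  rw [h1, h.reduced_gibbs_left_right, mul_sub, Matrix.mul_smul, Matrix.mul_smul, ← mul_assoc,
    ← mul_assoc _ _ (h.leftAveraged Φ * h.symm.leftAveraged Φ), hone, one_mul, one_mul, smul_sub,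
    smul_smul, smul_smul, ratio]
  congr 1
  · rw [div_mul_div_cancel₀ hB, div_self hI, one_smul]
  · congr 1
    field_simp

/-- Z_I / Z_B costs g d^{2m} e^{2x} through Z_A Z_C, removing e^{-H_A} e^{-H_C} costs e^{2x}, and
passing from `corr` to the norm costs d^{4m}. The bound is useful when A and C are short compared
with the decay length of c. -/
theorem norm_averaged_sub_le {h : IsPartition A B C I} {g : ℝ} (hg : h.IsBounded Φ g) {x : ℝ} {m : ℕ}
    (hA : ‖Φ.hamiltonian A‖ ≤ x) (hC : ‖Φ.hamiltonian C‖ ≤ x) (hAm : A.card ≤ m) (hCm : C.card ≤ m)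
    {c : ℝ} (hc : corr (Φ.gibbs I) A C ≤ c) (hc0 : 0 ≤ c) :
    ‖h.averaged Φ - h.ratio Φ • (h.leftAveraged Φ * h.symm.leftAveraged Φ)‖ ≤
      g * c * ((d : ℝ) ^ m) ^ 6 * Real.exp x ^ 4 := by
  have hd1 : (1 : ℝ) ≤ d := by exact_mod_cast NeZero.one_le
  have hg0 := hg.nonneg
  have hz : ∀ Λ : Finset ℤ, Λ.card ≤ m → ‖Φ.hamiltonian Λ‖ ≤ x →
      ‖Φ.partitionFn Λ‖ ≤ (d : ℝ) ^ m * Real.exp x := fun Λ hΛ hx =>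
    (SpinChain.norm_trace_le _).trans (mul_le_mul (pow_le_pow_right₀ hd1 hΛ) (norm_exp_neg_hamiltonian_le hx)
      (norm_nonneg _) (by positivity))
  have hratio : ‖Φ.partitionFn I / Φ.partitionFn B‖ ≤ ((d : ℝ) ^ m * Real.exp x) ^ 2 * g := by
    have hB : 0 < ‖Φ.partitionFn B‖ := norm_pos_iff.2 (partitionFn_ne_zero Φ B)
    rw [norm_div, div_le_iff₀ hB]
    refine (norm_partitionFn_le hg).trans ?_
    rw [norm_mul, norm_mul]
    have h1 := hz A hAm hA
    have h2 := hz C hCm hC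
    calc ‖Φ.partitionFn A‖ * ‖Φ.partitionFn B‖ * ‖Φ.partitionFn C‖ * g
        ≤ ((d : ℝ) ^ m * Real.exp x) * ‖Φ.partitionFn B‖ * ((d : ℝ) ^ m * Real.exp x) * g := by
          gcongr
      _ = _ := by ring
  have hD : ‖reduced (Finset.union_subset h.left h.right) (Φ.gibbs I) -
      reduced h.left (Φ.gibbs I) * reduced h.right (Φ.gibbs I)‖ ≤ ((d : ℝ) ^ (2 * m)) ^ 2 * c := by
    refine (norm_reduced_sub_le h.left h.right h.left_right (Φ.gibbs I)).trans ?_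
    have : (A ∪ C).card ≤ 2 * m := (Finset.card_union_le _ _).trans (by omega)
    calc _ ≤ ((d : ℝ) ^ (A ∪ C).card) ^ 2 * c := by gcongr
      _ ≤ _ := by gcongr
  have hE : ∀ {X : Finset ℤ} (hX : X ⊆ I), ‖Φ.hamiltonian X‖ ≤ x →
      ‖embed hX (NormedSpace.exp (Φ.hamiltonian X))‖ ≤ Real.exp x := fun hX hx =>
    (norm_embed_le _ _).trans (norm_exp_hamiltonian_le hx)
  rw [averaged_sub_eq, norm_smul]
  calc _ ≤ (((d : ℝ) ^ m * Real.exp x) ^ 2 * g) *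
        ((Real.exp x * Real.exp x) * (((d : ℝ) ^ (2 * m)) ^ 2 * c)) := by
        gcongr
        refine (norm_mul_le _ _).trans ?_
        gcongr
        exact (norm_mul_le _ _).trans (mul_le_mul (hE _ hC) (hE _ hA) (norm_nonneg _) (by positivity))
    _ = _ := by ring

/-- `leftAveraged` is an observable of the left part. -/
theorem exists_leftAveraged_eq_embed (h : IsPartition A B C I) :
    ∃ P : Observable d A, h.leftAveraged Φ = embed h.left P := by
  have hz : Φ.partitionFn B * Φ.partitionFn C / Φ.partitionFn I ≠ 0 :=
    div_ne_zero (mul_ne_zero (partitionFn_ne_zero Φ B) (partitionFn_ne_zero Φ C))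
      (partitionFn_ne_zero Φ I)
  refine ⟨(Φ.partitionFn B * Φ.partitionFn C / Φ.partitionFn I)⁻¹ •
    (NormedSpace.exp (Φ.hamiltonian A) * reduce A (Φ.gibbs I)), ?_⟩
  rw [embed_smul, embed_mul]
  change _ = _ • (_ * reduced h.left (Φ.gibbs I))
  rw [h.reduced_gibbs_left, Matrix.mul_smul, smul_smul, inv_mul_cancel₀ hz, one_smul, ← mul_assoc,
    embed_exp_mul_embed_exp_neg, one_mul]

/-- If the averaged expansional is close to a product, it is close to the product of its averages. -/
theorem norm_averaged_sub_ratio_smul_le {h : IsPartition A B C I} {g : ℝ} (hg1 : 1 ≤ g)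
    (hg : h.IsBounded Φ g) {P : Observable d A} {Q : Observable d C} (hP : ‖embed h.left P‖ ≤ g ^ 2)
    (hQ : ‖embed h.right Q‖ ≤ g) {δ : ℝ}
    (hδ : ‖h.averaged Φ - embed h.left P * embed h.right Q‖ ≤ δ) :
    ‖h.averaged Φ - h.ratio Φ • (h.symm.leftAveraged Φ * h.leftAveraged Φ)‖ ≤ 4 * g ^ 4 * δ := by
  have hg0 := hg.nonneg
  have hδ0 := (norm_nonneg _).trans hδ
  have hHA := isHermitian_neg_hamiltonian Φ A
  have hHC := isHermitian_neg_hamiltonian Φ C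
  set eP := embed h.left P with heP
  set eQ := embed h.right Q with heQ
  set w := h.averaged Φ
  set p := h.leftAveraged Φ with hp
  set q := h.symm.leftAveraged Φ with hq
  set κ := h.ratio Φ
  -- Averaging w ≈ P Q over C gives p ≈ u P, averaging over A gives q ≈ v Q, and averaging over
  -- both, with the normalization of the ratio, gives κ u v ≈ 1.
  obtain ⟨u, hu⟩ : ∃ u : ℂ, thermal h.right (-Φ.hamiltonian C) eQ = u • 1 := ⟨_, thermal_embed _ _ _⟩
  obtain ⟨v, hv⟩ : ∃ v : ℂ, thermal h.left (-Φ.hamiltonian A) eP = v • 1 := ⟨_, thermal_embed _ _ _⟩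
  have hun : ‖u‖ ≤ g := by
    have := (norm_thermal_le h.right hHC eQ).trans hQ
    rwa [hu, norm_smul, norm_one, mul_one] at this
  have hpu : ‖p - u • eP‖ ≤ δ := by
    have h1 : thermal h.right (-Φ.hamiltonian C) (w - eP * eQ) = p - u • eP := by
      rw [thermal_sub, heP, thermal_embed_mul h.left h.right h.left_right, hu, Matrix.mul_smul, mul_one]
      rfl
    rw [← h1]
    exact (norm_thermal_le _ hHC _).trans hδ
  have hqv : ‖q - v • eQ‖ ≤ δ := by
    have h1 : thermal h.left (-Φ.hamiltonian A) (w - eP * eQ) = q - v • eQ := by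
      rw [thermal_sub, heQ, thermal_mul_embed h.right h.left h.left_right.symm, hv, Matrix.smul_mul,
        one_mul, hq, leftAveraged, averaged_symm]
    rw [← h1]
    exact (norm_thermal_le _ hHA _).trans hδ
  have huv : ‖1 - κ * (u * v)‖ ≤ g * δ := by
    have h1 : κ • thermal h.left (-Φ.hamiltonian A) (p - u • eP) =
        (1 - κ * (u * v)) • (1 : Observable d I) := by
      rw [thermal_sub, thermal_smul, hv, smul_sub, h.ratio_smul_thermal, smul_smul, smul_smul,
        sub_smul, one_smul, mul_assoc]
    have h2 := congrArg norm h1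
    rw [norm_smul, norm_smul, norm_one, mul_one] at h2
    rw [← h2]
    exact mul_le_mul (norm_ratio_le hg) ((norm_thermal_le _ hHA _).trans hpu) (norm_nonneg _) hg0
  have hcomm : eP * eQ = eQ * eP := (commute_embed h.left h.right h.left_right P Q).eq
  have hdecomp : w - κ • (q * p) = (w - eP * eQ) + (1 - κ * (u * v)) • (eP * eQ) +
      -(κ • ((q - v • eQ) * (u • eP) + q * (p - u • eP))) := by
    simp only [sub_mul, mul_sub, Matrix.smul_mul, Matrix.mul_smul, hcomm]
    module
  have hκ := norm_ratio_le hg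
  have hqn : ‖q‖ ≤ g := hg.symm.norm_leftAveraged_le
  rw [hdecomp]
  calc _ ≤ ‖w - eP * eQ‖ + ‖1 - κ * (u * v)‖ * (‖eP‖ * ‖eQ‖) +
        ‖κ‖ * (‖q - v • eQ‖ * (‖u‖ * ‖eP‖) + ‖q‖ * ‖p - u • eP‖) := by
        refine (norm_add_le _ _).trans (add_le_add ((norm_add_le _ _).trans (add_le_add le_rfl ?_)) ?_)
        · rw [norm_smul]
          gcongr
          exact norm_mul_le _ _
        · rw [norm_neg, norm_smul]
          gcongr
          refine (norm_add_le _ _).trans (add_le_add ((norm_mul_le _ _).trans ?_) (norm_mul_le _ _))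
          rw [norm_smul]
    _ ≤ δ + g * δ * (g ^ 2 * g) + g * (δ * (g * g ^ 2) + g * δ) := by gcongr
    _ = (1 + 2 * g ^ 4 + g ^ 2) * δ := by ring
    _ ≤ 4 * g ^ 4 * δ := by
        gcongr
        have : 1 ≤ g ^ 2 := one_le_pow₀ hg1
        nlinarith

/-- The mixing condition in terms of the averaged expansionals. -/
theorem norm_mixing_le {h : IsPartition A B C I} {g : ℝ} (hg : h.IsBounded Φ g) {N N' : Observable d I}
    (hN : N * h.leftAveraged Φ = 1) (hN' : N' * h.symm.leftAveraged Φ = 1) {n : ℝ} (hNn : ‖N‖ ≤ n)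
    (hN'n : ‖N'‖ ≤ n) (hAC : A ∪ C ⊆ I) {δ : ℝ}
    (hδ : ‖h.averaged Φ - h.ratio Φ • (h.symm.leftAveraged Φ * h.leftAveraged Φ)‖ ≤ δ) :
    ‖(reduced h.left (Φ.gibbs I))⁻¹ * (reduced h.right (Φ.gibbs I))⁻¹ * reduced hAC (Φ.gibbs I) - 1‖ ≤
      g * n ^ 2 * δ := by
  have hZ := partitionFn_ne_zero Φ
  have hn0 := (norm_nonneg _).trans hNn
  have hg0 := hg.nonneg
  set gA := embed h.left (NormedSpace.exp (-Φ.hamiltonian A)) with hgA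
  set gC := embed h.right (NormedSpace.exp (-Φ.hamiltonian C)) with hgC
  set gA' := embed h.left (NormedSpace.exp (Φ.hamiltonian A))
  set gC' := embed h.right (NormedSpace.exp (Φ.hamiltonian C))
  have hneg : ∀ {X : Finset ℤ} (hX : X ⊆ I), embed hX (NormedSpace.exp (Φ.hamiltonian X)) *
      embed hX (NormedSpace.exp (-Φ.hamiltonian X)) = 1 := fun hX => embed_exp_mul_embed_exp_neg hX _
  set a := Φ.partitionFn B * Φ.partitionFn C / Φ.partitionFn I with ha
  set c := Φ.partitionFn A * Φ.partitionFn B / Φ.partitionFn I with hc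
  have ha0 : a ≠ 0 := div_ne_zero (mul_ne_zero (hZ B) (hZ C)) (hZ I)
  have hc0 : c ≠ 0 := div_ne_zero (mul_ne_zero (hZ A) (hZ B)) (hZ I)
  set RA := reduced h.left (Φ.gibbs I) with hRA
  set RC := reduced h.right (Φ.gibbs I) with hRC
  have hRA' : RA = a • (gA * h.leftAveraged Φ) := h.reduced_gibbs_left
  have hRC' : RC = c • (gC * h.symm.leftAveraged Φ) := h.reduced_gibbs_right
  have hinv : ∀ {z : ℂ} {G G' M p : Observable d I}, z ≠ 0 → G' * G = 1 → M * p = 1 →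
      z⁻¹ • (M * G') * z • (G * p) = 1 := fun {z G G' M p} hz hG hM => by
    rw [Matrix.smul_mul, Matrix.mul_smul, smul_smul, inv_mul_cancel₀ hz, one_smul, mul_assoc,
      ← mul_assoc G', hG, one_mul, hM]
  have hA1 : a⁻¹ • (N * gA') * RA = 1 := by rw [hRA']; exact hinv ha0 (hneg h.left) hN
  have hC1 : c⁻¹ • (N' * gC') * RC = 1 := by rw [hRC']; exact hinv hc0 (hneg h.right) hN'
  have hAi : RA⁻¹ = a⁻¹ • (N * gA') := Matrix.inv_eq_left_inv hA1
  have hCi : RC⁻¹ = c⁻¹ • (N' * gC') := Matrix.inv_eq_left_inv hC1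
  have hAR : RA⁻¹ * RA = 1 := by rw [hAi]; exact hA1
  have hCR : RC⁻¹ * RC = 1 := by rw [hCi]; exact hC1
  have hRC1 : RC * RC⁻¹ = 1 := mul_eq_one_comm.1 hCR
  have hcRA : RC * gA = gA * RC :=
    (commute_embed h.right h.left h.left_right.symm (reduce C (Φ.gibbs I)) _).eq
  have hcRA' : RC⁻¹ * gA = gA * RC⁻¹ := by
    calc RC⁻¹ * gA = RC⁻¹ * gA * (RC * RC⁻¹) := by rw [hRC1, mul_one]
      _ = RC⁻¹ * (gA * RC) * RC⁻¹ := by simp only [mul_assoc]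
      _ = RC⁻¹ * RC * gA * RC⁻¹ := by rw [← hcRA]; simp only [mul_assoc]
      _ = gA * RC⁻¹ := by rw [hCR, one_mul]
  have hRCRA : RC * RA = (Φ.partitionFn B / Φ.partitionFn I) • (gA * gC *
      (h.ratio Φ • (h.symm.leftAveraged Φ * h.leftAveraged Φ))) := by
    rw [hRA', Matrix.mul_smul, ← mul_assoc, hcRA, hRC', Matrix.mul_smul, Matrix.smul_mul, smul_smul,
      Matrix.mul_smul, smul_smul, mul_assoc gA, mul_assoc gA, mul_assoc gC]
    congr 1
    rw [ha, hc, ratio]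
    ring
  -- ρ_C ρ_A and ρ_{AC} carry the same prefactor e^{-H_A} e^{-H_C}, which cancels against the
  -- inverses; the partition functions combine to κ^{-1}.
  have hkey : RA⁻¹ * RC⁻¹ * reduced hAC (Φ.gibbs I) - 1 = (h.ratio Φ)⁻¹ • (N * (N' *
      (h.averaged Φ - h.ratio Φ • (h.symm.leftAveraged Φ * h.leftAveraged Φ)))) := by
    have h1 : RA⁻¹ * RC⁻¹ * (RC * RA) = 1 := by
      rw [mul_assoc, ← mul_assoc RC⁻¹, hCR, one_mul, hAR]
    have h2 : RA⁻¹ * gA = a⁻¹ • N := by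
      rw [hAi, Matrix.smul_mul, mul_assoc, hneg, mul_one]
    have h3 : RC⁻¹ * gC = c⁻¹ • N' := by
      rw [hCi, Matrix.smul_mul, mul_assoc, hneg, mul_one]
    have h4 : RA⁻¹ * RC⁻¹ * (gA * gC) = (a⁻¹ * c⁻¹) • (N * N') := by
      rw [mul_assoc, ← mul_assoc RC⁻¹, hcRA', mul_assoc gA, ← mul_assoc RA⁻¹, h2, h3, Matrix.smul_mul,
        Matrix.mul_smul, smul_smul]
    rw [← h1, ← mul_sub, hRCRA, h.reduced_gibbs_left_right hAC, ← smul_sub, ← hgA, ← hgC, ← mul_sub,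
      Matrix.mul_smul, ← mul_assoc, h4, Matrix.smul_mul, smul_smul, mul_assoc]
    congr 1
    rw [ha, hc, ratio]
    have := hZ A
    have := hZ B
    have := hZ C
    have := hZ I
    field_simp
  rw [hkey, norm_smul]
  calc _ ≤ g * (n * (n * δ)) := by
        refine mul_le_mul (norm_inv_ratio_le hg) ?_ (norm_nonneg _) hg0
        refine (norm_mul_le _ _).trans ?_
        gcongr
        refine (norm_mul_le _ _).trans ?_
        gcongr
    _ = _ := by ring

end IsPartition

end Partition

/-! ### Truncation of intervals, uniform invertibility and the exponential rate. -/

section Intervals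

variable {d : ℕ} [NeZero d] {Φ : LocalInteraction d} {r J : ℝ} {R : ℕ}

theorem isPartition_Ico {a b c e : ℤ} (hab : a ≤ b) (hbc : b ≤ c) (hce : c ≤ e) :
    IsPartition (Finset.Ico a b) (Finset.Ico b c) (Finset.Ico c e) (Finset.Ico a e) where
  left := Finset.Ico_subset_Ico_right (hbc.trans hce)
  mid := Finset.Ico_subset_Ico hab hce
  right := Finset.Ico_subset_Ico_left (hab.trans hbc)
  subset x := by simp only [Finset.mem_union, Finset.mem_Ico]; omega
  left_mid := Finset.Ico_disjoint_Ico_consecutive a b c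
  left_right := Finset.disjoint_left.2 fun x => by simp only [Finset.mem_Ico]; omega
  mid_right := Finset.Ico_disjoint_Ico_consecutive b c e

/-- An interaction of range at most `R` and strength at most `J` without constant term. -/
structure IsLocal (Φ : LocalInteraction d) (J : ℝ) (R : ℕ) : Prop where
  range : Φ.HasRange R
  strength : Φ.HasStrength J
  term_empty : Φ.term ∅ = 0
  pos : 0 < R

theorem IsLocal.embed_hamiltonian (hΦ : IsLocal Φ J R) {Λ I : Finset ℤ} (h : Λ ⊆ I) :
    embed h (Φ.hamiltonian Λ) = localSum (Φ.termIn I) R Λ :=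
  embed_hamiltonian_eq_localSum hΦ.range hΦ.term_empty le_rfl h

theorem IsLocal.embed_decoupled (hΦ : IsLocal Φ J R) {A B C Λ I : Finset ℤ} (h : IsPartition A B C Λ)
    (hI : Λ ⊆ I) : embed hI (h.decoupled Φ) = localSum (Φ.termIn I) R A +
      localSum (Φ.termIn I) R B + localSum (Φ.termIn I) R C := by
  rw [← embedHom_apply, IsPartition.decoupled, map_add, map_add]
  simp only [embedHom_apply, embed_embed]
  simp only [hΦ.embed_hamiltonian]

theorem IsLocal.embed_expansional (hΦ : IsLocal Φ J R) {A B C Λ I : Finset ℤ}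
    (h : IsPartition A B C Λ) (hI : Λ ⊆ I) :
    embed hI (h.expansional Φ) = expansional (Φ.termIn I) R A B C Λ := by
  have hn : embed hI (-Φ.hamiltonian Λ) = -embed hI (Φ.hamiltonian Λ) := (embedLin hI).map_neg _
  rw [IsPartition.expansional, embed_mul, embed_exp, embed_exp, hΦ.embed_decoupled, hn,
    hΦ.embed_hamiltonian, expansional]

theorem IsLocal.strength_nonneg (hΦ : IsLocal Φ J R) : 0 ≤ J :=
  (norm_nonneg _).trans (hΦ.strength ∅)

theorem IsLocal.isBounded (hΦ : IsLocal Φ J R) {a b c e : ℤ} (hab : a ≤ b) (hbc : b ≤ c)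
    (hce : c ≤ e) : (isPartition_Ico hab hbc hce).IsBounded Φ (Real.exp (evolveBound J R)) where
  norm_expansional_le := by
    rw [← embed_rfl ((isPartition_Ico hab hbc hce).expansional Φ), hΦ.embed_expansional]
    exact norm_expansional_Ico_le (commute_termIn _) (norm_termIn_le hΦ.strength _) hΦ.pos hab hbc hce
  norm_inv_le s hs hs1 := by
    rw [← embed_rfl ((isPartition_Ico hab hbc hce).decoupled Φ), hΦ.embed_decoupled,
      ← embed_rfl (Φ.hamiltonian _), hΦ.embed_hamiltonian]
    exact norm_exp_mul_exp_Ico_le (commute_termIn _) (norm_termIn_le hΦ.strength _) hΦ.pos hab hbc hce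
      hs hs1

theorem IsLocal.norm_hamiltonian_le (hΦ : IsLocal Φ J R) {Λ : Finset ℤ} {m : ℕ} (hm : Λ.card ≤ m) :
    ‖Φ.hamiltonian Λ‖ ≤ J * 2 ^ (2 * R + 1) * m := by
  have := hΦ.strength_nonneg
  refine (SpinChain.norm_hamiltonian_le hΦ.range hΦ.strength hΦ.term_empty le_rfl Λ).trans ?_
  gcongr

/-- The error of removing the interaction at distance at least `n * R` of the cuts. -/
noncomputable def truncationError (J : ℝ) (R : ℕ) (t : ℝ) (n : ℕ) : ℝ :=
  Real.exp (3 * evolveBound J R) * (evolveTail J R t / t ^ n)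

variable {a b c e a' e' : ℤ} {n : ℕ} {t : ℝ}

theorem IsTruncation.subset (h : IsTruncation R n a b c e a' e') :
    Finset.Ico a' e' ⊆ Finset.Ico a e := Finset.Ico_subset_Ico h.le_left h.right_le

theorem IsLocal.norm_averaged_sub_le (hΦ : IsLocal Φ J R) (hbc : b ≤ c)
    (h : IsTruncation R n a b c e a' e') (ht : 1 ≤ t) :
    ‖(isPartition_Ico (h.le_left.trans h.left_le) hbc (h.le_right.trans h.right_le)).averaged Φ -
      embed h.subset ((isPartition_Ico h.left_le hbc h.le_right).averaged Φ)‖ ≤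
      truncationError J R t n := by
  rw [IsPartition.averaged, IsPartition.averaged, ← thermal_embed_ambient, ← thermal_sub]
  refine (norm_thermal_le _ (isHermitian_neg_hamiltonian Φ _) _).trans ?_
  rw [hΦ.embed_expansional, ← embed_rfl (IsPartition.expansional _ Φ), hΦ.embed_expansional]
  exact norm_expansional_sub_truncation_le (commute_termIn _) (norm_termIn_le hΦ.strength _) hΦ.pos
    hbc h ht

/-- Both sides average over the same B and C, so the contraction property applies to the difference.
-/
theorem IsPartition.norm_leftAveraged_sub_le {A A' B C Λ I : Finset ℤ} (h : IsPartition A B C I)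
    (h' : IsPartition A' B C Λ) (hΛ : Λ ⊆ I) : ‖h.leftAveraged Φ - embed hΛ (h'.leftAveraged Φ)‖ ≤
      ‖h.averaged Φ - embed hΛ (h'.averaged Φ)‖ := by
  rw [leftAveraged, leftAveraged, ← thermal_embed_ambient, ← thermal_sub]
  exact norm_thermal_le _ (isHermitian_neg_hamiltonian Φ _) _

theorem IsPartition.norm_rightAveraged_sub_le {A B C C' Λ I : Finset ℤ} (h : IsPartition A B C I)
    (h' : IsPartition A B C' Λ) (hΛ : Λ ⊆ I) :
    ‖h.symm.leftAveraged Φ - embed hΛ (h'.symm.leftAveraged Φ)‖ ≤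
      ‖h.averaged Φ - embed hΛ (h'.averaged Φ)‖ := by
  rw [← h.averaged_symm, ← h'.averaged_symm]
  exact norm_leftAveraged_sub_le h.symm h'.symm hΛ

/-- The number of sites that are kept by a truncation at distance `n * R`. -/
def truncationWidth (R n : ℕ) : ℕ := (n + 1) * R + 1

theorem isTruncation (R n : ℕ) {a b c e : ℤ} (hab : a ≤ b) (hce : c ≤ e) :
    IsTruncation R n a b c e (max a (b - (n + 1) * R)) (min e (c + truncationWidth R n)) := by
  have h : (0 : ℤ) ≤ (n + 1) * R := by positivity
  have h1 : (truncationWidth R n : ℤ) = (n + 1) * R + 1 := by simp [truncationWidth]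
  rw [h1]
  constructor <;> omega

theorem isTruncation_left (R n : ℕ) {a b c e : ℤ} (hab : a ≤ b) (hce : c ≤ e) :
    IsTruncation R n a b c e (max a (b - (n + 1) * R)) e := by
  have h := isTruncation R n hab hce
  exact ⟨h.le_left, h.left_le, hce, le_rfl, h.left, Or.inl rfl⟩

theorem isTruncation_right (R n : ℕ) {a b c e : ℤ} (hab : a ≤ b) (hce : c ≤ e) :
    IsTruncation R n a b c e a (min e (c + truncationWidth R n)) := by
  have h := isTruncation R n hab hce
  exact ⟨le_rfl, hab, h.le_right, h.right_le, Or.inl rfl, h.right⟩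

theorem card_truncation_left_le (R n : ℕ) (a b : ℤ) :
    (Finset.Ico (max a (b - (n + 1) * R)) b).card ≤ truncationWidth R n := by
  have h1 : (truncationWidth R n : ℤ) = (n + 1) * R + 1 := by simp [truncationWidth]
  rw [Int.card_Ico]
  omega

theorem card_truncation_right_le (R n : ℕ) (c e : ℤ) :
    (Finset.Ico c (min e (c + truncationWidth R n))).card ≤ truncationWidth R n := by
  rw [Int.card_Ico]
  omega

/-- Neumann series: N' p = 1 - z with ‖z‖ ≤ 1/2. -/
theorem exists_left_inv_of_norm_sub_le {𝔐 : Type*} [NormedRing 𝔐] [CompleteSpace 𝔐] [NormOneClass 𝔐]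
    {p p' N' : 𝔐} {x y : ℝ} (hN' : N' * p' = 1) (hx : ‖N'‖ ≤ x) (hy : ‖p - p'‖ ≤ y)
    (hxy : x * y ≤ 1 / 2) : ∃ N : 𝔐, N * p = 1 ∧ ‖N‖ ≤ 2 * x := by
  have hx0 := (norm_nonneg _).trans hx
  set z := N' * (p' - p)
  have hz : ‖z‖ ≤ 1 / 2 := by
    refine (norm_mul_le _ _).trans (le_trans ?_ hxy)
    rw [norm_sub_rev]
    gcongr
  have hz1 : ‖z‖ < 1 := by linarith
  have hNp : N' * p = 1 - z := by
    simp only [z, mul_sub, hN']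
    abel
  refine ⟨(∑' k : ℕ, z ^ k) * N', ?_, ?_⟩
  · rw [mul_assoc, hNp]
    exact geom_series_mul_neg z hz1
  · refine (norm_mul_le _ _).trans (mul_le_mul ?_ hx (norm_nonneg _) zero_le_two)
    refine (tsum_geometric_le_of_norm_lt_one z hz1).trans ?_
    rw [norm_one, sub_self, zero_add]
    exact inv_le_of_inv_le₀ two_pos (by linarith)

/-- The inverse bound at width about nR grows like q^n, while the truncation error is C_t / t^n with
t at our disposal. With t = 2q the product is a constant times 2^{-n}. -/
theorem exists_truncation_le_half {J : ℝ} (hJ : 0 ≤ J) (R : ℕ) : ∃ (n : ℕ) (t : ℝ), 1 ≤ t ∧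
    Real.exp (evolveBound J R) ^ 2 * Real.exp (2 * (J * 2 ^ (2 * R + 1) * truncationWidth R n)) *
      truncationError J R t n ≤ 1 / 2 := by
  set j := J * 2 ^ (2 * R + 1) with hj
  have hj0 : 0 ≤ j := by positivity
  have hE := energyRate_nonneg hJ R
  set q := Real.exp (2 * j * R) with hq
  have hq1 : 1 ≤ q := Real.one_le_exp (by positivity)
  set M := Real.exp (evolveBound J R) ^ 2 * Real.exp (2 * j * (R + 1)) *
    (Real.exp (3 * evolveBound J R) * evolveTail J R (2 * q)) with hM
  have hM0 : 0 ≤ M := by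
    rw [hM]
    have : 0 ≤ evolveTail J R (2 * q) := by unfold evolveTail; positivity
    positivity
  obtain ⟨n, hn⟩ := exists_pow_lt_of_lt_one (show (0 : ℝ) < 1 / (2 * (M + 1)) by positivity)
    (show (1 / 2 : ℝ) < 1 by norm_num)
  refine ⟨n, 2 * q, by linarith, ?_⟩
  have h1 : Real.exp (2 * (j * truncationWidth R n)) = Real.exp (2 * j * (R + 1)) * q ^ n := by
    rw [hq, ← Real.exp_nat_mul, ← Real.exp_add]
    congr 1
    simp only [truncationWidth]
    push_cast
    ring
  have hqn : q ^ n ≠ 0 := by positivity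
  have h2 : Real.exp (evolveBound J R) ^ 2 * Real.exp (2 * (j * truncationWidth R n)) *
      truncationError J R (2 * q) n = M * (1 / 2) ^ n := by
    rw [h1, truncationError, hM, mul_pow, one_div, inv_pow]
    field_simp
  rw [h2]
  calc M * (1 / 2) ^ n ≤ M * (1 / (2 * (M + 1))) := by gcongr
    _ ≤ 1 / 2 := by
      rw [mul_one_div, div_le_iff₀ (by positivity)]
      linarith

/-- The averaged expansionals are uniformly invertible. -/
theorem exists_uniform_inv {J : ℝ} (hJ : 0 ≤ J) (R : ℕ) : ∃ M : ℝ, 0 < M ∧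
    ∀ Φ : LocalInteraction d, IsLocal Φ J R → ∀ (a b c e : ℤ) (hab : a ≤ b) (hbc : b ≤ c) (hce : c ≤ e),
      (∃ N, N * (isPartition_Ico hab hbc hce).leftAveraged Φ = 1 ∧ ‖N‖ ≤ M) ∧
      ∃ N, N * (isPartition_Ico hab hbc hce).symm.leftAveraged Φ = 1 ∧ ‖N‖ ≤ M := by
  obtain ⟨n, t, ht, hn⟩ := exists_truncation_le_half hJ R
  refine ⟨2 * (Real.exp (evolveBound J R) ^ 2 *
    Real.exp (2 * (J * 2 ^ (2 * R + 1) * truncationWidth R n))), by positivity, ?_⟩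
  intro Φ hΦ a b c e hab hbc hce
  constructor
  -- Only A is shortened, so that B and C, over which one averages, stay the same; the width is
  -- fixed once and for all.
  · have h := isTruncation_left R n hab hce (b := b) (c := c)
    obtain ⟨N, hN, hNn⟩ := IsPartition.exists_inv_leftAveraged (hΦ.isBounded h.left_le hbc h.le_right)
      (hΦ.norm_hamiltonian_le (card_truncation_left_le R n a b))
    refine exists_left_inv_of_norm_sub_le (N' := embed h.subset N) ?_ ((norm_embed_le _ _).trans hNn)
      ((IsPartition.norm_leftAveraged_sub_le _ _ _).trans (hΦ.norm_averaged_sub_le hbc h ht)) hn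
    rw [← embed_mul, hN, embed_one]
  · have h := isTruncation_right R n hab hce (b := b) (c := c)
    obtain ⟨N, hN, hNn⟩ := IsPartition.exists_inv_leftAveraged
      (hΦ.isBounded h.left_le hbc h.le_right).symm
      (hΦ.norm_hamiltonian_le (card_truncation_right_le R n c e))
    refine exists_left_inv_of_norm_sub_le (N' := embed h.subset N) ?_ ((norm_embed_le _ _).trans hNn)
      ((IsPartition.norm_rightAveraged_sub_le _ _ _).trans (hΦ.norm_averaged_sub_le hbc h ht)) hn
    rw [← embed_mul, hN, embed_one]

/-- The averaged expansional is close to the product of its averages. -/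
theorem IsLocal.norm_averaged_sub_ratio_smul_le (hΦ : IsLocal Φ J R) (hab : a ≤ b) (hbc : b ≤ c)
    (hce : c ≤ e) (n : ℕ) (ht : 1 ≤ t) {ε : ℝ} (hε : 0 ≤ ε)
    (hcorr : ∀ a' e', a' ≤ b → c ≤ e' →
      corr (Φ.gibbs (Finset.Ico a' e')) (Finset.Ico a' b) (Finset.Ico c e') ≤ ε) :
    ‖(isPartition_Ico hab hbc hce).averaged Φ - (isPartition_Ico hab hbc hce).ratio Φ •
      ((isPartition_Ico hab hbc hce).symm.leftAveraged Φ *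
        (isPartition_Ico hab hbc hce).leftAveraged Φ)‖ ≤
      4 * Real.exp (evolveBound J R) ^ 4 * (truncationError J R t n +
        Real.exp (evolveBound J R) * ε * ((d : ℝ) ^ truncationWidth R n) ^ 6 *
          Real.exp (J * 2 ^ (2 * R + 1) * truncationWidth R n) ^ 4) := by
  have hJ := hΦ.strength_nonneg
  have hE := energyRate_nonneg hJ R
  have hg1 : 1 ≤ Real.exp (evolveBound J R) := Real.one_le_exp (by unfold evolveBound; positivity)
  have h := isTruncation R n hab hce (b := b) (c := c)
  set a' := max a (b - (n + 1) * R)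
  set e' := min e (c + truncationWidth R n)
  set h' := isPartition_Ico h.left_le hbc h.le_right
  have hg' := hΦ.isBounded h.left_le hbc h.le_right
  obtain ⟨P, hP⟩ := h'.exists_leftAveraged_eq_embed (Φ := Φ)
  obtain ⟨Q, hQ⟩ := h'.symm.exists_leftAveraged_eq_embed (Φ := Φ)
  have hA : Finset.Ico a' b ⊆ Finset.Ico a b := Finset.Ico_subset_Ico_left h.le_left
  have hC : Finset.Ico c e' ⊆ Finset.Ico c e := Finset.Ico_subset_Ico_right h.right_le
  -- The ratio of the truncated system is absorbed into P, hence the bound g² for P and g for Q.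
  have heP : embed (isPartition_Ico hab hbc hce).left (embed hA (h'.ratio Φ • P)) =
      h'.ratio Φ • embed h.subset (h'.leftAveraged Φ) := by
    rw [hP, embed_embed, embed_embed, embed_smul]
  have heQ : embed (isPartition_Ico hab hbc hce).right (embed hC Q) =
      embed h.subset (h'.symm.leftAveraged Φ) := by
    rw [hQ, embed_embed, embed_embed]
  refine IsPartition.norm_averaged_sub_ratio_smul_le hg1 (hΦ.isBounded hab hbc hce)
    (P := embed hA (h'.ratio Φ • P)) (Q := embed hC Q) ?_ ?_ ?_
  · rw [heP, norm_smul, sq]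
    exact mul_le_mul (IsPartition.norm_ratio_le hg')
      ((norm_embed_le _ _).trans hg'.norm_leftAveraged_le) (norm_nonneg _) (Real.exp_pos _).le
  · rw [heQ]
    exact (norm_embed_le _ _).trans hg'.symm.norm_leftAveraged_le
  · rw [heP, heQ]
    refine (norm_sub_le_norm_sub_add_norm_sub _ (embed h.subset (h'.averaged Φ)) _).trans
      (add_le_add (hΦ.norm_averaged_sub_le hbc h ht) ?_)
    have h1 : embed h.subset (h'.averaged Φ) - h'.ratio Φ • embed h.subset (h'.leftAveraged Φ) *
        embed h.subset (h'.symm.leftAveraged Φ) = embed h.subset (h'.averaged Φ -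
          h'.ratio Φ • (h'.leftAveraged Φ * h'.symm.leftAveraged Φ)) := by
      simp only [← embedHom_apply, map_sub, map_smul, map_mul, Matrix.smul_mul]
    rw [h1]
    exact (norm_embed_le _ _).trans (IsPartition.norm_averaged_sub_le hg'
      (hΦ.norm_hamiltonian_le (card_truncation_left_le R n a b))
      (hΦ.norm_hamiltonian_le (card_truncation_right_le R n c e))
      (card_truncation_left_le R n a b) (card_truncation_right_le R n c e)
      (hcorr a' e' h.left_le h.le_right) hε)

/-- The number of sites that are kept is chosen proportional to `ℓ`. -/
theorem exists_exp_rate {J Kt αt : ℝ} (hJ : 0 ≤ J) (R d : ℕ) [NeZero d] (hKt : 0 < Kt) (hαt : 0 < αt) :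
    ∃ K α : ℝ, 0 < K ∧ 0 < α ∧ ∀ ℓ : ℝ, 0 ≤ ℓ → ∃ n : ℕ, truncationError J R (Real.exp 1) n +
        Real.exp (evolveBound J R) * (Kt * Real.exp (-αt * ℓ)) * ((d : ℝ) ^ truncationWidth R n) ^ 6 *
          Real.exp (J * 2 ^ (2 * R + 1) * truncationWidth R n) ^ 4 ≤ K * Real.exp (-α * ℓ) := by
  have hE := energyRate_nonneg hJ R
  have hd1 : (1 : ℝ) ≤ d := by exact_mod_cast NeZero.one_le
  have hd0 : (0 : ℝ) < d := one_pos.trans_le hd1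
  set j := J * 2 ^ (2 * R + 1) with hj
  have hj0 : 0 ≤ j := by positivity
  -- The growth rate, per kept site, of the losses d^{6m} e^{4jm}.
  set lam := 6 * Real.log d + 4 * j with hlam
  have hlam0 : 0 ≤ lam := by
    have := Real.log_nonneg hd1
    positivity
  set T := Real.exp (3 * evolveBound J R) * evolveTail J R (Real.exp 1) with hT
  have hT0 : 0 ≤ T := by
    have : 0 ≤ evolveTail J R (Real.exp 1) := by unfold evolveTail; positivity
    positivity
  -- Chosen so that keeping about εℓR sites spends at most half of the clustering rate; the + 1
  -- keeps the denominator positive.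
  set ε := αt / (2 * (lam * R + 1)) with hε
  have hε0 : 0 < ε := by positivity
  have hεl : lam * R * ε ≤ αt / 2 := by
    rw [hε, mul_div_assoc', div_le_iff₀ (by positivity)]
    nlinarith [mul_nonneg hlam0 (Nat.cast_nonneg (α := ℝ) R)]
  -- The factor e compensates the rounding in n = ⌊εℓ⌋. The two summands bound the truncation error
  -- and the correlation error.
  refine ⟨T * Real.exp 1 + Real.exp (evolveBound J R) * Kt * Real.exp (lam * (R + 1)),
    min ε (αt / 2), by positivity, by positivity, fun ℓ hℓ => ⟨⌊ε * ℓ⌋₊, ?_⟩⟩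
  set n := ⌊ε * ℓ⌋₊
  have hn1 : (n : ℝ) ≤ ε * ℓ := Nat.floor_le (by positivity)
  have hn2 : ε * ℓ < n + 1 := Nat.lt_floor_add_one _
  have hα1 : min ε (αt / 2) * ℓ ≤ ε * ℓ := by gcongr; exact min_le_left _ _
  have hα2 : min ε (αt / 2) * ℓ ≤ αt / 2 * ℓ := by gcongr; exact min_le_right _ _
  rw [add_mul]
  apply add_le_add
  · have h1 : truncationError J R (Real.exp 1) n = T * Real.exp (-n) := by
      rw [truncationError, hT, ← Real.exp_nat_mul, mul_one, Real.exp_neg]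
      ring
    clear_value T
    rw [h1, mul_assoc, ← Real.exp_add]
    gcongr
    linarith
  · have h1 : ((d : ℝ) ^ truncationWidth R n) ^ 6 * Real.exp (j * truncationWidth R n) ^ 4 =
        Real.exp (lam * (R + 1)) * Real.exp (lam * R * n) := by
      rw [← Real.exp_log (pow_pos hd0 (truncationWidth R n)), Real.log_pow, ← Real.exp_nat_mul,
        ← Real.exp_nat_mul, ← Real.exp_add, ← Real.exp_add]
      congr 1
      rw [hlam]
      simp only [truncationWidth]
      push_cast
      ring
    calc _ = Real.exp (evolveBound J R) * Kt * (((d : ℝ) ^ truncationWidth R n) ^ 6 *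
          Real.exp (j * truncationWidth R n) ^ 4) * Real.exp (-αt * ℓ) := by ring
      _ = Real.exp (evolveBound J R) * Kt * Real.exp (lam * (R + 1)) *
          Real.exp (lam * R * n + -αt * ℓ) := by
          rw [h1, Real.exp_add]
          ring
      _ ≤ _ := by
          gcongr
          have h2 : lam * R * n ≤ lam * R * (ε * ℓ) := by gcongr
          have h3 : lam * R * ε * ℓ ≤ αt / 2 * ℓ := by gcongr
          linarith

end Intervals

/-! ### Conclusion. -/

theorem isLocal_dropConst {d : ℕ} {Φ : LocalInteraction d} {r J : ℝ} (hr : Φ.HasRange r) (hr0 : 0 < r)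
    (hJ : Φ.HasStrength J) : IsLocal Φ.dropConst J ⌈r⌉₊ where
  range X hX := by
    simp only [LocalInteraction.dropConst]
    split_ifs
    · rfl
    · exact hr X ((Nat.le_ceil r).trans_lt hX)
  strength X := by
    simp only [LocalInteraction.dropConst]
    split_ifs
    · rw [norm_zero]
      exact (norm_nonneg _).trans (hJ ∅)
    · exact hJ X
  term_empty := by simp [LocalInteraction.dropConst]
  pos := Nat.ceil_pos.2 hr0

end SpinChain

/-- `I = [a, e)` is split into `A = [a, b)`, `B = [b, c)`, `C = [c, e)`. -/
theorem proposition8p1 (d : ℕ) (hd : 0 < d) (r J Kt αt : ℝ)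
    (hr : 0 < r) (hJ : 0 < J) (hKt : 0 < Kt) (hαt : 0 < αt) :
    ∃ K α : ℝ, 0 < K ∧ 0 < α ∧
      ∀ Φ : SpinChain.LocalInteraction d, Φ.HasRange r → Φ.HasStrength J →
        Φ.UniformClustering (fun ℓ => Kt * Real.exp (-αt * ℓ)) →
        ∀ (a b c e : ℤ) (hab : a ≤ b) (hbc : b ≤ c) (hce : c ≤ e) (ℓ : ℝ),
          0 ≤ 3 * ℓ → 3 * ℓ ≤ (Finset.Ico b c).card →
          ‖(SpinChain.reduced
                (Finset.Ico_subset_Ico_right (hbc.trans hce) : Finset.Ico a b ⊆ Finset.Ico a e)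
                (Φ.gibbs (Finset.Ico a e)))⁻¹ *
              (SpinChain.reduced
                (Finset.Ico_subset_Ico_left (hab.trans hbc) : Finset.Ico c e ⊆ Finset.Ico a e)
                (Φ.gibbs (Finset.Ico a e)))⁻¹ *
              SpinChain.reduced
                (Finset.union_subset (Finset.Ico_subset_Ico_right (hbc.trans hce))
                  (Finset.Ico_subset_Ico_left (hab.trans hbc)) :
                  Finset.Ico a b ∪ Finset.Ico c e ⊆ Finset.Ico a e)
                (Φ.gibbs (Finset.Ico a e)) - 1‖
            ≤ K * Real.exp (-α * ℓ) := by
  open SpinChain in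
  have : NeZero d := ⟨hd.ne'⟩
  obtain ⟨M, hM, hinv⟩ := exists_uniform_inv (d := d) hJ.le ⌈r⌉₊
  obtain ⟨K, α, hK, hα, hrate⟩ := exists_exp_rate hJ.le ⌈r⌉₊ d hKt hαt
  set g := Real.exp (evolveBound J ⌈r⌉₊) with hg
  refine ⟨g * M ^ 2 * (4 * g ^ 4 * K), α, by positivity, hα, ?_⟩
  intro Φ hr' hJ' hcl a b c e hab hbc hce ℓ hℓ hℓB
  have hΦ := isLocal_dropConst hr' hr hJ'
  have hℓ0 : 0 ≤ ℓ := by linarith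
  obtain ⟨n, hn⟩ := hrate ℓ hℓ0
  obtain ⟨⟨N, hN, hNM⟩, N', hN', hN'M⟩ := hinv _ hΦ a b c e hab hbc hce
  have hcorr : ∀ a' e', a' ≤ b → c ≤ e' →
      corr (Φ.dropConst.gibbs (Finset.Ico a' e')) (Finset.Ico a' b) (Finset.Ico c e') ≤
        Kt * Real.exp (-αt * ℓ) := fun a' e' ha' he' => by
    rw [gibbs_dropConst]
    -- Clustering is applied to the Gibbs state of the truncated interval, not to a restriction of
    -- ρ^I, which is why it must hold uniformly in the interval. The middle part is still B.
    exact hcl.corr_le a' b c e' ha' hbc he' ℓ hℓ0 (by linarith)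
  have hclose := hΦ.norm_averaged_sub_ratio_smul_le hab hbc hce n (Real.one_le_exp zero_le_one)
    (by positivity) hcorr
  have hmix := IsPartition.norm_mixing_le (hΦ.isBounded hab hbc hce) hN hN' hNM hN'M
    (Finset.union_subset (isPartition_Ico hab hbc hce).left (isPartition_Ico hab hbc hce).right) hclose
  rw [gibbs_dropConst] at hmix
  refine hmix.trans ?_
  rw [← hg]
  calc _ ≤ g * M ^ 2 * (4 * g ^ 4 * (K * Real.exp (-α * ℓ))) := by gcongr
    _ = _ := by ring
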